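/- Let $N\in\mathbb N$, $s\in(0,1)$ with $N>2s$, let $\alpha\in(0,N)$, and let $$\frac{N+\alpha}{N}<q<p=\frac{N+2s+\alpha}{N}.$$ Let $I_\alpha(x)=A_\alpha|x|^{-(N-\alpha)}$ with $A_\alpha=\frac{\Gamma((N-\alpha)/2)}{\Gamma(\alpha/2)\,\pi^{N/2}2^{\alpha}}$, and let $$H^s(\mathbb R^N)=\Big\{u\in L^2(\mathbb R^N;\mathbb R):\ \iint_{\mathbb R^{2N}}\frac{|u(x)-u(y)|^2}{|x-y|^{N+2s}}\,dx\,dy<\infty\Big\},$$ $$\langle u,v\rangle_s=\int_{\mathbb R^N}(-\Delta)^{s/2}u\,(-\Delta)^{s/2}v\,dx=\frac{C(N,s)}{2}\iint_{\mathbb R^{2N}}\frac{(u(x)-u(y))(v(x)-v(y))}{|x-y|^{N+2s}}\,dx\,dy,\qquad \|u\|^2=\langle u,u\rangle_s,$$ where $C(N,s)=\frac{s\,4^s\,\Gamma(N/2+s)}{\pi^{N/2}\,\Gamma(1-s)}$ is the usual normalization constant of the fractional Laplacian. Consider measurable functions $V,f,g\in L^\infty(\mathbb R^N)$ and the conditions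 * $(V)$: $0\le V(x)\le V_\infty:=\lim_{|x|\to\infty}V(x)$ for all $x\in\mathbb R^N$; * $(f)$: $0<f_\infty:=\lim_{|x|\to\infty}f(x)\le f(x)\le f_{max}$ for all $x\in\mathbb R^N$; * $(g)$: $0<g_\infty:=\lim_{|x|\to\infty}g(x)\le g(x)\le g_{max}$ for all $x\in\mathbb R^N$. Let $C_{\alpha,p}$ be the best constant in the fractional Gagliardo–Nirenberg–Hardy–Littlewood–Sobolev inequality $$\int_{\mathbb R^N}(I_\alpha*|u|^p)|u|^p\,dx\le C_{\alpha,p}\,\|u\|^{2}\,\|u\|_2^{2p-2},\qquad u\in H^s(\mathbb R^N),$$ and put $a^*=\left(\frac{p}{C_{\alpha,p}\,g_{max}^2}\right)^{\frac1{p-1}}$. Let $$J(u)=\frac12\|u\|^2+\frac12\int_{\mathbb R^N}V u^2\,dx-\frac1{2q}\int_{\mathbb R^N}(I_\alpha*(f|u|^q))f|u|^q\,dx-\frac1{2p}\int_{\mathbb R^N}(I_\alpha*(g|u|^p))g|u|^p\,dx$$ and $S(a)=\{u\in H^s(\mathbb R^N):\int_{\mathbb R^N}u^2\,dx=a\}$.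 **Theorem.** Let $f$ and $g$ satisfy $(f)$ and $(g)$, and let $0<a<a^*$. Then there is $V_*>0$ such that, for every $V$ which satisfies $(V)$ and $\|V\|_\infty<V_*$, there are $u\in S(a)$ and $\lambda\in\mathbb R$ with $\lambda<0$ and $J(u)<0$ such that $u$ minimizes $J$ on $S(a)$ and $u$ is a weak solution of $$(-\Delta)^su+V(x)u=\lambda u+f(x)\,(I_\alpha*(f|u|^q))\,|u|^{q-2}u+g(x)\,(I_\alpha*(g|u|^p))\,|u|^{p-2}u\quad\text{in }\mathbb R^N,$$ that is, for all $\varphi\in H^s(\mathbb R^N)$ (all integrals being absolutely convergent), $$\langle u,\varphi\rangle_s+\int V u\varphi\,dx=\lambda\int u\varphi\,dx+\int f(I_\alpha*(f|u|^q))|u|^{q-2}u\varphi\,dx+\int g(I_\alpha*(g|u|^p))|u|^{p-2}u\varphi\,dx.$$ -/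

import Mathlib

open MeasureTheory Filter
open scoped Topology ENNReal

namespace FracChoquard

noncomputable section

/-- `ℝ^N` with its Euclidean norm. -/
abbrev Space (N : ℕ) : Type := EuclideanSpace ℝ (Fin N)

/-- The normalization constant `C(N,s)` of the fractional Laplacian
`(-Δ)^s u(x) = C(N,s) P.V. ∫ (u(x) - u(y)) / |x - y|^(N+2s) dy`, that is the reciprocal of
`∫ (1 - cos ζ₁) / |ζ|^(N+2s) dζ`, in closed form. -/
def fracConst (N : ℕ) (s : ℝ) : ℝ :=
  s * (4 : ℝ) ^ s * Real.Gamma ((N : ℝ) / 2 + s) /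
    (Real.pi ^ ((N : ℝ) / 2) * Real.Gamma (1 - s))

/-- The integrand of the Gagliardo form of order `s`. -/
def gagliardoKernel {N : ℕ} (s : ℝ) (u v : Space N → ℝ) (z : Space N × Space N) : ℝ :=
  (u z.1 - u z.2) * (v z.1 - v z.2) / ‖z.1 - z.2‖ ^ ((N : ℝ) + 2 * s)

/-- `u` belongs to the (real) fractional Sobolev space `H^s(ℝ^N)`: it is square integrable and
`∫∫ |u(x) - u(y)|^2 / |x - y|^(N+2s) dx dy` is finite. -/
structure MemHs {N : ℕ} (s : ℝ) (u : Space N → ℝ) : Prop where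
  memLp : MemLp u 2 volume
  gagliardo : Integrable (gagliardoKernel s u u) (volume.prod volume)

/-- The bilinear form of `(-Δ)^s`,
`∫ (-Δ)^(s/2) u (-Δ)^(s/2) v dx
  = C(N,s)/2 ∫∫ (u(x) - u(y)) (v(x) - v(y)) / |x - y|^(N+2s) dx dy`. -/
def fracForm {N : ℕ} (s : ℝ) (u v : Space N → ℝ) : ℝ :=
  fracConst N s / 2 *
    (∫ z : Space N × Space N, gagliardoKernel s u v z ∂(volume.prod volume))

/-- The seminorm `‖u‖ = (∫ |(-Δ)^(s/2) u|^2 dx)^(1/2)`. -/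
def fracNorm {N : ℕ} (s : ℝ) (u : Space N → ℝ) : ℝ := √(fracForm s u u)

/-- The norm `‖u‖₂` of `L^2(ℝ^N)`. -/
def normTwo {N : ℕ} (u : Space N → ℝ) : ℝ := √(∫ x, u x ^ 2)

/-- The constant `A_α` of the Riesz potential. -/
def rieszConst (N : ℕ) (α : ℝ) : ℝ :=
  Real.Gamma (((N : ℝ) - α) / 2) / (Real.Gamma (α / 2) * Real.pi ^ ((N : ℝ) / 2) * (2 : ℝ) ^ α)

/-- The Riesz kernel `I_α(x) = A_α / |x|^(N-α)`. -/
def rieszKernel {N : ℕ} (α : ℝ) (x : Space N) : ℝ :=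
  rieszConst N α / ‖x‖ ^ ((N : ℝ) - α)

/-- The convolution `I_α * h`. -/
def rieszPotential {N : ℕ} (α : ℝ) (h : Space N → ℝ) (x : Space N) : ℝ :=
  ∫ y, rieszKernel α (x - y) * h y

/-- The nonlocal energy `∫ (I_α * (w|u|^t)) w|u|^t dx` with weight `w`. -/
def choquardEnergy {N : ℕ} (α t : ℝ) (w u : Space N → ℝ) : ℝ :=
  ∫ x, rieszPotential α (fun y => w y * |u y| ^ t) x * (w x * |u x| ^ t)

/-- The nonlocal nonlinearity `w (I_α * (w|u|^t)) |u|^(t-2) u` with weight `w`. -/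
def choquardTerm {N : ℕ} (α t : ℝ) (w u : Space N → ℝ) (x : Space N) : ℝ :=
  w x * rieszPotential α (fun y => w y * |u y| ^ t) x * |u x| ^ (t - 2) * u x

/-- The energy functional `J`. -/
def energy {N : ℕ} (s α q p : ℝ) (V f g u : Space N → ℝ) : ℝ :=
  1 / 2 * fracForm s u u + 1 / 2 * (∫ x, V x * u x ^ 2)
    - 1 / (2 * q) * choquardEnergy α q f u - 1 / (2 * p) * choquardEnergy α p g u

/-- The constraint `S(a) = {u ∈ H^s(ℝ^N) : ∫ |u|^2 dx = a}`. -/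
def massSphere {N : ℕ} (s a : ℝ) : Set (Space N → ℝ) :=
  {u | MemHs s u ∧ (∫ x, u x ^ 2) = a}

/-- `u ∈ H^s(ℝ^N)` is a weak solution of
`(-Δ)^s u + V u = lam u + f (I_α * (f|u|^q)) |u|^(q-2) u + g (I_α * (g|u|^p)) |u|^(p-2) u`,
tested with all of `H^s(ℝ^N)`. The nonlocal terms are required to converge absolutely. -/
structure IsWeakSolution {N : ℕ} (s α q p : ℝ) (V f g : Space N → ℝ) (lam : ℝ)
    (u : Space N → ℝ) : Prop where
  memHs : MemHs s u
  conv_f : ∀ᵐ x, Integrable (fun y => rieszKernel α (x - y) * (f y * |u y| ^ q))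
  conv_g : ∀ᵐ x, Integrable (fun y => rieszKernel α (x - y) * (g y * |u y| ^ p))
  integrable_f : ∀ φ : Space N → ℝ, MemHs s φ →
    Integrable (fun x => choquardTerm α q f u x * φ x)
  integrable_g : ∀ φ : Space N → ℝ, MemHs s φ →
    Integrable (fun x => choquardTerm α p g u x * φ x)
  eqn : ∀ φ : Space N → ℝ, MemHs s φ →
    fracForm s u φ + (∫ x, V x * u x * φ x)
      = lam * (∫ x, u x * φ x) + (∫ x, choquardTerm α q f u x * φ x)
        + (∫ x, choquardTerm α p g u x * φ x)

/-- The exponent `γ_{t,s} = (N t - N - α) / (2 t s)`. -/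
def gnExponent (N : ℕ) (s α t : ℝ) : ℝ :=
  ((N : ℝ) * t - N - α) / (2 * t * s)

/-- The optimal constant `C_{α,t}` in
`∫ (I_α * |u|^t) |u|^t dx ≤ C ‖u‖^(2tγ) ‖u‖₂^(2t(1-γ))` for `u ∈ H^s(ℝ^N)`, with
`γ = γ_{t,s}`. -/
def gnConst (N : ℕ) (s α t : ℝ) : ℝ :=
  sInf {C : ℝ | 0 ≤ C ∧ ∀ u : Space N → ℝ, MemHs s u →
    choquardEnergy α t (fun _ => 1) u
      ≤ C * fracNorm s u ^ (2 * t * gnExponent N s α t)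
          * normTwo u ^ (2 * t * (1 - gnExponent N s α t))}

/-- The mass threshold `a^* = (p / (C_{α,p} g_max^2))^(1/(p-1))`. -/
def massThreshold (N : ℕ) (s α p gmax : ℝ) : ℝ :=
  (p / (gnConst N s α p * gmax ^ 2)) ^ (1 / (p - 1))

/-- Condition `(V)`: `V ∈ L^∞` and `0 ≤ V(x) ≤ V_∞ = lim_{|x| → ∞} V(x)` for all `x`. -/
structure CondV {N : ℕ} (V : Space N → ℝ) (Vinf : ℝ) : Prop where
  memLp : MemLp V ∞ volume
  tendsto : Tendsto V (cocompact (Space N)) (𝓝 Vinf)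
  nonneg : ∀ x, 0 ≤ V x
  le_lim : ∀ x, V x ≤ Vinf

/-- Conditions `(f)` and `(g)` on a weight `w`: `w ∈ L^∞` and
`0 < w_∞ = lim_{|x| → ∞} w(x) ≤ w(x) ≤ w_max` for all `x`. -/
structure CondW {N : ℕ} (w : Space N → ℝ) (winf wmax : ℝ) : Prop where
  memLp : MemLp w ∞ volume
  tendsto : Tendsto w (cocompact (Space N)) (𝓝 winf)
  lim_pos : 0 < winf
  lim_le : ∀ x, winf ≤ w x
  le_max : ∀ x, w x ≤ wmax

end

end FracChoquard

open FracChoquard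

/-! The proof is the direct method on S(a). Compactness is recovered from a scaling inequality in
the mass and from comparison with the problem at infinity.

The level is finite and negative. Since p is the mass-critical power, the inequality defining
C_{α,p} bounds the p-term by a multiple of the kinetic energy, and a < a^* makes this multiple
smaller than the available one. The q-term grows like a power less than 1 of the kinetic energy, so
it is absorbed (`exists_coercive`). Spreading a function out by dilations that preserve the L² norm,
the q-term decays more slowly than the kinetic term, so the energy without potential takes a
negative value e₀ at some w in S(a) (`exists_energy_neg`). The value stays negative when ‖V‖_∞ < V_*
= -e₀/a.

Minimizing sequences converge. A minimizing sequence is bounded in H^s, hence converges a.e. along a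
subsequence to some U (`exists_subseq_tendsto_ae`). For θ ≥ 1, J(√θ u) ≤ θ J(u) - (θ^p - θ)
D_p(u)/(2p), where D_p is the p-term (`energy_sqrt_mul_le`). If U ≠ 0, this and the Brezis-Lieb
splitting of J exclude a loss of mass, and U is a minimizer (`mem_massSphere_of_tendsto`). If U = 0,
the coefficients may be replaced by their limits at infinity: J_∞(u_n) → m = inf J
(`tendsto_energy_sub`). As m < 0, the sequence does not vanish in the sense of Lions
(`exists_frequently_mass`), so suitable translates have a nonzero limit X. The same splitting
argument, applied to J_∞ with the lower bound m ≤ J ≤ J_∞, gives X in S(a) and J_∞(X) ≤ m. Then J(X)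
≤ J_∞(X) ≤ m, so X minimizes J. No strict inequality between the two levels is needed
(`exists_isMinOn_energy`).

The equation follows by differentiating J along the curve u + εφ rescaled to mass a
(`euler_lagrange`). The multiplier satisfies λa = ‖u‖² + ∫Vu² - D_q(u) - D_p(u) ≤ 2J(u) < 0, because
p, q > 1.

The analytic input is elementary. The embedding into L^r, 2 ≤ r ≤ 2 + 4s/N, comes from a pointwise
estimate by averages over balls, which also yields Lions' vanishing lemma. The role of the
Hardy-Littlewood-Sobolev inequality is played by a Young inequality for a kernel split at |z| = 1
(`RieszSplit`), at the price of two exponents on either side of 2N/(N+α). Local compactness comes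
from comparing u with its averages over small balls. -/

open FracChoquard

namespace FracChoquard

/-! ### Algebra of the Gagliardo form and of weighted L² forms -/

section Basic

variable {N : ℕ} {s : ℝ} {u v : Space N → ℝ}

/-- The squared Gagliardo seminorm, without the normalization constant. -/
noncomputable def gagliardoSq (s : ℝ) (u : Space N → ℝ) : ℝ :=
  ∫ z : Space N × Space N, gagliardoKernel s u u z ∂(volume.prod volume)

lemma fracForm_self : fracForm s u u = fracConst N s / 2 * gagliardoSq s u := rfl

lemma fracConst_pos (hs0 : 0 < s) (hs1 : s < 1) : 0 < fracConst N s := by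
  have h1 := Real.Gamma_pos_of_pos (s := (N : ℝ) / 2 + s) (by positivity)
  have h2 := Real.Gamma_pos_of_pos (s := 1 - s) (by linarith)
  have := Real.pi_pos
  unfold fracConst
  positivity

lemma gagliardoKernel_self_nonneg (z : Space N × Space N) : 0 ≤ gagliardoKernel s u u z :=
  div_nonneg (mul_self_nonneg _) (by positivity)

lemma gagliardoSq_nonneg : 0 ≤ gagliardoSq s u :=
  integral_nonneg fun z => gagliardoKernel_self_nonneg z

lemma aestronglyMeasurable_gagliardoKernel (hu : AEStronglyMeasurable u volume)
    (hv : AEStronglyMeasurable v volume) :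
    AEStronglyMeasurable (gagliardoKernel s u v) (volume.prod volume) := by
  have h1 : Measurable fun z : Space N × Space N => ‖z.1 - z.2‖ ^ ((N : ℝ) + 2 * s) := by
    fun_prop
  exact (((hu.comp_fst.sub hu.comp_snd).mul (hv.comp_fst.sub hv.comp_snd)).aemeasurable.div
    h1.aemeasurable).aestronglyMeasurable

lemma integrable_gagliardoKernel (hu : MemHs s u) (hv : MemHs s v) :
    Integrable (gagliardoKernel s u v) (volume.prod volume) := by
  refine (hu.gagliardo.add hv.gagliardo).mono'
    (aestronglyMeasurable_gagliardoKernel hu.memLp.1 hv.memLp.1) (Eventually.of_forall fun z => ?_)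
  have hd : 0 ≤ ‖z.1 - z.2‖ ^ ((N : ℝ) + 2 * s) := by positivity
  simp only [gagliardoKernel, Pi.add_apply, ← add_div, Real.norm_eq_abs, abs_div, abs_of_nonneg hd]
  gcongr
  rw [abs_le]
  constructor <;> nlinarith [sq_nonneg ((u z.1 - u z.2) + (v z.1 - v z.2)),
    sq_nonneg ((u z.1 - u z.2) - (v z.1 - v z.2)), sq_nonneg (u z.1 - u z.2),
    sq_nonneg (v z.1 - v z.2)]

lemma gagliardoKernel_lincomb (c d : ℝ) (z : Space N × Space N) :
    gagliardoKernel s (fun x => c * u x + d * v x) (fun x => c * u x + d * v x) z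
      = c ^ 2 * gagliardoKernel s u u z + 2 * c * d * gagliardoKernel s u v z
        + d ^ 2 * gagliardoKernel s v v z := by
  simp only [gagliardoKernel]
  ring

lemma MemHs.lincomb (hu : MemHs s u) (hv : MemHs s v) (c d : ℝ) :
    MemHs s (fun x => c * u x + d * v x) := by
  refine ⟨(hu.memLp.const_mul c).add (hv.memLp.const_mul d), ?_⟩
  refine (((hu.gagliardo.const_mul (c ^ 2)).add
    ((integrable_gagliardoKernel hu hv).const_mul (2 * c * d))).add
    (hv.gagliardo.const_mul (d ^ 2))).congr (Eventually.of_forall fun z => ?_)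
  simp [gagliardoKernel_lincomb]

lemma MemHs.const_mul (hu : MemHs s u) (c : ℝ) : MemHs s (fun x => c * u x) := by
  simpa using hu.lincomb hu c 0

lemma MemHs.sub (hu : MemHs s u) (hv : MemHs s v) : MemHs s (fun x => u x - v x) := by
  simpa [sub_eq_add_neg] using hu.lincomb hv 1 (-1)

lemma fracForm_lincomb (hu : MemHs s u) (hv : MemHs s v) (c d : ℝ) :
    fracForm s (fun x => c * u x + d * v x) (fun x => c * u x + d * v x)
      = c ^ 2 * fracForm s u u + 2 * c * d * fracForm s u v + d ^ 2 * fracForm s v v := by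
  have h1 := hu.gagliardo.const_mul (c ^ 2)
  have h2 := (integrable_gagliardoKernel hu hv).const_mul (2 * c * d)
  have h3 := hv.gagliardo.const_mul (d ^ 2)
  simp only [fracForm, gagliardoKernel_lincomb]
  have h12 : Integrable (fun z => c ^ 2 * gagliardoKernel s u u z
      + 2 * c * d * gagliardoKernel s u v z) (volume.prod volume) := h1.add h2
  rw [integral_add h12 h3, integral_add h1 h2]
  simp only [integral_const_mul]
  ring

lemma gagliardoSq_const_mul (c : ℝ) : gagliardoSq s (fun x => c * u x) = c ^ 2 * gagliardoSq s u := by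
  unfold gagliardoSq
  rw [← integral_const_mul]
  congr 1
  ext z
  simp only [gagliardoKernel]
  ring

lemma gagliardoSq_sub_le (hu : MemHs s u) (hv : MemHs s v) :
    gagliardoSq s (fun x => u x - v x) ≤ 2 * gagliardoSq s u + 2 * gagliardoSq s v := by
  unfold gagliardoSq
  rw [← integral_const_mul, ← integral_const_mul,
    ← integral_add (hu.gagliardo.const_mul 2) (hv.gagliardo.const_mul 2)]
  refine integral_mono (hu.sub hv).gagliardo
    ((hu.gagliardo.const_mul 2).add (hv.gagliardo.const_mul 2)) fun z => ?_
  simp only [gagliardoKernel, ← mul_div_assoc, ← add_div]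
  gcongr
  nlinarith [sq_nonneg ((u z.1 - u z.2) + (v z.1 - v z.2))]

lemma Integrable.weight {X : Type*} [MeasurableSpace X] {μ : Measure X} {w h : X → ℝ} {C : ℝ}
    (hw : AEStronglyMeasurable w μ) (hC : ∀ x, |w x| ≤ C) (hh : Integrable h μ) :
    Integrable (fun x => w x * h x) μ := by
  refine (hh.norm.const_mul C).mono' (hw.mul hh.1) (Eventually.of_forall fun x => ?_)
  simp only [norm_mul, Real.norm_eq_abs]
  exact mul_le_mul_of_nonneg_right (hC x) (abs_nonneg _)

lemma integral_sq_lincomb {X : Type*} [MeasurableSpace X] {μ : Measure X} {u v w : X → ℝ} {C : ℝ}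
    (hw : AEStronglyMeasurable w μ) (hC : ∀ x, |w x| ≤ C) (hu : MemLp u 2 μ) (hv : MemLp v 2 μ)
    (c d : ℝ) :
    ∫ x, w x * (c * u x + d * v x) ^ 2 ∂μ
      = c ^ 2 * (∫ x, w x * u x ^ 2 ∂μ) + 2 * c * d * (∫ x, w x * u x * v x ∂μ)
        + d ^ 2 * (∫ x, w x * v x ^ 2 ∂μ) := by
  have h1 : Integrable (fun x => w x * u x ^ 2) μ := Integrable.weight hw hC hu.integrable_sq
  have h2 : Integrable (fun x => w x * u x * v x) μ := by
    simpa [mul_assoc] using Integrable.weight hw hC (hu.integrable_mul hv)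
  have h3 : Integrable (fun x => w x * v x ^ 2) μ := Integrable.weight hw hC hv.integrable_sq
  have h12 : Integrable (fun x => c ^ 2 * (w x * u x ^ 2) + 2 * c * d * (w x * u x * v x)) μ :=
    (h1.const_mul _).add (h2.const_mul _)
  rw [← integral_const_mul, ← integral_const_mul, ← integral_const_mul,
    ← integral_add (h1.const_mul _) (h2.const_mul _), ← integral_add h12 (h3.const_mul _)]
  congr 1
  ext x
  ring

end Basic

/-! ### Embedding of H^s into L^r and Lions' inequality -/

section Embedding

variable {N : ℕ} {s : ℝ}

/-- Average u(x)² ≤ 2(u(x)-u(y))² + 2u(y)² over y in the ball of radius δ, where |x-y|^(N+2s) ≤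
δ^(N+2s). The free scale δ is optimized later, separately at each x; δ ≤ 1 keeps the ball inside the
unit ball, on which E bounds the mass. -/
lemma sq_le_of_ball (hs0 : 0 < s) {u : Space N → ℝ} (hu : MemLp u 2 volume) {x : Space N}
    (hG : Integrable fun y => gagliardoKernel s u u (x, y)) {δ E : ℝ} (hδ : 0 < δ) (hδ1 : δ ≤ 1)
    (hE : ∫ y in Metric.ball x 1, u y ^ 2 ≤ E) :
    u x ^ 2 ≤ 2 / volume.real (Metric.ball (0 : Space N) 1) *
      (δ ^ (2 * s) * (∫ y, gagliardoKernel s u u (x, y)) + δ ^ (-(N : ℝ)) * E) := by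
  set ω := volume.real (Metric.ball (0 : Space N) 1) with hω
  have hωpos : 0 < ω := by
    rw [hω, measureReal_def]
    exact ENNReal.toReal_pos (Metric.measure_ball_pos _ _ one_pos).ne' measure_ball_lt_top.ne
  have hvol : volume.real (Metric.ball x δ) = δ ^ (N : ℝ) * ω := by
    rw [hω, measureReal_def, Measure.addHaar_ball_of_pos _ _ hδ, ENNReal.toReal_mul,
      ENNReal.toReal_ofReal (by positivity), measureReal_def]
    simp
  have hsq : Integrable (fun y => u y ^ 2) := hu.integrable_sq
  have key : ∫ y in Metric.ball x δ, u x ^ 2 ≤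
      ∫ y in Metric.ball x δ, (2 * δ ^ ((N : ℝ) + 2 * s) * gagliardoKernel s u u (x, y)
        + 2 * u y ^ 2) := by
    refine setIntegral_mono_on (integrableOn_const measure_ball_lt_top.ne) ?_ measurableSet_ball fun y hy => ?_
    · exact ((hG.const_mul _).add (hsq.const_mul 2)).integrableOn
    · have h1 : (u x - u y) ^ 2 ≤ δ ^ ((N : ℝ) + 2 * s) * gagliardoKernel s u u (x, y) := by
        rcases eq_or_ne x y with rfl | hxy
        · simp [gagliardoKernel]
        · have hpos : 0 < ‖x - y‖ := norm_pos_iff.2 (sub_ne_zero.2 hxy)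
          have hlt : ‖x - y‖ ≤ δ := by
            rw [← dist_eq_norm, dist_comm]; exact (Metric.mem_ball.1 hy).le
          have h2 : ‖x - y‖ ^ ((N : ℝ) + 2 * s) ≤ δ ^ ((N : ℝ) + 2 * s) :=
            Real.rpow_le_rpow hpos.le hlt (by positivity)
          have h3 : 0 < ‖x - y‖ ^ ((N : ℝ) + 2 * s) := by positivity
          simp only [gagliardoKernel]
          rw [← mul_div_assoc, le_div_iff₀ h3, ← pow_two, mul_comm]
          gcongr
      -- 2(u(x)-u(y))² + 2u(y)² - u(x)² is the square (u(x)-2u(y))².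
      nlinarith [sq_nonneg (u x - 2 * u y)]
  have h1 : ∫ y in Metric.ball x δ, u x ^ 2 = δ ^ (N : ℝ) * ω * u x ^ 2 := by
    rw [setIntegral_const, hvol, smul_eq_mul]
  have h2 : ∫ y in Metric.ball x δ, gagliardoKernel s u u (x, y)
      ≤ ∫ y, gagliardoKernel s u u (x, y) :=
    setIntegral_le_integral hG (Eventually.of_forall fun y => gagliardoKernel_self_nonneg _)
  have h3 : ∫ y in Metric.ball x δ, u y ^ 2 ≤ E :=
    (setIntegral_mono_set hsq.integrableOn (Eventually.of_forall fun y => sq_nonneg _)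
      (Metric.ball_subset_ball hδ1).eventuallyLE).trans hE
  rw [h1, integral_add (hG.const_mul _).integrableOn (hsq.const_mul 2).integrableOn,
    integral_const_mul, integral_const_mul] at key
  have hδN : 0 < δ ^ (N : ℝ) := by positivity
  have key2 : δ ^ (N : ℝ) * ω * u x ^ 2 ≤ 2 * δ ^ ((N : ℝ) + 2 * s) *
      (∫ y, gagliardoKernel s u u (x, y)) + 2 * E := by
    refine key.trans ?_
    gcongr
  have e1 : 2 / ω * (δ ^ (2 * s) * (∫ y, gagliardoKernel s u u (x, y)) + δ ^ (-(N : ℝ)) * E)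
      = (2 * δ ^ ((N : ℝ) + 2 * s) * (∫ y, gagliardoKernel s u u (x, y)) + 2 * E) /
        (δ ^ (N : ℝ) * ω) := by
    rw [Real.rpow_add hδ, Real.rpow_neg hδ.le]
    field_simp
  rw [e1, le_div_iff₀ (by positivity)]
  linarith

/-- Used with Y = u(x)² and F the Gagliardo density at x. The scale δ^n = 2CE/Y makes the mass term
equal to Y/2, which is absorbed. That scale is admissible only if Y ≥ 2CE; otherwise Y itself is
small and the bound is immediate. -/
lemma rpow_le_of_forall_scale {Y F E C n r : ℝ} (hY : 0 ≤ Y) (hF : 0 ≤ F) (hE : 0 < E) (hC : 0 < C)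
    (hn : 0 < n) (hr : 2 ≤ r) (hr2 : r ≤ 2 + 4 * s / n)
    (h : ∀ δ : ℝ, 0 < δ → δ ≤ 1 → Y ≤ C * (δ ^ (2 * s) * F + δ ^ (-n) * E)) :
    Y ^ (r / 2) ≤ (2 * C) ^ ((r - 2) / 2) * (1 + 2 * C) * (E ^ ((r - 2) / 2) * (Y + F)) := by
  set e := (r - 2) / 2 with he
  have he0 : 0 ≤ e := by rw [he]; linarith
  have hee : e ≤ 2 * s / n := by
    rw [he]; have : 4 * s / n = 2 * (2 * s / n) := by ring
    linarith
  have hsplit : Y ^ (r / 2) = Y * Y ^ e := by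
    rw [show r / 2 = 1 + e by rw [he]; ring]
    rcases hY.eq_or_lt with rfl | hpos
    · simp [Real.zero_rpow (by positivity : (1 + e) ≠ 0)]
    · rw [Real.rpow_add hpos, Real.rpow_one]
  have hmul : (2 * C) ^ e * E ^ e = (2 * C * E) ^ e := (Real.mul_rpow (by positivity) hE.le).symm
  have goal2 : Y * Y ^ e ≤ (2 * C * E) ^ e * ((1 + 2 * C) * (Y + F)) := by
    rcases le_or_gt Y (2 * C * E) with hle | hgt
    · calc Y * Y ^ e ≤ Y * (2 * C * E) ^ e := by gcongr
        _ = (2 * C * E) ^ e * Y := by ring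
        _ ≤ _ := by gcongr; nlinarith [mul_nonneg hC.le (add_nonneg hY hF)]
    · have hYpos : 0 < Y := lt_trans (by positivity) hgt
      have hb0 : 0 < 2 * C * E / Y := by positivity
      have hb1 : 2 * C * E / Y ≤ 1 := by rw [div_le_one hYpos]; exact hgt.le
      have h1 := h ((2 * C * E / Y) ^ (1 / n)) (by positivity)
        (Real.rpow_le_one hb0.le hb1 (by positivity))
      rw [← Real.rpow_mul hb0.le, ← Real.rpow_mul hb0.le] at h1
      rw [show 1 / n * -n = -1 by field_simp, Real.rpow_neg_one,
        show 1 / n * (2 * s) = 2 * s / n by ring] at h1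
      -- The base is at most 1, so the exponent 2s/n may be lowered to (r-2)/2; this is where r ≤ 2
      -- + 4s/n enters.
      have h2 : (2 * C * E / Y) ^ (2 * s / n) ≤ (2 * C * E / Y) ^ e :=
        Real.rpow_le_rpow_of_exponent_ge hb0 hb1 hee
      have h3 : C * ((2 * C * E / Y)⁻¹ * E) = Y / 2 := by field_simp
      have h4 : Y ≤ 2 * C * ((2 * C * E / Y) ^ e * F) := by
        have : (2 * C * E / Y) ^ (2 * s / n) * F ≤ (2 * C * E / Y) ^ e * F := by gcongr
        have := mul_le_mul_of_nonneg_left this hC.le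
        rw [mul_add, h3] at h1
        linarith
      rw [Real.div_rpow (by positivity) hY] at h4
      have hYe : 0 < Y ^ e := by positivity
      have h5 : Y * Y ^ e ≤ 2 * C * ((2 * C * E) ^ e * F) := by
        calc Y * Y ^ e ≤ 2 * C * ((2 * C * E) ^ e / Y ^ e * F) * Y ^ e := by gcongr
          _ = _ := by field_simp
      refine h5.trans ?_
      have : 2 * C * ((2 * C * E) ^ e * F) = (2 * C * E) ^ e * (2 * C * F) := by ring
      rw [this]
      nlinarith [mul_nonneg hC.le hY, mul_nonneg (Real.rpow_nonneg (by positivity : 0 ≤ 2 * C * E) e)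
        (by nlinarith [mul_nonneg hC.le hY] : 0 ≤ Y + F + 2 * C * Y)]
  calc Y ^ (r / 2) = Y * Y ^ e := hsplit
    _ ≤ _ := goal2
    _ = _ := by rw [← hmul]; ring

/-- Lions' inequality: the `L^r` norm of `u ∈ H^s` is controlled by its local masses. -/
lemma exists_integral_rpow_le (hs0 : 0 < s) (hN : 0 < N) {r : ℝ} (hr : 2 ≤ r)
    (hr2 : r ≤ 2 + 4 * s / N) :
    ∃ C : ℝ, 0 < C ∧ ∀ u : Space N → ℝ, MemHs s u → ∀ E : ℝ, 0 < E →
      (∀ x, ∫ y in Metric.ball x 1, u y ^ 2 ≤ E) →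
      Integrable (fun x => |u x| ^ r) ∧
      ∫ x, |u x| ^ r ≤ C * (E ^ ((r - 2) / 2) * ((∫ x, u x ^ 2) + gagliardoSq s u)) := by
  set ω := volume.real (Metric.ball (0 : Space N) 1) with hω
  have hωpos : 0 < ω := by
    rw [hω, measureReal_def]
    exact ENNReal.toReal_pos (Metric.measure_ball_pos _ _ one_pos).ne' measure_ball_lt_top.ne
  refine ⟨(2 * (2 / ω)) ^ ((r - 2) / 2) * (1 + 2 * (2 / ω)), by positivity, ?_⟩
  intro u hu E hE hball
  set C := (2 * (2 / ω)) ^ ((r - 2) / 2) * (1 + 2 * (2 / ω)) with hC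
  have hF : Integrable fun x => ∫ y, gagliardoKernel s u u (x, y) := hu.gagliardo.integral_prod_left
  have hsq : Integrable (fun y => u y ^ 2) := hu.memLp.integrable_sq
  have hbd : Integrable fun x => C * (E ^ ((r - 2) / 2) *
      (u x ^ 2 + ∫ y, gagliardoKernel s u u (x, y))) :=
    ((hsq.add hF).const_mul _).const_mul _
  have hae : ∀ᵐ x, |u x| ^ r ≤ C * (E ^ ((r - 2) / 2) *
      (u x ^ 2 + ∫ y, gagliardoKernel s u u (x, y))) := by
    filter_upwards [hu.gagliardo.prod_right_ae] with x hx
    have h := rpow_le_of_forall_scale (Y := u x ^ 2) (E := E) (C := 2 / ω) (n := N) (s := s) (r := r)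
      (sq_nonneg _) (integral_nonneg fun y => gagliardoKernel_self_nonneg (u := u) (s := s) (x, y)) hE
      (by positivity) (by exact_mod_cast hN) hr hr2
      (fun δ h1 h2 => sq_le_of_ball hs0 hu.memLp hx h1 h2 (hball x))
    convert h using 1
    rw [← sq_abs, ← Real.rpow_natCast, ← Real.rpow_mul (abs_nonneg _)]
    congr 1
    push_cast; ring
  have hint : Integrable (fun x => |u x| ^ r) := by
    refine hbd.mono' ?_ ?_
    · exact (Real.continuous_rpow_const (by linarith)).comp_aestronglyMeasurable
        (continuous_abs.comp_aestronglyMeasurable hu.memLp.1)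
    · filter_upwards [hae] with x hx
      rwa [Real.norm_of_nonneg (by positivity)]
  refine ⟨hint, (integral_mono_ae hint hbd hae).trans_eq ?_⟩
  rw [integral_const_mul, integral_const_mul, integral_add hsq hF, gagliardoSq,
    integral_prod _ hu.gagliardo]

lemma MemHs.integrable_rpow {u : Space N → ℝ} (hu : MemHs s u) (hs0 : 0 < s) (hN : 0 < N) {r : ℝ}
    (hr : 2 ≤ r) (hr2 : r ≤ 2 + 4 * s / N) : Integrable (fun x => |u x| ^ r) := by
  obtain ⟨C, -, h⟩ := exists_integral_rpow_le hs0 hN hr hr2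
  have h0 : 0 ≤ ∫ x, u x ^ 2 := integral_nonneg fun x => sq_nonneg _
  refine (h u hu ((∫ x, u x ^ 2) + 1) (by linarith) fun x => ?_).1
  have := setIntegral_le_integral (s := Metric.ball x 1) hu.memLp.integrable_sq
    (Eventually.of_forall fun y => sq_nonneg (u y))
  linarith

/-- The embedding of `H^s` into `L^r`, for bounded sets. -/
lemma exists_integral_rpow_le_of_le (hs0 : 0 < s) (hN : 0 < N) {r : ℝ} (hr : 2 ≤ r)
    (hr2 : r ≤ 2 + 4 * s / N) (M : ℝ) :
    ∃ C : ℝ, 0 ≤ C ∧ ∀ u : Space N → ℝ, MemHs s u → ∫ x, u x ^ 2 ≤ M → gagliardoSq s u ≤ M →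
      ∫ x, |u x| ^ r ≤ C := by
  obtain ⟨C, hC, h⟩ := exists_integral_rpow_le hs0 hN hr hr2
  refine ⟨C * ((|M| + 1) ^ ((r - 2) / 2) * (|M| + |M|)), by positivity, fun u hu h1 h2 => ?_⟩
  have hM := le_abs_self M
  refine (h u hu (|M| + 1) (by positivity) fun x => ?_).2.trans ?_
  · have := setIntegral_le_integral (s := Metric.ball x 1) hu.memLp.integrable_sq
      (Eventually.of_forall fun y => sq_nonneg (u y))
    linarith
  · gcongr <;> linarith

end Embedding

/-! ### The Riesz kernel and its splitting into two Young kernels -/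

section Riesz

variable {N : ℕ} {α : ℝ}

lemma rieszConst_pos (hα0 : 0 < α) (hαN : α < N) : 0 < rieszConst N α := by
  have h1 := Real.Gamma_pos_of_pos (s := ((N : ℝ) - α) / 2) (by linarith)
  have h2 := Real.Gamma_pos_of_pos (s := α / 2) (by linarith)
  have := Real.pi_pos
  unfold rieszConst
  positivity

lemma rieszKernel_nonneg (hα0 : 0 < α) (hαN : α < N) (z : Space N) : 0 ≤ rieszKernel α z :=
  div_nonneg (rieszConst_pos hα0 hαN).le (by positivity)

lemma rieszKernel_pos (hα0 : 0 < α) (hαN : α < N) {z : Space N} (hz : z ≠ 0) :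
    0 < rieszKernel α z :=
  div_pos (rieszConst_pos hα0 hαN) (Real.rpow_pos_of_pos (norm_pos_iff.2 hz) _)

lemma rieszKernel_neg (z : Space N) : rieszKernel α (-z) = rieszKernel α z := by
  simp [rieszKernel]

@[fun_prop]
lemma measurable_rieszKernel : Measurable (rieszKernel α : Space N → ℝ) := by
  unfold rieszKernel
  fun_prop

/-- The pointwise inequality behind Young's inequality `∫∫ h K k ≤ ‖h‖_ρ ‖K‖_m ‖k‖_ρ`. -/
lemma mul_mul_le_young {h k K ρ : ℝ} (hh : 0 ≤ h) (hk : 0 ≤ k) (hK : 0 ≤ K) (h1 : 1 < ρ)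
    (h2 : ρ < 2) :
    h * k * K ≤ h ^ ρ * k ^ ρ + (h ^ ρ + k ^ ρ) * K ^ (ρ / (2 * (ρ - 1))) := by
  rcases hh.eq_or_lt with rfl | hh
  · simp only [zero_mul]; positivity
  rcases hk.eq_or_lt with rfl | hk
  · simp only [mul_zero, zero_mul]; positivity
  rcases hK.eq_or_lt with rfl | hK
  · simp only [mul_zero]; positivity
  have hρ : 0 < ρ := by linarith
  have hρ1 : ρ - 1 ≠ 0 := by linarith
  have w1 : 0 ≤ 2 / ρ - 1 := by rw [sub_nonneg, one_le_div hρ]; exact h2.le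
  have w2 : 0 ≤ 1 - 1 / ρ := by rw [sub_nonneg, div_le_one hρ]; exact h1.le
  have w1' : 2 / ρ - 1 ≤ 1 := by
    have : 2 / ρ ≤ 2 := div_le_self (by norm_num) h1.le
    linarith
  have w2' : 1 - 1 / ρ ≤ 1 := by have : 0 < 1 / ρ := by positivity
                                 linarith
  set m := ρ / (2 * (ρ - 1)) with hm
  -- The weights sum to 1 and are those for which the weighted geometric mean of h^ρ k^ρ, h^ρ K^m,
  -- k^ρ K^m is hkK.
  have key := Real.geom_mean_le_arith_mean3_weighted w1 w2 w2
    (by positivity : 0 ≤ h ^ ρ * k ^ ρ) (by positivity : 0 ≤ h ^ ρ * K ^ m)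
    (by positivity : 0 ≤ k ^ ρ * K ^ m) (by ring)
  have e : h * k * K = (h ^ ρ * k ^ ρ) ^ (2 / ρ - 1) * (h ^ ρ * K ^ m) ^ (1 - 1 / ρ) *
      (k ^ ρ * K ^ m) ^ (1 - 1 / ρ) := by
    rw [Real.mul_rpow (by positivity) (by positivity), Real.mul_rpow (by positivity) (by positivity),
      Real.mul_rpow (by positivity) (by positivity), ← Real.rpow_mul hh.le, ← Real.rpow_mul hh.le,
      ← Real.rpow_mul hk.le, ← Real.rpow_mul hk.le, ← Real.rpow_mul hK.le]
    have a1 : ρ * (2 / ρ - 1) = 2 - ρ := by field_simp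
    have a2 : ρ * (1 - 1 / ρ) = ρ - 1 := by field_simp
    have a3 : m * (1 - 1 / ρ) = 1 / 2 := by rw [hm]; field_simp
    rw [a1, a2, a3]
    have b1 : ∀ y : ℝ, 0 < y → y ^ (2 - ρ) * y ^ (ρ - 1) = y := fun y hy => by
      rw [← Real.rpow_add hy]; norm_num
    have b2 : K ^ (1 / 2 : ℝ) * K ^ (1 / 2 : ℝ) = K := by
      rw [← Real.rpow_add hK]; norm_num
    calc h * k * K = (h ^ (2 - ρ) * h ^ (ρ - 1)) * (k ^ (2 - ρ) * k ^ (ρ - 1)) *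
          (K ^ (1 / 2 : ℝ) * K ^ (1 / 2 : ℝ)) := by rw [b1 h hh, b1 k hk, b2]
      _ = _ := by ring
  rw [e]
  refine key.trans ?_
  have p1 : 0 ≤ h ^ ρ * k ^ ρ := by positivity
  have p2 : 0 ≤ h ^ ρ * K ^ m := by positivity
  have p3 : 0 ≤ k ^ ρ * K ^ m := by positivity
  nlinarith

/-- A splitting of the Riesz kernel into a part near `0` and a part near infinity, each of which
satisfies a Young inequality, on exponents which `|u|^t` has for `u ∈ L^r`, `2 < r < R`. -/
structure RieszSplit (α t R ρ₁ ρ₂ : ℝ) (κ : Space N → ℝ) : Prop where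
  one_lt₁ : 1 < ρ₁
  one_lt₂ : 1 < ρ₂
  lt_mul₁ : 2 < t * ρ₁
  lt_mul₂ : 2 < t * ρ₂
  mul_lt₁ : t * ρ₁ < R
  mul_lt₂ : t * ρ₂ < R
  integrable : Integrable κ
  nonneg : ∀ z, 0 ≤ κ z
  even : ∀ z, κ (-z) = κ z
  bound : ∀ h k : ℝ, 0 ≤ h → 0 ≤ k → ∀ z, h * k * rieszKernel α z ≤
    (h ^ ρ₁ * k ^ ρ₁ + (h ^ ρ₁ + k ^ ρ₁) * κ z) + (h ^ ρ₂ * k ^ ρ₂ + (h ^ ρ₂ + k ^ ρ₂) * κ z)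

/-- In polar coordinates the two conditions are those for integrability of a power at infinity and
at the origin. -/
lemma integrable_fun_norm_of_rpow (hN : 0 < N) {A b m₁ m₂ : ℝ} (hA : 0 ≤ A) (h1 : N < b * m₁)
    (h2 : b * m₂ < N) :
    Integrable fun z : Space N =>
      if ‖z‖ ≤ 1 then (A / ‖z‖ ^ b) ^ m₂ else (A / ‖z‖ ^ b) ^ m₁ := by
  have : Nonempty (Fin N) := ⟨⟨0, hN⟩⟩
  have := (integrable_fun_norm_addHaar (volume : Measure (Space N))
    (f := fun y : ℝ => if y ≤ 1 then (A / y ^ b) ^ m₂ else (A / y ^ b) ^ m₁)).2 ?_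
  · exact this
  have hfin : Module.finrank ℝ (Space N) = N := by simp
  rw [hfin]
  have e : ∀ m y : ℝ, 0 < y → y ^ (N - 1) * (A / y ^ b) ^ m = A ^ m * y ^ ((N : ℝ) - 1 - b * m) := by
    intro m y hy
    rw [Real.div_rpow hA (by positivity), ← Real.rpow_mul hy.le, Real.rpow_sub hy,
      ← Real.rpow_natCast, Nat.cast_sub hN]
    simp only [Nat.cast_one]
    ring
  rw [← Set.Ioc_union_Ioi_eq_Ioi (zero_le_one' ℝ)]
  refine IntegrableOn.union ?_ ?_
  · have hI : IntegrableOn (fun y : ℝ => A ^ m₂ * y ^ ((N : ℝ) - 1 - b * m₂)) (Set.Ioc 0 1) := by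
      have := (intervalIntegral.intervalIntegrable_rpow' (a := 0) (b := 1)
        (r := (N : ℝ) - 1 - b * m₂) (by linarith)).const_mul (A ^ m₂)
      rwa [intervalIntegrable_iff_integrableOn_Ioc_of_le zero_le_one] at this
    refine hI.congr_fun (fun y hy => ?_) measurableSet_Ioc
    simp only [if_pos hy.2, smul_eq_mul, e m₂ y hy.1]
  · have hI : IntegrableOn (fun y : ℝ => A ^ m₁ * y ^ ((N : ℝ) - 1 - b * m₁)) (Set.Ioi 1) :=
      (integrableOn_Ioi_rpow_of_lt (by linarith) one_pos).const_mul _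
    refine hI.congr_fun (fun y hy => ?_) measurableSet_Ioi
    have hy' : (1 : ℝ) < y := hy
    simp only [if_neg (not_le.2 hy'), smul_eq_mul, e m₁ y (by linarith)]

/-- At ρ₀ = 2N/(N+α) the kernel exponent ρ/(2(ρ-1)) equals N/(N-α), for which the power of the
kernel just fails to be integrable at both ends. The exponent decreases in ρ, so ρ₁ < ρ₀ gives
integrability at infinity and ρ₂ > ρ₀ near 0. The bounds on t leave room on both sides of ρ₀ to keep
tρ₁ and tρ₂ strictly between 2 and R. -/
lemma exists_rieszSplit (hN : 0 < N) (hα0 : 0 < α) (hαN : α < N) {t R : ℝ}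
    (ht : ((N : ℝ) + α) / N < t) (hR : t * (2 * N / (N + α)) < R) :
    ∃ (ρ₁ ρ₂ : ℝ) (κ : Space N → ℝ), RieszSplit α t R ρ₁ ρ₂ κ := by
  have hN' : (0 : ℝ) < N := by exact_mod_cast hN
  have ht0 : 0 < t := lt_trans (by positivity) ht
  set ρ₀ : ℝ := 2 * N / (N + α) with hρ₀
  have h1 : 1 < ρ₀ := by rw [hρ₀, lt_div_iff₀ (by linarith)]; linarith
  have h2 : ρ₀ < 2 := by rw [hρ₀, div_lt_iff₀ (by linarith)]; linarith
  have h3 : 2 / t < ρ₀ := by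
    rw [div_lt_iff₀ ht0]
    calc (2 : ℝ) = ρ₀ * ((N + α) / N) := by rw [hρ₀]; field_simp
      _ < ρ₀ * t := by gcongr
  have h4 : ρ₀ < R / t := by rw [lt_div_iff₀ ht0]; linarith
  obtain ⟨ρ₁, ha, hb⟩ := exists_between (max_lt h1 h3)
  obtain ⟨ρ₂, hc, hd⟩ := exists_between (lt_min h2 h4)
  rw [max_lt_iff] at ha
  rw [lt_min_iff] at hd
  have hρ₁2 : ρ₁ < 2 := by linarith
  have hρ₂1 : 1 < ρ₂ := by linarith
  set A := rieszConst N α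
  have hA : 0 < A := rieszConst_pos hα0 hαN
  refine ⟨ρ₁, ρ₂, fun z => if ‖z‖ ≤ 1 then (A / ‖z‖ ^ ((N : ℝ) - α)) ^ (ρ₂ / (2 * (ρ₂ - 1))) else
    (A / ‖z‖ ^ ((N : ℝ) - α)) ^ (ρ₁ / (2 * (ρ₁ - 1))), ha.1, hρ₂1, ?_, ?_, ?_, ?_, ?_, ?_, ?_, ?_⟩
  · have := ha.2; rwa [div_lt_iff₀ ht0, mul_comm] at this
  · have := h3.trans hc; rwa [div_lt_iff₀ ht0, mul_comm] at this
  · have := hb.trans h4; rwa [lt_div_iff₀ ht0, mul_comm] at this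
  · have := hd.2; rwa [lt_div_iff₀ ht0, mul_comm] at this
  · refine integrable_fun_norm_of_rpow hN hA.le ?_ ?_
    · rw [mul_div_assoc', lt_div_iff₀ (by linarith)]
      rw [hρ₀, lt_div_iff₀ (by linarith)] at hb
      linarith
    · rw [mul_div_assoc', div_lt_iff₀ (by linarith)]
      rw [hρ₀, div_lt_iff₀ (by linarith)] at hc
      linarith
  · intro z
    split_ifs <;> positivity
  · intro z
    simp
  · intro h k hh hk z
    have hK := rieszKernel_nonneg hα0 hαN z
    have hz : A / ‖z‖ ^ ((N : ℝ) - α) = rieszKernel α z := rfl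
    rw [hz]
    split_ifs
    · refine (mul_mul_le_young hh hk hK hρ₂1 hd.1).trans (le_add_of_nonneg_left ?_)
      positivity
    · refine (mul_mul_le_young hh hk hK ha.1 hρ₁2).trans (le_add_of_nonneg_right ?_)
      positivity

end Riesz

/-! ### The bilinear Riesz form on L^ρ₁ ∩ L^ρ₂ -/

section RieszForm

variable {N : ℕ} {α t R ρ₁ ρ₂ : ℝ} {κ h k h' k' : Space N → ℝ}

lemma integrable_snd_mul_sub (hk : Integrable k) (hκ : Integrable κ) :
    Integrable (fun z : Space N × Space N => k z.2 * κ (z.1 - z.2)) (volume.prod volume) := by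
  simpa using hk.convolution_integrand (ContinuousLinearMap.mul ℝ ℝ) hκ

lemma integral_snd_mul_sub (hk : Integrable k) (hκ : Integrable κ) :
    ∫ z : Space N × Space N, k z.2 * κ (z.1 - z.2) ∂(volume.prod volume)
      = (∫ x, k x) * ∫ x, κ x := by
  rw [integral_prod_symm _ (integrable_snd_mul_sub hk hκ)]
  simp only [integral_const_mul]
  rw [← integral_mul_const]
  congr 1
  ext y
  rw [integral_sub_right_eq_self κ y]

lemma integrable_fst_mul_sub (hh : Integrable h) (hκ : Integrable κ) (he : ∀ z, κ (-z) = κ z) :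
    Integrable (fun z : Space N × Space N => h z.1 * κ (z.1 - z.2)) (volume.prod volume) := by
  refine (integrable_snd_mul_sub hh hκ).swap.congr (Eventually.of_forall fun z => ?_)
  simp only [Function.comp_apply, Prod.fst_swap, Prod.snd_swap]
  rw [← he, neg_sub]

lemma integral_fst_mul_sub (hh : Integrable h) (hκ : Integrable κ) (he : ∀ z, κ (-z) = κ z) :
    ∫ z : Space N × Space N, h z.1 * κ (z.1 - z.2) ∂(volume.prod volume)
      = (∫ x, h x) * ∫ x, κ x := by
  rw [← integral_snd_mul_sub hh hκ, ← integral_prod_swap]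
  congr 1
  ext z
  simp only [Prod.fst_swap, Prod.snd_swap]
  rw [← he, neg_sub]

/-- Nonnegative measurable functions in `L^ρ₁ ∩ L^ρ₂`. -/
structure RieszAdm (ρ₁ ρ₂ : ℝ) (h : Space N → ℝ) : Prop where
  aesm : AEStronglyMeasurable h
  nonneg : ∀ x, 0 ≤ h x
  int₁ : Integrable fun x => h x ^ ρ₁
  int₂ : Integrable fun x => h x ^ ρ₂

lemma integrable_rpow_of_le {ρ : ℝ} (hρ : 0 ≤ ρ) (hk : AEStronglyMeasurable k)
    (hk0 : ∀ x, 0 ≤ k x) (hle : ∀ x, k x ≤ h x) (hh : Integrable fun x => h x ^ ρ) :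
    Integrable fun x => k x ^ ρ := by
  refine hh.mono' ((Real.continuous_rpow_const hρ).comp_aestronglyMeasurable hk)
    (Eventually.of_forall fun x => ?_)
  rw [Real.norm_of_nonneg (Real.rpow_nonneg (hk0 x) _)]
  exact Real.rpow_le_rpow (hk0 x) (hle x) hρ

lemma RieszAdm.of_le (hS : RieszSplit α t R ρ₁ ρ₂ κ) (hh : RieszAdm ρ₁ ρ₂ h)
    (hk : AEStronglyMeasurable k) (hk0 : ∀ x, 0 ≤ k x) (hle : ∀ x, k x ≤ h x) :
    RieszAdm ρ₁ ρ₂ k :=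
  ⟨hk, hk0, integrable_rpow_of_le (by linarith [hS.one_lt₁]) hk hk0 hle hh.int₁,
    integrable_rpow_of_le (by linarith [hS.one_lt₂]) hk hk0 hle hh.int₂⟩

lemma RieszAdm.const_mul (hh : RieszAdm ρ₁ ρ₂ h) {c : ℝ} (hc : 0 ≤ c) :
    RieszAdm ρ₁ ρ₂ (fun x => c * h x) := by
  refine ⟨hh.aesm.const_mul c, fun x => mul_nonneg hc (hh.nonneg x), ?_, ?_⟩
  · simpa only [Real.mul_rpow hc (hh.nonneg _)] using hh.int₁.const_mul (c ^ ρ₁)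
  · simpa only [Real.mul_rpow hc (hh.nonneg _)] using hh.int₂.const_mul (c ^ ρ₂)

lemma RieszAdm.weight (hS : RieszSplit α t R ρ₁ ρ₂ κ) (hh : RieszAdm ρ₁ ρ₂ h) {w : Space N → ℝ}
    {C : ℝ} (hw : AEStronglyMeasurable w) (hw0 : ∀ x, 0 ≤ w x) (hC : ∀ x, w x ≤ C) :
    RieszAdm ρ₁ ρ₂ (fun x => w x * h x) :=
  RieszAdm.of_le hS (hh.const_mul ((hw0 0).trans (hC 0))) (hw.mul hh.aesm)
    (fun x => mul_nonneg (hw0 x) (hh.nonneg x))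
    fun x => mul_le_mul_of_nonneg_right (hC x) (hh.nonneg x)

/-- The bilinear form `∫ (I_α * k) h`. -/
noncomputable def rieszForm (α : ℝ) (h k : Space N → ℝ) : ℝ :=
  ∫ z : Space N × Space N, h z.1 * k z.2 * rieszKernel α (z.1 - z.2) ∂(volume.prod volume)

lemma aestronglyMeasurable_rieszIntegrand (hh : AEStronglyMeasurable h)
    (hk : AEStronglyMeasurable k) :
    AEStronglyMeasurable (fun z : Space N × Space N => h z.1 * k z.2 * rieszKernel α (z.1 - z.2))
      (volume.prod volume) := by
  have : Measurable fun z : Space N × Space N => rieszKernel α (z.1 - z.2) := by fun_prop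
  exact (hh.comp_fst.mul hk.comp_snd).mul this.aestronglyMeasurable

/-- The majorant of the integrand of the Riesz form for one exponent. -/
noncomputable def youngMajorant (ρ : ℝ) (κ h k : Space N → ℝ) (z : Space N × Space N) : ℝ :=
  h z.1 ^ ρ * k z.2 ^ ρ + (h z.1 ^ ρ + k z.2 ^ ρ) * κ (z.1 - z.2)

lemma integrable_youngMajorant {ρ : ℝ} (hκ : Integrable κ) (he : ∀ z, κ (-z) = κ z)
    (hh : Integrable fun x => h x ^ ρ) (hk : Integrable fun x => k x ^ ρ) :
    Integrable (youngMajorant ρ κ h k) (volume.prod volume) := by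
  refine ((hh.mul_prod hk).add ((integrable_fst_mul_sub hh hκ he).add
    (integrable_snd_mul_sub hk hκ))).congr (Eventually.of_forall fun z => ?_)
  simp only [youngMajorant, Pi.add_apply]
  ring

lemma integral_youngMajorant {ρ : ℝ} (hκ : Integrable κ) (he : ∀ z, κ (-z) = κ z)
    (hh : Integrable fun x => h x ^ ρ) (hk : Integrable fun x => k x ^ ρ) :
    ∫ z, youngMajorant ρ κ h k z ∂(volume.prod volume)
      = (∫ x, h x ^ ρ) * (∫ x, k x ^ ρ)
        + ((∫ x, h x ^ ρ) + ∫ x, k x ^ ρ) * ∫ x, κ x := by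
  have h1 := hh.mul_prod hk
  have h2 := integrable_fst_mul_sub hh hκ he
  have h3 := integrable_snd_mul_sub hk hκ
  have e : youngMajorant ρ κ h k = fun z => h z.1 ^ ρ * k z.2 ^ ρ +
      (h z.1 ^ ρ * κ (z.1 - z.2) + k z.2 ^ ρ * κ (z.1 - z.2)) := by
    ext z; simp only [youngMajorant]; ring
  have h23 : Integrable (fun z : Space N × Space N =>
    h z.1 ^ ρ * κ (z.1 - z.2) + k z.2 ^ ρ * κ (z.1 - z.2)) (volume.prod volume) := h2.add h3
  rw [e, integral_add h1 h23, integral_add h2 h3, integral_fst_mul_sub hh hκ he,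
    integral_snd_mul_sub hk hκ, integral_prod_mul (fun x => h x ^ ρ) (fun x => k x ^ ρ)]
  ring

lemma youngMajorant_nonneg {ρ : ℝ} (hκ : ∀ z, 0 ≤ κ z) (hh : ∀ x, 0 ≤ h x) (hk : ∀ x, 0 ≤ k x)
    (z : Space N × Space N) : 0 ≤ youngMajorant ρ κ h k z := by
  have h1 := Real.rpow_nonneg (hh z.1) ρ
  have h2 := Real.rpow_nonneg (hk z.2) ρ
  have h3 := hκ (z.1 - z.2)
  unfold youngMajorant
  positivity

lemma integrable_rieszIntegrand (hα0 : 0 < α) (hαN : α < N) (hS : RieszSplit α t R ρ₁ ρ₂ κ)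
    (hh : RieszAdm ρ₁ ρ₂ h) (hk : RieszAdm ρ₁ ρ₂ k) :
    Integrable (fun z : Space N × Space N => h z.1 * k z.2 * rieszKernel α (z.1 - z.2))
      (volume.prod volume) := by
  refine ((integrable_youngMajorant hS.integrable hS.even hh.int₁ hk.int₁).add
    (integrable_youngMajorant hS.integrable hS.even hh.int₂ hk.int₂)).mono'
    (aestronglyMeasurable_rieszIntegrand hh.aesm hk.aesm) (Eventually.of_forall fun z => ?_)
  rw [Real.norm_of_nonneg (mul_nonneg (mul_nonneg (hh.nonneg _) (hk.nonneg _))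
    (rieszKernel_nonneg hα0 hαN _))]
  exact hS.bound _ _ (hh.nonneg _) (hk.nonneg _) _

/-- Substitute for the Hardy-Littlewood-Sobolev inequality. It is not homogeneous in h and k;
homogeneity is restored where needed by rescaling. -/
lemma rieszForm_le (hα0 : 0 < α) (hαN : α < N) (hS : RieszSplit α t R ρ₁ ρ₂ κ)
    (hh : RieszAdm ρ₁ ρ₂ h) (hk : RieszAdm ρ₁ ρ₂ k) :
    rieszForm α h k ≤ ((∫ x, h x ^ ρ₁) * (∫ x, k x ^ ρ₁)
        + ((∫ x, h x ^ ρ₁) + ∫ x, k x ^ ρ₁) * ∫ x, κ x) +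
      ((∫ x, h x ^ ρ₂) * (∫ x, k x ^ ρ₂) + ((∫ x, h x ^ ρ₂) + ∫ x, k x ^ ρ₂) * ∫ x, κ x) := by
  have h1 := integrable_youngMajorant hS.integrable hS.even hh.int₁ hk.int₁
  have h2 := integrable_youngMajorant hS.integrable hS.even hh.int₂ hk.int₂
  rw [← integral_youngMajorant hS.integrable hS.even hh.int₁ hk.int₁,
    ← integral_youngMajorant hS.integrable hS.even hh.int₂ hk.int₂, ← integral_add h1 h2]
  exact integral_mono (integrable_rieszIntegrand hα0 hαN hS hh hk) (h1.add h2)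
    fun z => hS.bound _ _ (hh.nonneg _) (hk.nonneg _) _

lemma rieszForm_nonneg (hα0 : 0 < α) (hαN : α < N) (hh : ∀ x, 0 ≤ h x) (hk : ∀ x, 0 ≤ k x) :
    0 ≤ rieszForm α h k :=
  integral_nonneg fun _ => mul_nonneg (mul_nonneg (hh _) (hk _)) (rieszKernel_nonneg hα0 hαN _)

lemma rieszForm_mono (hα0 : 0 < α) (hαN : α < N) (hS : RieszSplit α t R ρ₁ ρ₂ κ)
    (hk : RieszAdm ρ₁ ρ₂ k) (hh : RieszAdm ρ₁ ρ₂ h) (hle : ∀ x, h x ≤ k x) :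
    rieszForm α h h ≤ rieszForm α k k := by
  refine integral_mono (integrable_rieszIntegrand hα0 hαN hS hh hh)
    (integrable_rieszIntegrand hα0 hαN hS hk hk) fun z => ?_
  have h1 := hh.nonneg z.1
  have h2 := hh.nonneg z.2
  have h3 := hk.nonneg z.1
  have h4 := rieszKernel_nonneg hα0 hαN (z.1 - z.2)
  exact mul_le_mul_of_nonneg_right (mul_le_mul (hle _) (hle _) h2 h3) h4

lemma rieszForm_const_mul (c : ℝ) :
    rieszForm α (fun x => c * h x) (fun x => c * h x) = c ^ 2 * rieszForm α h h := by
  unfold rieszForm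
  rw [← integral_const_mul]
  congr 1
  ext z
  ring

/-- If the form vanishes, so does its nonnegative integrand a.e.; the kernel is positive off the
diagonal, so a single suitable x with h(x) ≠ 0 forces h(y) = 0 for almost every y. -/
lemma rieszForm_pos (hα0 : 0 < α) (hαN : α < N) (hS : RieszSplit α t R ρ₁ ρ₂ κ) (hN : 0 < N)
    (hh : RieszAdm ρ₁ ρ₂ h) (hne : ¬ h =ᵐ[volume] 0) : 0 < rieszForm α h h := by
  have : Nonempty (Fin N) := ⟨⟨0, hN⟩⟩
  refine lt_of_le_of_ne (rieszForm_nonneg hα0 hαN hh.nonneg hh.nonneg) fun h0 => hne ?_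
  have h1 := (integral_eq_zero_iff_of_nonneg
    (fun z => mul_nonneg (mul_nonneg (hh.nonneg _) (hh.nonneg _)) (rieszKernel_nonneg hα0 hαN _))
    (integrable_rieszIntegrand hα0 hαN hS hh hh)).1 h0.symm
  have h2 := Measure.ae_ae_of_ae_prod h1
  filter_upwards [h2] with x hx
  by_contra hxne
  refine hne ?_
  filter_upwards [hx, Measure.ae_ne volume x] with y hy hyx
  have hpos := rieszKernel_pos hα0 hαN (sub_ne_zero.2 hyx.symm)
  simp only [Pi.zero_apply, mul_eq_zero] at hy hxne ⊢
  rcases hy with (hy | hy) | hy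
  · exact absurd hy hxne
  · exact hy
  · exact absurd hy hpos.ne'

lemma integral_rieszPotential_mul {h k : Space N → ℝ}
    (hi : Integrable (fun z : Space N × Space N => h z.1 * k z.2 * rieszKernel α (z.1 - z.2))
      (volume.prod volume)) :
    ∫ x, rieszPotential α k x * h x = rieszForm α h k := by
  rw [rieszForm, integral_prod _ hi]
  congr 1
  ext x
  rw [rieszPotential, ← integral_mul_const]
  congr 1
  ext y
  ring

lemma integrable_rieszPotential_mul {h k : Space N → ℝ}
    (hi : Integrable (fun z : Space N × Space N => h z.1 * k z.2 * rieszKernel α (z.1 - z.2))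
      (volume.prod volume)) :
    Integrable fun x => rieszPotential α k x * h x := by
  refine hi.integral_prod_left.congr (Eventually.of_forall fun x => ?_)
  simp only
  rw [rieszPotential, ← integral_mul_const]
  congr 1
  ext y
  ring

end RieszForm

/-! ### Powers of H^s functions are admissible -/

section Power

variable {N : ℕ} {s α t ρ₁ ρ₂ : ℝ} {κ u : Space N → ℝ}

lemma MemHs.rieszAdm (hu : MemHs s u) (hs0 : 0 < s) (hN : 0 < N) (ht : 0 < t)
    (hS : RieszSplit α t (2 + 4 * s / N) ρ₁ ρ₂ κ) : RieszAdm ρ₁ ρ₂ (fun x => |u x| ^ t) := by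
  refine ⟨(Real.continuous_rpow_const ht.le).comp_aestronglyMeasurable
    (continuous_abs.comp_aestronglyMeasurable hu.memLp.1), fun x => by positivity, ?_, ?_⟩
  · simpa only [← Real.rpow_mul (abs_nonneg _)] using
      hu.integrable_rpow hs0 hN hS.lt_mul₁.le hS.mul_lt₁.le
  · simpa only [← Real.rpow_mul (abs_nonneg _)] using
      hu.integrable_rpow hs0 hN hS.lt_mul₂.le hS.mul_lt₂.le

end Power

/-! ### Limits of integrals along bounded, a.e. convergent sequences -/

section Convergence

/-- A form of the dominated convergence theorem in which the majorant may contain a small multiple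
of a sequence bounded in `L^1`. -/
lemma tendsto_integral_abs_zero {X : Type*} [MeasurableSpace X] {μ : Measure X} {W A : ℕ → X → ℝ}
    {M : ℝ} (hW : ∀ n, Integrable (W n) μ) (hlim : ∀ᵐ x ∂μ, Tendsto (fun n => W n x) atTop (𝓝 0))
    (hA : ∀ n, Integrable (A n) μ) (hA0 : ∀ n x, 0 ≤ A n x) (hM : ∀ n, ∫ x, A n x ∂μ ≤ M)
    (hdom : ∀ ε : ℝ, 0 < ε → ∃ g : X → ℝ, Integrable g μ ∧
      ∀ n x, |W n x| ≤ ε * A n x + g x) :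
    Tendsto (fun n => ∫ x, |W n x| ∂μ) atTop (𝓝 0) := by
  have hM0 : 0 ≤ M := (integral_nonneg (hA0 0)).trans (hM 0)
  refine Metric.tendsto_atTop.2 fun η hη => ?_
  set ε := η / (2 * (M + 1)) with hε
  have hεpos : 0 < ε := by positivity
  obtain ⟨g, hg, hb⟩ := hdom ε hεpos
  have hint : ∀ n, Integrable (fun x => |W n x| - ε * A n x) μ :=
    fun n => (hW n).abs.sub ((hA n).const_mul ε)
  -- The truncation is dominated by the fixed function |g|, so ordinary dominated convergence
  -- applies to it; what was cut off has integral at most εM < η/2.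
  have hpos : ∀ n, Integrable (fun x => max (|W n x| - ε * A n x) 0) μ := fun n => (hint n).pos_part
  have h0 : Tendsto (fun n => ∫ x, max (|W n x| - ε * A n x) 0 ∂μ) atTop (𝓝 (∫ _, (0 : ℝ) ∂μ)) := by
    refine tendsto_integral_of_dominated_convergence (fun x => |g x|) (fun n => (hpos n).1) hg.abs
      (fun n => Eventually.of_forall fun x => ?_) ?_
    · rw [Real.norm_of_nonneg (le_max_right _ _)]
      refine max_le ?_ (abs_nonneg _)
      linarith [hb n x, le_abs_self (g x)]
    · filter_upwards [hlim] with x hx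
      refine squeeze_zero (fun n => le_max_right _ _) (fun n => ?_) (by simpa using hx.abs)
      refine max_le ?_ (abs_nonneg _)
      linarith [mul_nonneg hεpos.le (hA0 n x)]
  simp only [integral_zero] at h0
  obtain ⟨n₀, hn₀⟩ := Metric.tendsto_atTop.1 h0 (η / 2) (by positivity)
  refine ⟨n₀, fun n hn => ?_⟩
  have h1 := hn₀ n hn
  rw [Real.dist_eq, sub_zero] at h1 ⊢
  rw [abs_of_nonneg (integral_nonneg fun x => abs_nonneg _)]
  have h2 : ∫ x, |W n x| ∂μ ≤ ∫ x, (ε * A n x + max (|W n x| - ε * A n x) 0) ∂μ := by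
    refine integral_mono (hW n).abs (((hA n).const_mul ε).add (hpos n)) fun x => ?_
    have := le_max_left (|W n x| - ε * A n x) 0
    simp only
    linarith
  rw [integral_add ((hA n).const_mul ε) (hpos n), integral_const_mul] at h2
  have h3 : ε * ∫ x, A n x ∂μ ≤ ε * M := mul_le_mul_of_nonneg_left (hM n) hεpos.le
  have h4 : ε * M < η / 2 := by
    rw [hε, div_mul_eq_mul_div, div_lt_div_iff₀ (by positivity) (by positivity)]
    nlinarith
  linarith [le_abs_self (∫ x, max (|W n x| - ε * A n x) 0 ∂μ)]

lemma tendsto_integral_zero {X : Type*} [MeasurableSpace X] {μ : Measure X} {W A : ℕ → X → ℝ}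
    {M : ℝ} (hW : ∀ n, Integrable (W n) μ) (hlim : ∀ᵐ x ∂μ, Tendsto (fun n => W n x) atTop (𝓝 0))
    (hA : ∀ n, Integrable (A n) μ) (hA0 : ∀ n x, 0 ≤ A n x) (hM : ∀ n, ∫ x, A n x ∂μ ≤ M)
    (hdom : ∀ ε : ℝ, 0 < ε → ∃ g : X → ℝ, Integrable g μ ∧
      ∀ n x, |W n x| ≤ ε * A n x + g x) :
    Tendsto (fun n => ∫ x, W n x ∂μ) atTop (𝓝 0) :=
  squeeze_zero_norm (fun n => norm_integral_le_integral_norm (W n))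
    (tendsto_integral_abs_zero hW hlim hA hA0 hM hdom)

lemma abs_mul_le_young {a b ε : ℝ} (hε : 0 < ε) : |a * b| ≤ ε * b ^ 2 + a ^ 2 / (4 * ε) := by
  have h : ε * b ^ 2 + a ^ 2 / (4 * ε) - a * b = (2 * ε * b - a) ^ 2 / (4 * ε) := by
    field_simp; ring
  have h' : ε * b ^ 2 + a ^ 2 / (4 * ε) + a * b = (2 * ε * b + a) ^ 2 / (4 * ε) := by
    field_simp; ring
  have p1 : 0 ≤ (2 * ε * b - a) ^ 2 / (4 * ε) := by positivity
  have p2 : 0 ≤ (2 * ε * b + a) ^ 2 / (4 * ε) := by positivity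
  rw [abs_le]
  constructor <;> linarith

/-- Bounded sequences in `L^2` which converge to `0` almost everywhere converge weakly to `0`. -/
lemma tendsto_integral_mul_zero {X : Type*} [MeasurableSpace X] {μ : Measure X} {φ : X → ℝ}
    {F : ℕ → X → ℝ} {M : ℝ} (hφ : MemLp φ 2 μ) (hF : ∀ n, MemLp (F n) 2 μ)
    (hM : ∀ n, ∫ x, F n x ^ 2 ∂μ ≤ M) (hlim : ∀ᵐ x ∂μ, Tendsto (fun n => F n x) atTop (𝓝 0)) :
    Tendsto (fun n => ∫ x, φ x * F n x ∂μ) atTop (𝓝 0) := by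
  refine tendsto_integral_zero (A := fun n x => F n x ^ 2) (M := M)
    (fun n => hφ.integrable_mul (hF n)) ?_ (fun n => (hF n).integrable_sq)
    (fun n x => sq_nonneg _) hM fun ε hε => ?_
  · filter_upwards [hlim] with x hx
    simpa using hx.const_mul (φ x)
  · exact ⟨fun x => φ x ^ 2 / (4 * ε), hφ.integrable_sq.div_const _,
      fun n x => abs_mul_le_young hε⟩

lemma tendsto_fracForm_zero {N : ℕ} {s M : ℝ} {u : Space N → ℝ} {v : ℕ → Space N → ℝ}
    (hu : MemHs s u) (hv : ∀ n, MemHs s (v n)) (hM : ∀ n, gagliardoSq s (v n) ≤ M)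
    (hlim : ∀ᵐ x, Tendsto (fun n => v n x) atTop (𝓝 0)) :
    Tendsto (fun n => fracForm s u (v n)) atTop (𝓝 0) := by
  have h : Tendsto (fun n => ∫ z, gagliardoKernel s u (v n) z ∂(volume.prod volume)) atTop
      (𝓝 0) := by
    refine tendsto_integral_zero (A := fun n => gagliardoKernel s (v n) (v n)) (M := M)
      (fun n => integrable_gagliardoKernel hu (hv n)) ?_ (fun n => (hv n).gagliardo)
      (fun n z => gagliardoKernel_self_nonneg z) hM fun ε hε => ?_
    · filter_upwards [Measure.quasiMeasurePreserving_fst.ae hlim,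
        Measure.quasiMeasurePreserving_snd.ae hlim] with z h1 h2
      simpa [gagliardoKernel] using
        ((h1.sub h2).const_mul (u z.1 - u z.2)).div_const (‖z.1 - z.2‖ ^ ((N : ℝ) + 2 * s))
    · refine ⟨fun z => gagliardoKernel s u u z / (4 * ε), hu.gagliardo.div_const _, fun n z => ?_⟩
      have hd : 0 ≤ ‖z.1 - z.2‖ ^ ((N : ℝ) + 2 * s) := by positivity
      have := abs_mul_le_young (a := u z.1 - u z.2) (b := v n z.1 - v n z.2) hε
      simp only [gagliardoKernel, abs_div, abs_of_nonneg hd]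
      calc _ ≤ (ε * (v n z.1 - v n z.2) ^ 2 + (u z.1 - u z.2) ^ 2 / (4 * ε)) /
            ‖z.1 - z.2‖ ^ ((N : ℝ) + 2 * s) := by gcongr
        _ = _ := by ring
  simpa [fracForm] using h.const_mul (fracConst N s / 2)

end Convergence

/-! ### Brezis-Lieb splitting of the nonlocal energy -/

section BrezisLieb

/-- Choose δ so that (1±δ)^t is within η of 1. For |x| ≤ δ|y| the sum is a relative perturbation of
y; for |x| > δ|y| everything is controlled by |x|. -/
lemma exists_abs_rpow_add_sub_le {t : ℝ} (ht : 0 < t) {η : ℝ} (hη : 0 < η) :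
    ∃ C : ℝ, 0 ≤ C ∧ ∀ x y : ℝ, |(|x + y| ^ t) - |y| ^ t| ≤ η * |y| ^ t + C * |x| ^ t := by
  have h1 : ∀ᶠ δ : ℝ in 𝓝 0, (1 + δ) ^ t < 1 + η := by
    have : ContinuousAt (fun δ : ℝ => (1 + δ) ^ t) 0 :=
      (continuousAt_const.add continuousAt_id).rpow_const (Or.inr ht.le)
    exact this.eventually (gt_mem_nhds (by simpa using hη))
  have h2 : ∀ᶠ δ : ℝ in 𝓝 0, 1 - η < (1 - δ) ^ t := by
    have : ContinuousAt (fun δ : ℝ => (1 - δ) ^ t) 0 :=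
      (continuousAt_const.sub continuousAt_id).rpow_const (Or.inr ht.le)
    exact this.eventually (lt_mem_nhds (by simpa using hη))
  have h3 : ∀ᶠ δ : ℝ in 𝓝 0, δ < 1 := gt_mem_nhds one_pos
  obtain ⟨δ, hδ0, hδ1, hδ2, hδ3⟩ := ((frequently_gt_nhds (0 : ℝ)).and_eventually
    (h1.and (h2.and h3))).exists
  refine ⟨(1 + 1 / δ) ^ t, by positivity, fun x y => ?_⟩
  have habs : |x + y| ≤ |x| + |y| := abs_add_le x y
  have habs2 : |y| - |x| ≤ |x + y| := by
    have := abs_sub_abs_le_abs_sub y (-x)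
    rw [abs_neg, sub_neg_eq_add, add_comm y x] at this
    exact this
  have hy0 : 0 ≤ |y| ^ t := by positivity
  have hx0 : 0 ≤ |x| ^ t := by positivity
  have hC0 : 0 ≤ (1 + 1 / δ) ^ t := by positivity
  rcases le_or_gt |x| (δ * |y|) with hle | hgt
  · have u1 : |x + y| ^ t ≤ (1 + η) * |y| ^ t := by
      calc |x + y| ^ t ≤ ((1 + δ) * |y|) ^ t :=
            Real.rpow_le_rpow (abs_nonneg _) (by linarith) ht.le
        _ = (1 + δ) ^ t * |y| ^ t := Real.mul_rpow (by positivity) (abs_nonneg _)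
        _ ≤ _ := by gcongr
    have u2 : (1 - η) * |y| ^ t ≤ |x + y| ^ t := by
      calc (1 - η) * |y| ^ t ≤ (1 - δ) ^ t * |y| ^ t := by gcongr
        _ = ((1 - δ) * |y|) ^ t := (Real.mul_rpow (by linarith) (abs_nonneg _)).symm
        _ ≤ _ := Real.rpow_le_rpow (mul_nonneg (by linarith) (abs_nonneg _)) (by linarith) ht.le
    rw [abs_le]
    constructor <;> nlinarith [mul_nonneg hC0 hx0]
  · have hyx : |y| ≤ 1 / δ * |x| := by
      rw [one_div, inv_mul_eq_div, le_div_iff₀ hδ0]; linarith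
    have u1 : |x + y| ^ t ≤ (1 + 1 / δ) ^ t * |x| ^ t := by
      rw [← Real.mul_rpow (by positivity) (abs_nonneg _)]
      exact Real.rpow_le_rpow (abs_nonneg _) (by linarith) ht.le
    have u2 : |y| ^ t ≤ (1 + 1 / δ) ^ t * |x| ^ t := by
      rw [← Real.mul_rpow (by positivity) (abs_nonneg _)]
      exact Real.rpow_le_rpow (abs_nonneg _) (by linarith [abs_nonneg x]) ht.le
    have u3 : 0 ≤ |x + y| ^ t := by positivity
    rw [abs_le]
    constructor <;> nlinarith [mul_nonneg hη.le hy0]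

variable {N : ℕ} {α t R ρ₁ ρ₂ : ℝ} {κ : Space N → ℝ}

lemma exists_rpow_sub_one_le {ρ η : ℝ} (hρ : 1 < ρ) (hη : 0 < η) :
    ∃ θ₀ : ℝ, 0 < θ₀ ∧ ∀ θ : ℝ, 0 < θ → θ ≤ θ₀ → θ⁻¹ * θ ^ ρ ≤ η := by
  refine ⟨η ^ (1 / (ρ - 1)), by positivity, fun θ h0 h1 => ?_⟩
  have : θ⁻¹ * θ ^ ρ = θ ^ (ρ - 1) := by rw [Real.rpow_sub_one h0.ne']; ring
  rw [this]
  calc θ ^ (ρ - 1) ≤ (η ^ (1 / (ρ - 1))) ^ (ρ - 1) :=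
        Real.rpow_le_rpow h0.le h1 (by linarith)
    _ = η := by
        rw [← Real.rpow_mul hη.le, one_div, inv_mul_cancel₀ (by linarith), Real.rpow_one]

/-- Apply the Young bound to a and θb and divide by θ. Every term containing b gains a factor
θ^(ρ-1), small since ρ > 1; only the terms in a alone get a large constant. With a fixed and b
bounded this is the shape of majorant that `tendsto_integral_zero` accepts. -/
lemma RieszSplit.exists_bound (hS : RieszSplit α t R ρ₁ ρ₂ κ) {η : ℝ} (hη : 0 < η) :
    ∃ C : ℝ, 0 ≤ C ∧ ∀ a b : ℝ, 0 ≤ a → 0 ≤ b → ∀ z, a * b * rieszKernel α z ≤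
      η * ((a ^ ρ₁ * b ^ ρ₁ + (a ^ ρ₁ + b ^ ρ₁) * κ z) +
        (a ^ ρ₂ * b ^ ρ₂ + (a ^ ρ₂ + b ^ ρ₂) * κ z)) + C * (a ^ ρ₁ * κ z + a ^ ρ₂ * κ z) := by
  obtain ⟨θ₁, hθ₁, h1⟩ := exists_rpow_sub_one_le hS.one_lt₁ hη
  obtain ⟨θ₂, hθ₂, h2⟩ := exists_rpow_sub_one_le hS.one_lt₂ hη
  set θ := min θ₁ θ₂
  have hθ : 0 < θ := lt_min hθ₁ hθ₂
  specialize h1 θ hθ (min_le_left _ _)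
  specialize h2 θ hθ (min_le_right _ _)
  refine ⟨θ⁻¹, by positivity, fun a b ha hb z => ?_⟩
  have hκ := hS.nonneg z
  have key := hS.bound a (θ * b) ha (by positivity) z
  rw [Real.mul_rpow hθ.le hb, Real.mul_rpow hθ.le hb] at key
  have e : a * b * rieszKernel α z = θ⁻¹ * (a * (θ * b) * rieszKernel α z) := by field_simp
  rw [e]
  have p1 : 0 ≤ a ^ ρ₁ * b ^ ρ₁ + b ^ ρ₁ * κ z := by positivity
  have p2 : 0 ≤ a ^ ρ₂ * b ^ ρ₂ + b ^ ρ₂ * κ z := by positivity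
  have p3 : 0 ≤ η * (a ^ ρ₁ * κ z + a ^ ρ₂ * κ z) := by positivity
  calc θ⁻¹ * (a * (θ * b) * rieszKernel α z) ≤ θ⁻¹ * _ :=
        mul_le_mul_of_nonneg_left key (by positivity)
    _ = (θ⁻¹ * θ ^ ρ₁) * (a ^ ρ₁ * b ^ ρ₁ + b ^ ρ₁ * κ z) +
        (θ⁻¹ * θ ^ ρ₂) * (a ^ ρ₂ * b ^ ρ₂ + b ^ ρ₂ * κ z) +
        θ⁻¹ * (a ^ ρ₁ * κ z + a ^ ρ₂ * κ z) := by ring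
    _ ≤ η * (a ^ ρ₁ * b ^ ρ₁ + b ^ ρ₁ * κ z) + η * (a ^ ρ₂ * b ^ ρ₂ + b ^ ρ₂ * κ z) +
        θ⁻¹ * (a ^ ρ₁ * κ z + a ^ ρ₂ * κ z) := by gcongr
    _ ≤ _ := by linarith

/-- Two-point form of the Brezis-Lieb estimate, with unprimed values at x and primed values at y: a
comes from the fixed function, b from the vanishing sequence, c from their sum. Only the product bb'
carries the small factor, so each remaining product contains the fixed function. -/
lemma abs_mul_sub_sub_le {a a' b b' c c' η K : ℝ} (ha : 0 ≤ a) (ha' : 0 ≤ a') (hb : 0 ≤ b)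
    (hb' : 0 ≤ b') (hc' : 0 ≤ c') (hη : 0 ≤ η) (hη1 : η ≤ 1) (hK : 0 ≤ K)
    (h : |c - b| ≤ η * b + K * a) (h' : |c' - b'| ≤ η * b' + K * a') :
    |c * c' - a * a' - b * b'| ≤
      3 * η * (b * b') + (2 * K + K ^ 2 + 1) * (a * b' + a' * b + a * a') := by
  have e : c * c' - a * a' - b * b' = (c - b) * c' + b * (c' - b') - a * a' := by ring
  have hc'2 : c' ≤ (1 + η) * b' + K * a' := by linarith [le_abs_self (c' - b')]
  have t1 : |(c - b) * c'| ≤ (η * b + K * a) * ((1 + η) * b' + K * a') := by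
    rw [abs_mul, abs_of_nonneg hc']
    exact mul_le_mul h hc'2 hc' (by positivity)
  have t2 : |b * (c' - b')| ≤ b * (η * b' + K * a') := by
    rw [abs_mul, abs_of_nonneg hb]
    exact mul_le_mul_of_nonneg_left h' hb
  have t3 : |a * a'| = a * a' := abs_of_nonneg (by positivity)
  have tri : |c * c' - a * a' - b * b'| ≤ |(c - b) * c'| + |b * (c' - b')| + |a * a'| := by
    rw [e]
    exact (abs_sub _ _).trans (add_le_add_left (abs_add_le _ _) _)
  have hbb : 0 ≤ b * b' := by positivity
  have hab : 0 ≤ a * b' := by positivity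
  have hba : 0 ≤ a' * b := by positivity
  have haa : 0 ≤ a * a' := by positivity
  have f1 : η * η * (b * b') ≤ η * (b * b') := by nlinarith [mul_nonneg hη hbb]
  have f2 : η * (K * (a' * b)) ≤ K * (a' * b) := by nlinarith [mul_nonneg hK hba]
  have f3 : η * (K * (a * b')) ≤ K * (a * b') := by nlinarith [mul_nonneg hK hab]
  have f4 : 0 ≤ K ^ 2 * (a * b') := by positivity
  have f5 : 0 ≤ K ^ 2 * (a' * b) := by positivity
  have f6 : 0 ≤ K * (a * a') := by positivity
  nlinarith

/-- The Brezis-Lieb lemma for the nonlocal energy. -/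
lemma tendsto_rieszForm_brezisLieb (hα0 : 0 < α) (hαN : α < N) (hS : RieszSplit α t R ρ₁ ρ₂ κ)
    (ht : 0 < t) {u w : Space N → ℝ} {v : ℕ → Space N → ℝ} {C M : ℝ}
    (hw : AEStronglyMeasurable w) (hw0 : ∀ x, 0 ≤ w x) (hC : ∀ x, w x ≤ C)
    (hu : RieszAdm ρ₁ ρ₂ fun x => |u x| ^ t) (hv : ∀ n, RieszAdm ρ₁ ρ₂ fun x => |v n x| ^ t)
    (huv : ∀ n, RieszAdm ρ₁ ρ₂ fun x => |u x + v n x| ^ t)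
    (hM₁ : ∀ n, ∫ x, (|v n x| ^ t) ^ ρ₁ ≤ M) (hM₂ : ∀ n, ∫ x, (|v n x| ^ t) ^ ρ₂ ≤ M)
    (hlim : ∀ᵐ x, Tendsto (fun n => v n x) atTop (𝓝 0)) :
    Tendsto (fun n => rieszForm α (fun x => w x * |u x + v n x| ^ t) (fun x => w x * |u x + v n x| ^ t)
      - rieszForm α (fun x => w x * |u x| ^ t) (fun x => w x * |u x| ^ t)
      - rieszForm α (fun x => w x * |v n x| ^ t) (fun x => w x * |v n x| ^ t)) atTop (𝓝 0) := by
  have hC0 : 0 ≤ C := (hw0 0).trans (hC 0)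
  have i1 := fun n => integrable_rieszIntegrand hα0 hαN hS ((huv n).weight hS hw hw0 hC)
    ((huv n).weight hS hw hw0 hC)
  have i2 := integrable_rieszIntegrand hα0 hαN hS (hu.weight hS hw hw0 hC)
    (hu.weight hS hw hw0 hC)
  have i3 := fun n => integrable_rieszIntegrand hα0 hαN hS ((hv n).weight hS hw hw0 hC)
    ((hv n).weight hS hw hw0 hC)
  have j3 := fun n => integrable_rieszIntegrand hα0 hαN hS (hv n) (hv n)
  have j2 := integrable_rieszIntegrand hα0 hαN hS hu hu
  have y1 := fun n => integrable_youngMajorant hS.integrable hS.even hu.int₁ (hv n).int₁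
  have y2 := fun n => integrable_youngMajorant hS.integrable hS.even hu.int₂ (hv n).int₂
  have y3 := fun n => (y1 n).swap
  have y4 := fun n => (y2 n).swap
  set a : Space N → ℝ := fun x => |u x| ^ t
  set b : ℕ → Space N → ℝ := fun n x => |v n x| ^ t
  have hM0 : 0 ≤ M := (integral_nonneg fun x => by positivity).trans (hM₁ 0)
  have hκ0 : 0 ≤ ∫ x, κ x := integral_nonneg hS.nonneg
  have ha1 : 0 ≤ ∫ x, a x ^ ρ₁ := integral_nonneg fun x => by positivity
  have ha2 : 0 ≤ ∫ x, a x ^ ρ₂ := integral_nonneg fun x => by positivity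
  have hb1 : ∀ n, 0 ≤ ∫ x, b n x ^ ρ₁ := fun n => integral_nonneg fun x => by positivity
  have hb2 : ∀ n, 0 ≤ ∫ x, b n x ^ ρ₂ := fun n => integral_nonneg fun x => by positivity
  have e : ∀ n, rieszForm α (fun x => w x * |u x + v n x| ^ t) (fun x => w x * |u x + v n x| ^ t)
      - rieszForm α (fun x => w x * |u x| ^ t) (fun x => w x * |u x| ^ t)
      - rieszForm α (fun x => w x * |v n x| ^ t) (fun x => w x * |v n x| ^ t)
      = ∫ z : Space N × Space N, w z.1 * w z.2 * (|u z.1 + v n z.1| ^ t * |u z.2 + v n z.2| ^ t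
        - a z.1 * a z.2 - b n z.1 * b n z.2) * rieszKernel α (z.1 - z.2) ∂(volume.prod volume) := by
    intro n
    have i12 : Integrable (fun z : Space N × Space N =>
      w z.1 * |u z.1 + v n z.1| ^ t * (w z.2 * |u z.2 + v n z.2| ^ t) * rieszKernel α (z.1 - z.2) -
      w z.1 * |u z.1| ^ t * (w z.2 * |u z.2| ^ t) * rieszKernel α (z.1 - z.2))
      (volume.prod volume) := (i1 n).sub i2
    unfold rieszForm
    rw [← integral_sub (i1 n) i2, ← integral_sub i12 (i3 n)]
    congr 1
    ext z
    simp only [a, b]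
    ring
  simp only [e]
  -- A n collects every term that involves the vanishing sequence and is bounded in L¹: the diagonal
  -- term and the Young majorants of the two mixed terms.
  refine tendsto_integral_zero
    (A := fun n z => C ^ 2 * (3 * (b n z.1 * b n z.2 * rieszKernel α (z.1 - z.2)) +
      (youngMajorant ρ₁ κ a (b n) z + youngMajorant ρ₂ κ a (b n) z) +
      (youngMajorant ρ₁ κ a (b n) z.swap + youngMajorant ρ₂ κ a (b n) z.swap)))
    (M := C ^ 2 * (3 * ((M * M + (M + M) * ∫ x, κ x) + (M * M + (M + M) * ∫ x, κ x)) +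
      2 * (((∫ x, a x ^ ρ₁) * M + ((∫ x, a x ^ ρ₁) + M) * ∫ x, κ x) +
        ((∫ x, a x ^ ρ₂) * M + ((∫ x, a x ^ ρ₂) + M) * ∫ x, κ x)))) ?_ ?_ ?_ ?_ ?_ ?_
  · intro n
    refine (((i1 n).sub i2).sub (i3 n)).congr (Eventually.of_forall fun z => ?_)
    simp only [a, b, Pi.sub_apply]
    ring
  · filter_upwards [Measure.quasiMeasurePreserving_fst.ae hlim,
      Measure.quasiMeasurePreserving_snd.ae hlim] with z h1 h2
    have c1 : ∀ x, Tendsto (fun n => v n x) atTop (𝓝 0) →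
        Tendsto (fun n => |u x + v n x| ^ t) atTop (𝓝 (a x)) := fun x hx => by
      have := ((hx.const_add (u x)).abs).rpow_const (p := t) (Or.inr ht.le)
      simpa [a] using this
    have c2 : ∀ x, Tendsto (fun n => v n x) atTop (𝓝 0) →
        Tendsto (fun n => b n x) atTop (𝓝 0) := fun x hx => by
      have := hx.abs.rpow_const (p := t) (Or.inr ht.le)
      simpa [b, Real.zero_rpow ht.ne'] using this
    have := (((((c1 _ h1).mul (c1 _ h2)).sub_const (a z.1 * a z.2)).sub
      ((c2 _ h1).mul (c2 _ h2))).const_mul (w z.1 * w z.2)).mul_const (rieszKernel α (z.1 - z.2))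
    simpa using this
  · intro n
    exact ((((j3 n).const_mul 3).add ((y1 n).add (y2 n))).add ((y3 n).add (y4 n))).const_mul _
  · intro n z
    have g1 := youngMajorant_nonneg (ρ := ρ₁) hS.nonneg hu.nonneg (hv n).nonneg
    have g2 := youngMajorant_nonneg (ρ := ρ₂) hS.nonneg hu.nonneg (hv n).nonneg
    have := g1 z
    have := g2 z
    have := g1 z.swap
    have := g2 z.swap
    have := (hv n).nonneg z.1
    have := (hv n).nonneg z.2
    have := rieszKernel_nonneg hα0 hαN (z.1 - z.2)
    positivity
  · intro n
    have s1 : Integrable (fun z : Space N × Space N =>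
      3 * (b n z.1 * b n z.2 * rieszKernel α (z.1 - z.2))) (volume.prod volume) :=
      (j3 n).const_mul 3
    have s2 : Integrable (fun z => youngMajorant ρ₁ κ a (b n) z + youngMajorant ρ₂ κ a (b n) z)
      (volume.prod volume) := (y1 n).add (y2 n)
    have s3 : Integrable (fun z : Space N × Space N =>
      youngMajorant ρ₁ κ a (b n) z.swap + youngMajorant ρ₂ κ a (b n) z.swap)
      (volume.prod volume) := s2.swap
    have s12 : Integrable (fun z : Space N × Space N =>
      3 * (b n z.1 * b n z.2 * rieszKernel α (z.1 - z.2)) +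
      (youngMajorant ρ₁ κ a (b n) z + youngMajorant ρ₂ κ a (b n) z)) (volume.prod volume) :=
      s1.add s2
    rw [integral_const_mul, integral_add s12 s3, integral_add s1 s2, integral_const_mul]
    rw [integral_prod_swap (fun z => youngMajorant ρ₁ κ a (b n) z + youngMajorant ρ₂ κ a (b n) z),
      integral_add (y1 n) (y2 n), integral_youngMajorant hS.integrable hS.even hu.int₁ (hv n).int₁,
      integral_youngMajorant hS.integrable hS.even hu.int₂ (hv n).int₂]
    have q := rieszForm_le hα0 hαN hS (hv n) (hv n)
    have := hM₁ n
    have := hM₂ n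
    have := hb1 n
    have := hb2 n
    have q2 : rieszForm α (b n) (b n) ≤
        ((M * M + (M + M) * ∫ x, κ x) + (M * M + (M + M) * ∫ x, κ x)) := by
      refine q.trans ?_
      gcongr
    have q3 : (∫ x, a x ^ ρ₁) * (∫ x, b n x ^ ρ₁) + ((∫ x, a x ^ ρ₁) + ∫ x, b n x ^ ρ₁) *
        (∫ x, κ x) ≤ (∫ x, a x ^ ρ₁) * M + ((∫ x, a x ^ ρ₁) + M) * ∫ x, κ x := by gcongr
    have q4 : (∫ x, a x ^ ρ₂) * (∫ x, b n x ^ ρ₂) + ((∫ x, a x ^ ρ₂) + ∫ x, b n x ^ ρ₂) *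
        (∫ x, κ x) ≤ (∫ x, a x ^ ρ₂) * M + ((∫ x, a x ^ ρ₂) + M) * ∫ x, κ x := by gcongr
    refine mul_le_mul_of_nonneg_left ?_ (by positivity)
    unfold rieszForm at q2
    linarith
  · intro ε hε
    -- The cap at 1 is required by `abs_mul_sub_sub_le`.
    set η := min 1 ε
    have hη : 0 < η := lt_min one_pos hε
    obtain ⟨K, hK, hKb⟩ := exists_abs_rpow_add_sub_le ht hη
    set L := 2 * K + K ^ 2 + 1
    have hL : 0 < L := by positivity
    -- The mixed terms occur with the factor L, which ε/L compensates.
    obtain ⟨C', hC', hcross⟩ := hS.exists_bound (div_pos hε hL)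
    have k1 := integrable_fst_mul_sub hu.int₁ hS.integrable hS.even
    have k2 := integrable_fst_mul_sub hu.int₂ hS.integrable hS.even
    refine ⟨fun z => C ^ 2 * (L * (C' * (a z.1 ^ ρ₁ * κ (z.1 - z.2) + a z.1 ^ ρ₂ * κ (z.1 - z.2)) +
      C' * (a z.2 ^ ρ₁ * κ (z.2 - z.1) + a z.2 ^ ρ₂ * κ (z.2 - z.1)) +
      a z.1 * a z.2 * rieszKernel α (z.1 - z.2))), ?_, fun n z => ?_⟩
    · exact (((((k1.add k2).const_mul C').add ((k1.add k2).swap.const_mul C')).add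
        j2).const_mul L).const_mul _
    · have a1 := hu.nonneg z.1
      have a2 := hu.nonneg z.2
      have b1 := (hv n).nonneg z.1
      have b2 := (hv n).nonneg z.2
      have hI := rieszKernel_nonneg hα0 hαN (z.1 - z.2)
      have hA := abs_mul_sub_sub_le (c := |u z.1 + v n z.1| ^ t) (c' := |u z.2 + v n z.2| ^ t)
        a1 a2 b1 b2 (by positivity) hη.le (min_le_left _ _) hK (hKb (u z.1) (v n z.1))
        (hKb (u z.2) (v n z.2))
      have x1 := hcross (a z.1) (b n z.2) a1 b2 (z.1 - z.2)
      have x2 := hcross (a z.2) (b n z.1) a2 b1 (z.2 - z.1)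
      have hsym : rieszKernel α (z.2 - z.1) = rieszKernel α (z.1 - z.2) := by
        rw [← rieszKernel_neg, neg_sub]
      rw [hsym] at x2
      have hww : w z.1 * w z.2 ≤ C ^ 2 := by
        rw [pow_two]; exact mul_le_mul (hC _) (hC _) (hw0 _) hC0
      have hww0 : 0 ≤ w z.1 * w z.2 := mul_nonneg (hw0 _) (hw0 _)
      have e1 : ε / L * L = ε := by field_simp
      have hηε : η ≤ ε := min_le_right _ _
      rw [abs_mul, abs_mul, abs_of_nonneg hI, abs_of_nonneg hww0, mul_assoc]
      have step1 : |(|u z.1 + v n z.1| ^ t * |u z.2 + v n z.2| ^ t - a z.1 * a z.2 - b n z.1 * b n z.2)|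
          * rieszKernel α (z.1 - z.2) ≤ (3 * η * (b n z.1 * b n z.2) +
            L * (a z.1 * b n z.2 + a z.2 * b n z.1 + a z.1 * a z.2)) * rieszKernel α (z.1 - z.2) :=
        mul_le_mul_of_nonneg_right hA hI
      have step2 : η * (b n z.1 * b n z.2 * rieszKernel α (z.1 - z.2)) ≤
          ε * (b n z.1 * b n z.2 * rieszKernel α (z.1 - z.2)) := by
        refine mul_le_mul_of_nonneg_right hηε ?_
        positivity
      have step3 := mul_le_mul_of_nonneg_left x1 hL.le
      have step4 := mul_le_mul_of_nonneg_left x2 hL.le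
      rw [mul_add, ← mul_assoc L (ε / L), mul_comm L (ε / L), e1] at step3 step4
      have step5 : |(|u z.1 + v n z.1| ^ t * |u z.2 + v n z.2| ^ t - a z.1 * a z.2 - b n z.1 * b n z.2)|
          * rieszKernel α (z.1 - z.2) ≤ ε * (3 * (b n z.1 * b n z.2 * rieszKernel α (z.1 - z.2)) +
      (youngMajorant ρ₁ κ a (b n) z + youngMajorant ρ₂ κ a (b n) z) +
      (youngMajorant ρ₁ κ a (b n) z.swap + youngMajorant ρ₂ κ a (b n) z.swap)) +
      (L * (C' * (a z.1 ^ ρ₁ * κ (z.1 - z.2) + a z.1 ^ ρ₂ * κ (z.1 - z.2)) +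
      C' * (a z.2 ^ ρ₁ * κ (z.2 - z.1) + a z.2 ^ ρ₂ * κ (z.2 - z.1)) +
      a z.1 * a z.2 * rieszKernel α (z.1 - z.2))) := by
        simp only [youngMajorant, Prod.fst_swap, Prod.snd_swap]
        linarith
      calc _ ≤ C ^ 2 * _ := mul_le_mul hww step5 (by positivity) (by positivity)
        _ = _ := by ring

end BrezisLieb

/-! ### Weak sequential compactness in L² -/

section WeakSubsequence

variable {N : ℕ}

lemma norm_toLp_sq {X : Type*} [MeasurableSpace X] {μ : Measure X} {f : X → ℝ} (hf : MemLp f 2 μ) :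
    ‖hf.toLp f‖ ^ 2 = ∫ x, f x ^ 2 ∂μ := by
  rw [← real_inner_self_eq_norm_sq, L2.inner_def]
  refine integral_congr_ae ?_
  filter_upwards [hf.coeFn_toLp] with x hx
  rw [hx]
  simp [pow_two]

lemma inner_toLp {X : Type*} [MeasurableSpace X] {μ : Measure X} {f g : X → ℝ} (hf : MemLp f 2 μ)
    (hg : MemLp g 2 μ) : inner ℝ (hf.toLp f) (hg.toLp g) = ∫ x, f x * g x ∂μ := by
  rw [L2.inner_def]
  refine integral_congr_ae ?_
  filter_upwards [hf.coeFn_toLp, hg.coeFn_toLp] with x hx hy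
  rw [hx, hy]
  simp [mul_comm]

/-- Sequential Banach-Alaoglu in the separable space L², through the Riesz identification with its
dual. The weak limit is left anonymous: only convergence of the pairings is used. -/
lemma exists_subseq_tendsto_integral_mul {u : ℕ → Space N → ℝ} {M : ℝ}
    (hu : ∀ n, MemLp (u n) 2 volume) (hM : ∀ n, ∫ x, u n x ^ 2 ≤ M) :
    ∃ φ : ℕ → ℕ, StrictMono φ ∧ ∀ y : Space N → ℝ, MemLp y 2 volume →
      ∃ l : ℝ, Tendsto (fun n => ∫ x, u (φ n) x * y x) atTop (𝓝 l) := by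
  have : Fact ((2 : ℝ≥0∞) ≠ ∞) := ⟨by norm_num⟩
  have : SecondCountableTopology (Lp ℝ 2 (volume : Measure (Space N))) :=
    Lp.SecondCountableTopology
  let H := Lp ℝ 2 (volume : Measure (Space N))
  let x : ℕ → WeakDual ℝ H := fun n =>
    StrongDual.toWeakDual (InnerProductSpace.toDual ℝ H ((hu n).toLp (u n)))
  have hx : ∀ n, x n ∈ WeakDual.toStrongDual ⁻¹' Metric.closedBall (0 : StrongDual ℝ H) (√M) := by
    intro n
    have : ‖InnerProductSpace.toDual ℝ H ((hu n).toLp (u n))‖ ≤ √M := by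
      rw [LinearIsometryEquiv.norm_map]
      refine Real.le_sqrt_of_sq_le ?_
      rw [norm_toLp_sq]
      exact hM n
    exact mem_closedBall_zero_iff.2 this
  obtain ⟨f, -, φ, hφ, hlim⟩ := WeakDual.isSeqCompact_closedBall ℝ H 0 (√M) hx
  refine ⟨φ, hφ, fun y hy => ⟨f (hy.toLp y), ?_⟩⟩
  have h := (tendsto_iff_forall_eval_tendsto_topDualPairing.1 hlim) (hy.toLp y)
  refine (Tendsto.congr (fun n => ?_) h)
  rw [← inner_toLp (hu (φ n)) hy]
  rfl

end WeakSubsequence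

/-! ### Fatou's lemma for real-valued sequences -/

section Fatou

lemma integrable_and_integral_le_of_tendsto {X : Type*} [MeasurableSpace X] {μ : Measure X}
    {F : ℕ → X → ℝ} {G : X → ℝ} {M : ℝ} (hF : ∀ n, Integrable (F n) μ) (h0 : ∀ n x, 0 ≤ F n x)
    (hM : ∀ n, ∫ x, F n x ∂μ ≤ M) (hlim : ∀ᵐ x ∂μ, Tendsto (fun n => F n x) atTop (𝓝 (G x))) :
    Integrable G μ ∧ ∫ x, G x ∂μ ≤ M := by
  have hM0 : 0 ≤ M := (integral_nonneg (h0 0)).trans (hM 0)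
  have hGm : AEStronglyMeasurable G μ :=
    aestronglyMeasurable_of_tendsto_ae atTop (fun n => (hF n).1) hlim
  have hG0 : 0 ≤ᵐ[μ] G := by
    filter_upwards [hlim] with x hx
    exact ge_of_tendsto' hx fun n => h0 n x
  have h1 : ∫⁻ x, ENNReal.ofReal (G x) ∂μ ≤ ENNReal.ofReal M := by
    calc ∫⁻ x, ENNReal.ofReal (G x) ∂μ
        = ∫⁻ x, liminf (fun n => ENNReal.ofReal (F n x)) atTop ∂μ := by
          refine lintegral_congr_ae ?_
          filter_upwards [hlim] with x hx
          exact ((ENNReal.continuous_ofReal.tendsto _).comp hx).liminf_eq.symm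
      _ ≤ liminf (fun n => ∫⁻ x, ENNReal.ofReal (F n x) ∂μ) atTop :=
          lintegral_liminf_le' fun n => (hF n).1.aemeasurable.ennreal_ofReal
      _ ≤ ENNReal.ofReal M := by
          refine liminf_le_of_frequently_le' (Frequently.of_forall fun n => ?_)
          rw [← ofReal_integral_eq_lintegral_ofReal (hF n) (Eventually.of_forall (h0 n))]
          exact ENNReal.ofReal_le_ofReal (hM n)
  have hGi : Integrable G μ :=
    ⟨hGm, (hasFiniteIntegral_iff_ofReal hG0).2 (h1.trans_lt ENNReal.ofReal_lt_top)⟩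
  refine ⟨hGi, ?_⟩
  rw [← ofReal_integral_eq_lintegral_ofReal hGi hG0] at h1
  exact (ENNReal.ofReal_le_ofReal_iff hM0).1 h1

end Fatou

/-! ### Local compactness of H^s -/

section Compactness

variable {N : ℕ} {s : ℝ}

/-- Unlike in `sq_le_of_ball`, the last term is the square of the mean of u and not the mean of u².
Means over balls converge under weak convergence, and the first term is small with δ. -/
lemma sq_le_of_average (hs0 : 0 < s) {u : Space N → ℝ} (hu : MemLp u 2 volume) {x : Space N}
    (hG : Integrable fun y => gagliardoKernel s u u (x, y)) {δ : ℝ} (hδ : 0 < δ) :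
    u x ^ 2 ≤ 4 / volume.real (Metric.ball (0 : Space N) 1) *
      (δ ^ (2 * s) * (∫ y, gagliardoKernel s u u (x, y))) +
      4 * ((∫ y in Metric.ball x δ, u y) / volume.real (Metric.ball x δ)) ^ 2 := by
  set ω := volume.real (Metric.ball (0 : Space N) 1) with hω
  have hωpos : 0 < ω := by
    rw [hω, measureReal_def]
    exact ENNReal.toReal_pos (Metric.measure_ball_pos _ _ one_pos).ne' measure_ball_lt_top.ne
  have hvol : volume.real (Metric.ball x δ) = δ ^ (N : ℝ) * ω := by
    rw [hω, measureReal_def, Measure.addHaar_ball_of_pos _ _ hδ, ENNReal.toReal_mul,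
      ENNReal.toReal_ofReal (by positivity), measureReal_def]
    simp
  have huB : IntegrableOn u (Metric.ball x δ) :=
    hu.locallyIntegrable (by norm_num) |>.integrableOn_isCompact (isCompact_closedBall x δ)
      |>.mono_set Metric.ball_subset_closedBall
  have key : ∫ y in Metric.ball x δ, u x ^ 2 ≤
      ∫ y in Metric.ball x δ, ((u x ^ 2 / 4 + δ ^ ((N : ℝ) + 2 * s) * gagliardoKernel s u u (x, y))
        + u x * u y) := by
    refine setIntegral_mono_on (integrableOn_const measure_ball_lt_top.ne) ?_ measurableSet_ball
      fun y hy => ?_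
    · exact ((integrableOn_const measure_ball_lt_top.ne).add (hG.const_mul _).integrableOn).add
        (huB.const_mul _)
    · have h1 : (u x - u y) ^ 2 ≤ δ ^ ((N : ℝ) + 2 * s) * gagliardoKernel s u u (x, y) := by
        rcases eq_or_ne x y with rfl | hxy
        · simp [gagliardoKernel]
        · have hpos : 0 < ‖x - y‖ := norm_pos_iff.2 (sub_ne_zero.2 hxy)
          have hlt : ‖x - y‖ ≤ δ := by
            rw [← dist_eq_norm, dist_comm]; exact (Metric.mem_ball.1 hy).le
          have h2 : ‖x - y‖ ^ ((N : ℝ) + 2 * s) ≤ δ ^ ((N : ℝ) + 2 * s) :=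
            Real.rpow_le_rpow hpos.le hlt (by positivity)
          have h3 : 0 < ‖x - y‖ ^ ((N : ℝ) + 2 * s) := by positivity
          simp only [gagliardoKernel]
          rw [← mul_div_assoc, le_div_iff₀ h3, ← pow_two, mul_comm]
          gcongr
      -- u(x)² ≤ u(x)²/4 + (u(x)-u(y))² + u(x)u(y), the difference of the two sides being (u(x)/2 -
      -- u(y))². Linearity in u(y) is what produces the mean of u.
      nlinarith [sq_nonneg (u x / 2 - (u x - u y))]
  have h1 : ∀ c : ℝ, ∫ y in Metric.ball x δ, c = δ ^ (N : ℝ) * ω * c := fun c => by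
    rw [setIntegral_const, hvol, smul_eq_mul]
  have h2 : ∫ y in Metric.ball x δ, gagliardoKernel s u u (x, y)
      ≤ ∫ y, gagliardoKernel s u u (x, y) :=
    setIntegral_le_integral hG (Eventually.of_forall fun y => gagliardoKernel_self_nonneg _)
  have i1 : IntegrableOn (fun _ => u x ^ 2 / 4) (Metric.ball x δ) :=
    integrableOn_const measure_ball_lt_top.ne
  have i2 : IntegrableOn (fun y => δ ^ ((N : ℝ) + 2 * s) * gagliardoKernel s u u (x, y))
    (Metric.ball x δ) := (hG.const_mul _).integrableOn
  have i12 : IntegrableOn (fun y => u x ^ 2 / 4 +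
    δ ^ ((N : ℝ) + 2 * s) * gagliardoKernel s u u (x, y)) (Metric.ball x δ) := i1.add i2
  rw [h1, integral_add i12 (huB.const_mul _), integral_add i1 i2, integral_const_mul,
    integral_const_mul, h1] at key
  have hδN : 0 < δ ^ (N : ℝ) := by positivity
  set V := δ ^ (N : ℝ) * ω with hV
  have hVpos : 0 < V := by positivity
  rw [hvol]
  set P := (∫ y in Metric.ball x δ, u y) / V with hP
  have hPV : (∫ y in Metric.ball x δ, u y) = V * P := by rw [hP]; field_simp
  rw [hPV] at key
  set F := ∫ y, gagliardoKernel s u u (x, y) with hF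
  have key2 : V * u x ^ 2 ≤ V * (u x ^ 2 / 4) + δ ^ ((N : ℝ) + 2 * s) * F + u x * (V * P) := by
    refine key.trans ?_
    gcongr
  have e1 : δ ^ ((N : ℝ) + 2 * s) * F = V * (1 / ω * (δ ^ (2 * s) * F)) := by
    rw [Real.rpow_add hδ, hV]
    field_simp
  have e2 : u x * (V * P) = V * (u x * P) := by ring
  rw [e1, e2, ← mul_add, ← mul_add] at key2
  have key3 := le_of_mul_le_mul_left key2 hVpos
  have e3 : 4 / ω * (δ ^ (2 * s) * F) = 4 * (1 / ω * (δ ^ (2 * s) * F)) := by ring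
  rw [e3]
  have := hVpos.le
  have hF0 : 0 ≤ F := integral_nonneg fun y => gagliardoKernel_self_nonneg _
  have h5 : 0 ≤ 1 / ω * (δ ^ (2 * s) * F) := by positivity
  nlinarith [sq_nonneg (u x / 2 - P), sq_nonneg P]

lemma aestronglyMeasurable_ball_integral {u : Space N → ℝ} (hu : AEStronglyMeasurable u volume)
    (δ : ℝ) : AEStronglyMeasurable (fun x => ∫ y in Metric.ball x δ, u y) volume := by
  have hset : MeasurableSet {z : Space N × Space N | z.2 ∈ Metric.ball z.1 δ} := by
    have : IsOpen {z : Space N × Space N | dist z.2 z.1 < δ} :=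
      isOpen_lt (continuous_snd.dist continuous_fst) continuous_const
    exact this.measurableSet
  have h := ((hu.comp_snd (μ := (volume : Measure (Space N)))).indicator hset).integral_prod_right'
  refine h.congr (Eventually.of_forall fun x => ?_)
  beta_reduce
  rw [← integral_indicator measurableSet_ball]
  rfl

lemma integral_weight_sq_le (hs0 : 0 < s) {w u : Space N → ℝ} (hwm : AEStronglyMeasurable w)
    (hw0 : ∀ x, 0 ≤ w x) (hw1 : ∀ x, w x ≤ 1) (hu : MemHs s u) {δ : ℝ} (hδ : 0 < δ)
    (hP : Integrable fun x =>
      w x * ((∫ y in Metric.ball x δ, u y) / volume.real (Metric.ball x δ)) ^ 2) :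
    ∫ x, w x * u x ^ 2 ≤ 4 / volume.real (Metric.ball (0 : Space N) 1) *
      (δ ^ (2 * s) * gagliardoSq s u) + 4 * ∫ x,
      w x * ((∫ y in Metric.ball x δ, u y) / volume.real (Metric.ball x δ)) ^ 2 := by
  have hF : Integrable fun x => ∫ y, gagliardoKernel s u u (x, y) := hu.gagliardo.integral_prod_left
  have hsq : Integrable fun x => w x * u x ^ 2 :=
    Integrable.weight hwm (fun x => by rw [abs_of_nonneg (hw0 x)]; exact hw1 x) hu.memLp.integrable_sq
  set ω := volume.real (Metric.ball (0 : Space N) 1)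
  have hω : 0 ≤ ω := measureReal_nonneg
  have i1 : Integrable fun x => 4 / ω * (δ ^ (2 * s) * ∫ y, gagliardoKernel s u u (x, y)) :=
    (hF.const_mul _).const_mul _
  rw [gagliardoSq, integral_prod _ hu.gagliardo, ← integral_const_mul, ← integral_const_mul,
    ← integral_const_mul, ← integral_add i1 (hP.const_mul 4)]
  refine integral_mono_ae hsq (i1.add (hP.const_mul 4)) ?_
  filter_upwards [hu.gagliardo.prod_right_ae] with x hx
  have h := mul_le_mul_of_nonneg_left (sq_le_of_average hs0 hu.memLp hx hδ) (hw0 x)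
  refine h.trans ?_
  have hF0 : 0 ≤ ∫ y, gagliardoKernel s u u (x, y) :=
    integral_nonneg fun y => gagliardoKernel_self_nonneg _
  have : 0 ≤ 4 / ω * (δ ^ (2 * s) * ∫ y, gagliardoKernel s u u (x, y)) := by positivity
  nlinarith [mul_le_of_le_one_left this (hw1 x)]

/-- Weak convergence tested with the indicator of each ball makes the averages converge at every x.
They are bounded uniformly in x and n, so dominated convergence applies against the integrable
weight. -/
lemma tendsto_integral_ball_average {w : Space N → ℝ} (hw : Integrable w)
    {u : ℕ → Space N → ℝ} {M : ℝ} (hu : ∀ n, MemLp (u n) 2 volume) (hM : ∀ n, ∫ x, u n x ^ 2 ≤ M)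
    (hweak : ∀ y : Space N → ℝ, MemLp y 2 volume →
      ∃ l : ℝ, Tendsto (fun n => ∫ x, u n x * y x) atTop (𝓝 l)) {δ : ℝ} (hδ : 0 < δ) :
    (∀ n m, Integrable fun x => w x * ((∫ y in Metric.ball x δ, (u n y - u m y)) /
      volume.real (Metric.ball x δ)) ^ 2) ∧
    Tendsto (fun k : ℕ × ℕ => ∫ x, w x * ((∫ y in Metric.ball x δ, (u k.1 y - u k.2 y)) /
      volume.real (Metric.ball x δ)) ^ 2) atTop (𝓝 0) := by
  set V := volume.real (Metric.ball (0 : Space N) δ) with hV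
  have hVpos : 0 < V := by
    rw [hV, measureReal_def]
    exact ENNReal.toReal_pos (Metric.measure_ball_pos _ _ hδ).ne' measure_ball_lt_top.ne
  have hvol : ∀ x : Space N, volume.real (Metric.ball x δ) = V := fun x => by
    rw [hV, measureReal_def, measureReal_def, Measure.addHaar_ball_center]
  simp only [hvol]
  have huB : ∀ n x, IntegrableOn (u n) (Metric.ball x δ) := fun n x =>
    (hu n).locallyIntegrable (by norm_num) |>.integrableOn_isCompact (isCompact_closedBall x δ)
      |>.mono_set Metric.ball_subset_closedBall
  have hbd : ∀ n x, |∫ y in Metric.ball x δ, u n y| ≤ M + V := by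
    intro n x
    refine abs_integral_le_integral_abs.trans ?_
    have hc : IntegrableOn (fun _ : Space N => (1 : ℝ)) (Metric.ball x δ) :=
      integrableOn_const measure_ball_lt_top.ne
    have hsq := (hu n).integrable_sq
    calc ∫ y in Metric.ball x δ, |u n y| ≤ ∫ y in Metric.ball x δ, (u n y ^ 2 + 1) := by
          refine setIntegral_mono_on (huB n x).abs (hsq.integrableOn.add hc) measurableSet_ball
            fun y _ => ?_
          rw [← sq_abs]
          nlinarith [sq_nonneg (|u n y| - 1), abs_nonneg (u n y)]
      _ = (∫ y in Metric.ball x δ, u n y ^ 2) + V := by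
          rw [integral_add hsq.integrableOn hc, setIntegral_const, hvol]
          simp
      _ ≤ M + V := by
          have := setIntegral_le_integral (s := Metric.ball x δ) hsq
            (Eventually.of_forall fun y => sq_nonneg (u n y))
          linarith [hM n]
  have hMV : 0 ≤ M + V := (abs_nonneg _).trans (hbd 0 0)
  have hsub : ∀ n m x, ∫ y in Metric.ball x δ, (u n y - u m y) =
      (∫ y in Metric.ball x δ, u n y) - ∫ y in Metric.ball x δ, u m y :=
    fun n m x => integral_sub (huB n x) (huB m x)
  have hmeas : ∀ n m, AEStronglyMeasurable
      (fun x => w x * ((∫ y in Metric.ball x δ, (u n y - u m y)) / V) ^ 2) volume := fun n m =>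
    hw.1.mul (((aestronglyMeasurable_ball_integral ((hu n).1.sub (hu m).1) δ).mul_const V⁻¹).pow 2)
  have hdom : ∀ n m x, ‖w x * ((∫ y in Metric.ball x δ, (u n y - u m y)) / V) ^ 2‖ ≤
      |w x| * ((2 * (M + V)) / V) ^ 2 := by
    intro n m x
    rw [norm_mul, Real.norm_eq_abs, Real.norm_eq_abs, abs_pow, abs_div, abs_of_pos hVpos, hsub]
    have := hbd n x
    have := hbd m x
    have : |(∫ y in Metric.ball x δ, u n y) - ∫ y in Metric.ball x δ, u m y| ≤ 2 * (M + V) :=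
      (abs_sub _ _).trans (by linarith)
    gcongr
  have hint := hw.abs.mul_const (((2 * (M + V)) / V) ^ 2)
  refine ⟨fun n m => hint.mono' (hmeas n m) (Eventually.of_forall (hdom n m)), ?_⟩
  have h0 : Tendsto (fun k : ℕ × ℕ => ∫ x, w x * ((∫ y in Metric.ball x δ, (u k.1 y - u k.2 y)) /
      V) ^ 2) atTop (𝓝 (∫ _ : Space N, (0 : ℝ))) := by
    refine tendsto_integral_filter_of_dominated_convergence _
      (Eventually.of_forall fun k => hmeas k.1 k.2)
      (Eventually.of_forall fun k => Eventually.of_forall (hdom k.1 k.2)) hint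
      (Eventually.of_forall fun x => ?_)
    have hmem : MemLp ((Metric.ball x δ).indicator fun _ => (1 : ℝ)) 2 volume :=
      memLp_indicator_const _ measurableSet_ball _ (Or.inr measure_ball_lt_top.ne)
    obtain ⟨l, hl⟩ := hweak _ hmem
    have hl' : Tendsto (fun n => ∫ y in Metric.ball x δ, u n y) atTop (𝓝 l) := by
      refine hl.congr fun n => ?_
      rw [← integral_indicator measurableSet_ball]
      congr 1
      ext y
      by_cases hy : y ∈ Metric.ball x δ <;> simp [hy]
    simp only [hsub]
    rw [← prod_atTop_atTop_eq]
    have h1 := hl'.comp (tendsto_fst (f := (atTop : Filter ℕ)) (g := (atTop : Filter ℕ)))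
    have h2 := hl'.comp (tendsto_snd (f := (atTop : Filter ℕ)) (g := (atTop : Filter ℕ)))
    simpa using (((h1.sub h2).div_const V).pow 2).const_mul (w x)
  simpa using h0

/-- Bounded sequences in `H^s` have almost everywhere convergent subsequences. -/
lemma exists_subseq_tendsto_ae (hs0 : 0 < s) {u : ℕ → Space N → ℝ} {M : ℝ}
    (hu : ∀ n, MemHs s (u n)) (hM : ∀ n, ∫ x, u n x ^ 2 ≤ M) (hG : ∀ n, gagliardoSq s (u n) ≤ M) :
    ∃ φ : ℕ → ℕ, StrictMono φ ∧ ∃ U : Space N → ℝ, MemHs s U ∧ ∫ x, U x ^ 2 ≤ M ∧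
      ∀ᵐ x, Tendsto (fun n => u (φ n) x) atTop (𝓝 (U x)) := by
  obtain ⟨φ, hφ, hweak⟩ := exists_subseq_tendsto_integral_mul (fun n => (hu n).memLp) hM
  -- A positive integrable weight bounded by 1 turns local compactness into one Cauchy argument on
  -- the whole space; positivity allows division by √w afterwards.
  set w : Space N → ℝ := fun x => (1 + ‖x‖) ^ (-((N : ℝ) + 1)) with hw
  have hwint : Integrable w := integrable_one_add_norm (by simp)
  have hwpos : ∀ x, 0 < w x := fun x => by positivity
  have hw1 : ∀ x, w x ≤ 1 := fun x =>
    Real.rpow_le_one_of_one_le_of_nonpos (by linarith [norm_nonneg x]) (by linarith [N.cast_nonneg (α := ℝ)])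
  have hswm : Continuous fun x => √(w x) := by
    refine Real.continuous_sqrt.comp ?_
    refine Continuous.rpow_const (by fun_prop) fun x => Or.inl (by positivity)
  have hmem : ∀ n, MemLp (fun x => √(w x) * u (φ n) x) 2 volume := fun n => by
    refine (hu (φ n)).memLp.mono (hswm.aestronglyMeasurable.mul (hu (φ n)).memLp.1)
      (Eventually.of_forall fun x => ?_)
    rw [norm_mul]
    refine mul_le_of_le_one_left (norm_nonneg _) ?_
    rw [Real.norm_of_nonneg (Real.sqrt_nonneg _)]
    exact Real.sqrt_le_one.2 (hw1 x)
  have hsqint : ∀ n m, ‖(hmem n).toLp _ - (hmem m).toLp _‖ ^ 2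
      = ∫ x, w x * (u (φ n) x - u (φ m) x) ^ 2 := by
    intro n m
    rw [← MemLp.toLp_sub, norm_toLp_sq]
    congr 1
    ext x
    simp only [Pi.sub_apply]
    rw [← mul_sub, mul_pow, Real.sq_sqrt (hwpos x).le]
  set ω := volume.real (Metric.ball (0 : Space N) 1)
  have hω : 0 ≤ ω := measureReal_nonneg
  have hMn : 0 ≤ M := gagliardoSq_nonneg.trans (hG 0)
  have hcau : CauchySeq fun n => (hmem n).toLp _ := by
    refine Metric.cauchySeq_iff.2 fun ε hε => ?_
    -- First δ makes the distance to the averages small uniformly in n, m; with δ fixed, the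
    -- averages are a Cauchy sequence.
    obtain ⟨δ, hδ, hδε⟩ : ∃ δ : ℝ, 0 < δ ∧ 4 / ω * (δ ^ (2 * s) * (4 * M)) < ε ^ 2 / 2 := by
      have hc : Tendsto (fun δ : ℝ => 4 / ω * (δ ^ (2 * s) * (4 * M))) (𝓝 0)
          (𝓝 (4 / ω * ((0 : ℝ) ^ (2 * s) * (4 * M)))) :=
        (((Real.continuousAt_rpow_const _ _ (Or.inr (by linarith))).tendsto).mul_const _).const_mul _
      rw [Real.zero_rpow (by linarith), zero_mul, mul_zero] at hc
      obtain ⟨δ, h1, h2⟩ := ((frequently_gt_nhds (0 : ℝ)).and_eventually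
        (hc.eventually (gt_mem_nhds (by positivity : (0 : ℝ) < ε ^ 2 / 2)))).exists
      exact ⟨δ, h1, h2⟩
    obtain ⟨hPint, hPlim⟩ := tendsto_integral_ball_average hwint (fun n => (hu (φ n)).memLp)
      (fun n => hM (φ n)) hweak hδ
    have hev := hPlim.eventually (gt_mem_nhds (by positivity : (0 : ℝ) < ε ^ 2 / 8))
    rw [eventually_atTop] at hev
    obtain ⟨⟨a, b⟩, hab⟩ := hev
    refine ⟨max a b, fun n hn m hm => ?_⟩
    have h1 := hab (n, m) ⟨(le_max_left _ _).trans hn, (le_max_right _ _).trans hm⟩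
    have h2 := integral_weight_sq_le hs0 hwint.1 (fun x => (hwpos x).le) hw1
      ((hu (φ n)).sub (hu (φ m))) hδ (hPint n m)
    have h3 : gagliardoSq s (fun x => u (φ n) x - u (φ m) x) ≤ 4 * M :=
      (gagliardoSq_sub_le (hu _) (hu _)).trans (by linarith [hG (φ n), hG (φ m)])
    have h4 : 4 / ω * (δ ^ (2 * s) * gagliardoSq s (fun x => u (φ n) x - u (φ m) x)) ≤
      4 / ω * (δ ^ (2 * s) * (4 * M)) := by gcongr
    rw [dist_eq_norm]
    refine lt_of_pow_lt_pow_left₀ 2 hε.le ?_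
    rw [hsqint]
    simp only at h1
    linarith
  obtain ⟨f, hf⟩ := cauchySeq_tendsto_of_complete hcau
  obtain ⟨ψ, hψ, hae⟩ := (tendstoInMeasure_of_tendsto_Lp hf).exists_seq_tendsto_ae
  have hlim : ∀ᵐ x, Tendsto (fun n => u (φ (ψ n)) x) atTop (𝓝 (f x / √(w x))) := by
    have hall : ∀ᵐ x, ∀ n, (hmem n).toLp _ x = √(w x) * u (φ n) x :=
      ae_all_iff.2 fun n => (hmem n).coeFn_toLp
    filter_upwards [hae, hall] with x hx hx2
    have h := hx.div_const (√(w x))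
    refine h.congr fun n => ?_
    rw [hx2]
    have : √(w x) ≠ 0 := (Real.sqrt_pos.2 (hwpos x)).ne'
    field_simp
  refine ⟨φ ∘ ψ, hφ.comp hψ, fun x => f x / √(w x), ?_⟩
  have hUm : AEStronglyMeasurable (fun x => f x / √(w x)) volume :=
    aestronglyMeasurable_of_tendsto_ae atTop (fun n => (hu (φ (ψ n))).memLp.1) hlim
  have hsq := integrable_and_integral_le_of_tendsto (fun n => (hu (φ (ψ n))).memLp.integrable_sq)
    (fun n x => sq_nonneg _) (fun n => hM _)
    (hlim.mono fun x hx => hx.pow 2)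
  have hgag := integrable_and_integral_le_of_tendsto (fun n => (hu (φ (ψ n))).gagliardo)
    (fun n x => gagliardoKernel_self_nonneg x) (fun n => hG (φ (ψ n)))
    (G := gagliardoKernel s (fun x => f x / √(w x)) (fun x => f x / √(w x))) (by
      filter_upwards [Measure.quasiMeasurePreserving_fst.ae hlim,
        Measure.quasiMeasurePreserving_snd.ae hlim] with z h1 h2
      exact ((h1.sub h2).mul (h1.sub h2)).div_const _)
  exact ⟨⟨(memLp_two_iff_integrable_sq hUm).2 hsq.1, hgag.1⟩, hsq.2, hlim⟩

end Compactness

/-! ### Dilations -/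

section Scaling

variable {N : ℕ} {s α t : ℝ} {u : Space N → ℝ} {τ : ℝ}

lemma integral_comp_smul_space (hτ : 0 < τ) (f : Space N → ℝ) :
    ∫ x, f (τ • x) = τ ^ (-(N : ℝ)) * ∫ x, f x := by
  rw [Measure.integral_comp_smul_of_nonneg volume f τ (hR := hτ.le), Real.rpow_neg hτ.le]
  simp

lemma integral_comp_smul_prod (hτ : 0 < τ) (f : Space N × Space N → ℝ) :
    ∫ z, f (τ • z) ∂(volume.prod volume)
      = τ ^ (-(2 * N : ℝ)) * ∫ z, f z ∂(volume.prod volume) := by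
  rw [Measure.integral_comp_smul_of_nonneg (volume.prod volume) f τ (hR := hτ.le),
    Real.rpow_neg hτ.le]
  have : (2 * N : ℝ) = ((N + N : ℕ) : ℝ) := by push_cast; ring
  rw [this, Real.rpow_natCast]
  simp

lemma integral_sq_dilation (hτ : 0 < τ) (c : ℝ) :
    ∫ x, (c * u (τ • x)) ^ 2 = c ^ 2 * τ ^ (-(N : ℝ)) * ∫ x, u x ^ 2 := by
  simp only [mul_pow]
  rw [integral_const_mul, integral_comp_smul_space hτ (fun x => u x ^ 2), mul_assoc]

lemma gagliardoKernel_dilation (hτ : 0 < τ) (c : ℝ) (z : Space N × Space N) :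
    gagliardoKernel s (fun x => c * u (τ • x)) (fun x => c * u (τ • x)) z
      = c ^ 2 * τ ^ ((N : ℝ) + 2 * s) * gagliardoKernel s u u (τ • z) := by
  have h : ‖τ • z.1 - τ • z.2‖ ^ ((N : ℝ) + 2 * s) =
      τ ^ ((N : ℝ) + 2 * s) * ‖z.1 - z.2‖ ^ ((N : ℝ) + 2 * s) := by
    rw [← smul_sub, norm_smul, Real.norm_of_nonneg hτ.le, Real.mul_rpow hτ.le (norm_nonneg _)]
  have h2 : 0 < τ ^ ((N : ℝ) + 2 * s) := by positivity
  simp only [gagliardoKernel, Prod.smul_fst, Prod.smul_snd, h]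
  rw [← mul_div_assoc, mul_assoc (c ^ 2), mul_div_mul_left _ _ h2.ne' |>.symm]
  ring

lemma MemHs.dilation (hu : MemHs s u) (hτ : 0 < τ) (c : ℝ) : MemHs s (fun x => c * u (τ • x)) := by
  have hm : AEStronglyMeasurable (fun x => c * u (τ • x)) volume :=
    (hu.memLp.1.comp_quasiMeasurePreserving
      (Measure.quasiMeasurePreserving_smul volume hτ.ne')).const_mul c
  refine ⟨(memLp_two_iff_integrable_sq hm).2 ?_, ?_⟩
  · simp only [mul_pow]
    exact (hu.memLp.integrable_sq.comp_smul hτ.ne').const_mul _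
  · exact ((hu.gagliardo.comp_smul hτ.ne').const_mul _).congr
      (Eventually.of_forall fun z => (gagliardoKernel_dilation hτ c z).symm)

lemma gagliardoSq_dilation (hτ : 0 < τ) (c : ℝ) :
    gagliardoSq s (fun x => c * u (τ • x)) = c ^ 2 * τ ^ (2 * s - N) * gagliardoSq s u := by
  simp only [gagliardoSq, gagliardoKernel_dilation hτ]
  rw [integral_const_mul, integral_comp_smul_prod hτ (gagliardoKernel s u u), ← mul_assoc,
    mul_assoc (c ^ 2), ← Real.rpow_add hτ]
  congr 3
  ring

lemma rieszForm_dilation (hτ : 0 < τ) (c : ℝ) :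
    rieszForm α (fun x => |c * u (τ • x)| ^ t) (fun x => |c * u (τ • x)| ^ t)
      = (|c| ^ t) ^ 2 * τ ^ (-((N : ℝ) + α)) *
        rieszForm α (fun x => |u x| ^ t) (fun x => |u x| ^ t) := by
  have e : ∀ z : Space N × Space N, |c * u (τ • z.1)| ^ t * |c * u (τ • z.2)| ^ t *
      rieszKernel α (z.1 - z.2) = (|c| ^ t) ^ 2 * τ ^ ((N : ℝ) - α) *
        (fun z : Space N × Space N => |u z.1| ^ t * |u z.2| ^ t * rieszKernel α (z.1 - z.2))
          (τ • z) := by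
    intro z
    have h : ‖τ • z.1 - τ • z.2‖ ^ ((N : ℝ) - α) =
        τ ^ ((N : ℝ) - α) * ‖z.1 - z.2‖ ^ ((N : ℝ) - α) := by
      rw [← smul_sub, norm_smul, Real.norm_of_nonneg hτ.le, Real.mul_rpow hτ.le (norm_nonneg _)]
    have h2 : 0 < τ ^ ((N : ℝ) - α) := by positivity
    simp only [rieszKernel, Prod.smul_fst, Prod.smul_snd, h, abs_mul]
    rw [Real.mul_rpow (abs_nonneg _) (abs_nonneg _), Real.mul_rpow (abs_nonneg _) (abs_nonneg _)]
    field_simp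
  simp only [rieszForm, e]
  rw [integral_const_mul, integral_comp_smul_prod hτ
    (fun z => |u z.1| ^ t * |u z.2| ^ t * rieszKernel α (z.1 - z.2)), ← mul_assoc,
    mul_assoc ((|c| ^ t) ^ 2), ← Real.rpow_add hτ]
  congr 3
  ring

end Scaling

/-! ### A test function of prescribed mass -/

section TestFunction

variable {N : ℕ} {s : ℝ}

/-- The tent function. -/
noncomputable def tent (x : Space N) : ℝ := max 0 (1 - ‖x‖)

lemma continuous_tent : Continuous (tent : Space N → ℝ) := by
  unfold tent
  fun_prop

lemma tent_nonneg (x : Space N) : 0 ≤ tent x := le_max_left _ _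

lemma hasCompactSupport_tent : HasCompactSupport (tent : Space N → ℝ) := by
  refine HasCompactSupport.intro (isCompact_closedBall (0 : Space N) 1) fun x hx => ?_
  rw [mem_closedBall_zero_iff, not_le] at hx
  exact max_eq_left (by linarith)

/-- The tent has increments at most min(1, |x-y|), and both values vanish unless one point lies in
the unit ball. The kernel is thus bounded by B(x)κ(x-y) + B(y)κ(x-y), where κ is |z|^(2-N-2s) near
0, integrable as s < 1, and |z|^(-N-2s) at infinity, integrable as s > 0. -/
lemma memHs_tent (hs0 : 0 < s) (hs1 : s < 1) (hN : 0 < N) : MemHs s (tent : Space N → ℝ) := by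
  refine ⟨continuous_tent.memLp_of_hasCompactSupport hasCompactSupport_tent, ?_⟩
  set κ : Space N → ℝ := fun z => if ‖z‖ ≤ 1 then (1 / ‖z‖ ^ (1 : ℝ)) ^ ((N : ℝ) + 2 * s - 2) else
    (1 / ‖z‖ ^ (1 : ℝ)) ^ ((N : ℝ) + 2 * s) with hκ
  have hκi : Integrable κ := integrable_fun_norm_of_rpow hN zero_le_one (by linarith) (by linarith)
  have hκe : ∀ z, κ (-z) = κ z := fun z => by simp [hκ]
  have hκ0 : ∀ z, 0 ≤ κ z := fun z => by
    simp only [hκ]; split_ifs <;> positivity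
  set B : Space N → ℝ := (Metric.closedBall 0 1).indicator fun _ => 1 with hB
  have hB0 : ∀ x, 0 ≤ B x := fun x => Set.indicator_nonneg (fun _ _ => zero_le_one) x
  have hBi : Integrable B :=
    (integrable_indicator_iff measurableSet_closedBall).2
      (integrableOn_const measure_closedBall_lt_top.ne)
  refine ((integrable_fst_mul_sub hBi hκi hκe).add (integrable_snd_mul_sub hBi hκi)).mono'
    (aestronglyMeasurable_gagliardoKernel continuous_tent.aestronglyMeasurable
      continuous_tent.aestronglyMeasurable) (Eventually.of_forall fun z => ?_)
  rw [Real.norm_of_nonneg (gagliardoKernel_self_nonneg z)]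
  simp only [Pi.add_apply, ← add_mul]
  rcases eq_or_ne z.1 z.2 with heq | hne
  · have : gagliardoKernel s tent tent z = 0 := by simp [gagliardoKernel, heq]
    rw [this]
    exact mul_nonneg (add_nonneg (hB0 _) (hB0 _)) (hκ0 _)
  have hpos : 0 < ‖z.1 - z.2‖ := norm_pos_iff.2 (sub_ne_zero.2 hne)
  have htent0 : ∀ x : Space N, x ∉ Metric.closedBall (0 : Space N) 1 → tent x = 0 := fun x hx => by
    rw [mem_closedBall_zero_iff, not_le] at hx
    exact max_eq_left (by linarith)
  by_cases hz : z.1 ∈ Metric.closedBall (0 : Space N) 1 ∨ z.2 ∈ Metric.closedBall (0 : Space N) 1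
  · have hBB : 1 ≤ B z.1 + B z.2 := by
      rcases hz with h | h
      · have : B z.1 = 1 := by simp only [hB, Set.indicator_of_mem h]
        linarith [hB0 z.2]
      · have : B z.2 = 1 := by simp only [hB, Set.indicator_of_mem h]
        linarith [hB0 z.1]
    refine le_trans ?_ (le_mul_of_one_le_left (hκ0 _) hBB)
    have hlip : |tent z.1 - tent z.2| ≤ ‖z.1 - z.2‖ := by
      unfold tent
      rw [max_comm 0, max_comm 0]
      refine (abs_max_sub_max_le_abs _ _ _).trans ?_
      have : (1 - ‖z.1‖ - (1 - ‖z.2‖)) = ‖z.2‖ - ‖z.1‖ := by ring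
      rw [this, ← abs_neg, neg_sub]
      exact abs_norm_sub_norm_le _ _
    have hone : |tent z.1 - tent z.2| ≤ 1 := by
      have h1 : tent z.1 ≤ 1 := max_le zero_le_one (by linarith [norm_nonneg z.1])
      have h2 : tent z.2 ≤ 1 := max_le zero_le_one (by linarith [norm_nonneg z.2])
      rw [abs_le]
      constructor <;> linarith [tent_nonneg z.1, tent_nonneg z.2]
    simp only [gagliardoKernel, hκ, Real.rpow_one, one_div, ← pow_two]
    rw [← sq_abs]
    split_ifs
    · rw [Real.inv_rpow hpos.le, Real.rpow_sub hpos, Real.rpow_two, inv_div]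
      gcongr
    · rw [Real.inv_rpow hpos.le, ← one_div]
      gcongr
      exact pow_le_one₀ (abs_nonneg _) hone
  · push Not at hz
    have : gagliardoKernel s tent tent z = 0 := by
      simp [gagliardoKernel, htent0 _ hz.1, htent0 _ hz.2]
    rw [this]
    exact mul_nonneg (add_nonneg (hB0 _) (hB0 _)) (hκ0 _)

lemma integral_sq_tent_pos : 0 < ∫ x : Space N, tent x ^ 2 := by
  refine (continuous_tent.pow 2).integral_pos_of_hasCompactSupport_nonneg_nonzero (x := 0) ?_
    (fun x => sq_nonneg _) (by simp [tent])
  exact hasCompactSupport_tent.comp_left (g := fun y : ℝ => y ^ 2) (by simp)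

lemma exists_mem_massSphere (hs0 : 0 < s) (hs1 : s < 1) (hN : 0 < N) {a : ℝ} (ha : 0 < a) :
    ∃ w : Space N → ℝ, w ∈ massSphere s a := by
  have h := integral_sq_tent_pos (N := N)
  refine ⟨fun x => √(a / ∫ x : Space N, tent x ^ 2) * tent x,
    (memHs_tent hs0 hs1 hN).const_mul _, ?_⟩
  simp only [mul_pow]
  rw [integral_const_mul, Real.sq_sqrt (by positivity)]
  field_simp

end TestFunction

/-! ### Gagliardo-Nirenberg inequality for the nonlocal energy -/

section GagliardoNirenberg

variable {N : ℕ} {s α t : ℝ}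

lemma ae_eq_zero_of_integral_sq {u : Space N → ℝ} (hu : MemLp u 2 volume)
    (h : ∫ x, u x ^ 2 = 0) : u =ᵐ[volume] 0 := by
  have := (integral_eq_zero_iff_of_nonneg (fun x => sq_nonneg (u x)) hu.integrable_sq).1 h
  filter_upwards [this] with x hx
  simpa using hx

lemma rieszForm_eq_zero_of_ae {h : Space N → ℝ} (hh : h =ᵐ[volume] 0) : rieszForm α h h = 0 := by
  unfold rieszForm
  rw [integral_eq_zero_of_ae]
  filter_upwards [Measure.quasiMeasurePreserving_fst.ae hh] with z hz
  simp [hz]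

/-- The nonlocal energy is bounded on bounded subsets of `H^s`. -/
lemma exists_rieszForm_le (hs0 : 0 < s) (hN : 0 < N) (hα0 : 0 < α) (hαN : α < N)
    (ht0 : 0 < t) (ht : ((N : ℝ) + α) / N < t) (ht2 : t * (2 * N / (N + α)) < 2 + 4 * s / N)
    (M : ℝ) :
    ∃ C : ℝ, 0 ≤ C ∧ ∀ u : Space N → ℝ, MemHs s u → ∫ x, u x ^ 2 ≤ M → gagliardoSq s u ≤ M →
      rieszForm α (fun x => |u x| ^ t) (fun x => |u x| ^ t) ≤ C := by
  obtain ⟨ρ₁, ρ₂, κ, hS⟩ := exists_rieszSplit hN hα0 hαN ht ht2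
  obtain ⟨C₁, hC₁, h₁⟩ := exists_integral_rpow_le_of_le hs0 hN hS.lt_mul₁.le hS.mul_lt₁.le M
  obtain ⟨C₂, hC₂, h₂⟩ := exists_integral_rpow_le_of_le hs0 hN hS.lt_mul₂.le hS.mul_lt₂.le M
  have hκ0 : 0 ≤ ∫ x, κ x := integral_nonneg hS.nonneg
  refine ⟨(C₁ * C₁ + (C₁ + C₁) * ∫ x, κ x) + (C₂ * C₂ + (C₂ + C₂) * ∫ x, κ x), by positivity,
    fun u hu hu1 hu2 => ?_⟩
  have hadm := hu.rieszAdm hs0 hN ht0 hS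
  refine (rieszForm_le hα0 hαN hS hadm hadm).trans ?_
  simp only [← Real.rpow_mul (abs_nonneg _)]
  have k1 := h₁ u hu hu1 hu2
  have k2 := h₂ u hu hu1 hu2
  have p1 : 0 ≤ ∫ x, |u x| ^ (t * ρ₁) := integral_nonneg fun x => by positivity
  have p2 : 0 ≤ ∫ x, |u x| ^ (t * ρ₂) := integral_nonneg fun x => by positivity
  gcongr

/-- The fractional Gagliardo-Nirenberg inequality for the nonlocal energy. -/
lemma exists_rieszForm_le_rpow (hs0 : 0 < s) (hN : 0 < N) (hα0 : 0 < α) (hαN : α < N)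
    (ht : ((N : ℝ) + α) / N < t) (ht2 : t * (2 * N / (N + α)) < 2 + 4 * s / N) :
    ∃ C : ℝ, 0 ≤ C ∧ ∀ u : Space N → ℝ, MemHs s u →
      rieszForm α (fun x => |u x| ^ t) (fun x => |u x| ^ t) ≤
        C * (gagliardoSq s u ^ ((N * t - N - α) / (2 * s)) *
          (∫ x, u x ^ 2) ^ (t - (N * t - N - α) / (2 * s))) := by
  have hN' : (0 : ℝ) < N := by exact_mod_cast hN
  have ht0 : 0 < t := lt_trans (by positivity) ht
  obtain ⟨C, hC, h⟩ := exists_rieszForm_le hs0 hN hα0 hαN ht0 ht ht2 1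
  refine ⟨C, hC, fun u hu => ?_⟩
  set e := (N * t - N - α) / (2 * s) with he
  have he0 : 0 < e := by
    have : N + α < N * t := by rw [div_lt_iff₀ hN'] at ht; linarith
    exact div_pos (by linarith) (by linarith)
  set A := ∫ x, u x ^ 2 with hA
  have hA0 : 0 ≤ A := integral_nonneg fun x => sq_nonneg _
  set B := gagliardoSq s u with hB
  have hB0 : 0 ≤ B := gagliardoSq_nonneg
  rcases hA0.eq_or_lt with hA1 | hApos
  · have hz := ae_eq_zero_of_integral_sq hu.memLp hA1.symm
    rw [rieszForm_eq_zero_of_ae]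
    · positivity
    · filter_upwards [hz] with x hx
      simp [hx, Real.zero_rpow ht0.ne']
  -- A majorant B' > 0 of the seminorm avoids dividing by a possibly zero B; B' decreases to B at
  -- the end.
  have key : ∀ B' : ℝ, 0 < B' → B ≤ B' →
      rieszForm α (fun x => |u x| ^ t) (fun x => |u x| ^ t) ≤ C * (B' ^ e * A ^ (t - e)) := by
    intro B' hB'0 hBB'
    -- With τ^(2s) = A/B' and c² = τ^N/A, the function c u(τ·) has mass 1 and squared seminorm B/B'
    -- ≤ 1, so the bound on bounded sets applies with M = 1.
    set τ := (A / B') ^ (1 / (2 * s)) with hτdef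
    have hτ : 0 < τ := by positivity
    have hτ2 : τ ^ (2 * s) = A / B' := by
      rw [hτdef, ← Real.rpow_mul (by positivity), one_div, inv_mul_cancel₀ (by linarith),
        Real.rpow_one]
    set c := √(τ ^ (N : ℝ) / A) with hc
    have hc2 : c ^ 2 = τ ^ (N : ℝ) / A := Real.sq_sqrt (by positivity)
    have hcpos : 0 < c := Real.sqrt_pos.2 (by positivity)
    have h1 := h (fun x => c * u (τ • x)) (hu.dilation hτ c) (by
      rw [integral_sq_dilation hτ, hc2, ← hA, Real.rpow_neg hτ.le]
      have : τ ^ (N : ℝ) ≠ 0 := by positivity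
      field_simp
      exact le_refl _) (by
      rw [gagliardoSq_dilation hτ, hc2, ← hB, Real.rpow_sub hτ, hτ2]
      have : τ ^ (N : ℝ) ≠ 0 := by positivity
      field_simp
      exact hBB')
    rw [rieszForm_dilation hτ] at h1
    have hct : (|c| ^ t) ^ 2 = τ ^ (N * t) / A ^ t := by
      rw [abs_of_pos hcpos, ← Real.rpow_natCast, ← Real.rpow_mul hcpos.le, mul_comm,
        Real.rpow_mul hcpos.le, Real.rpow_natCast, hc2, Real.div_rpow (by positivity) hA0,
        ← Real.rpow_mul hτ.le]
    have hτe : τ ^ (N * t) * τ ^ (-((N : ℝ) + α)) = A ^ e / B' ^ e := by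
      rw [← Real.rpow_add hτ, ← Real.div_rpow hA0 hB'0.le, ← hτ2, ← Real.rpow_mul hτ.le, he]
      congr 1
      field_simp
      ring
    rw [hct, div_mul_eq_mul_div, hτe] at h1
    rw [Real.rpow_sub hApos]
    have q1 : 0 < A ^ t := by positivity
    have q2 : 0 < A ^ e := by positivity
    have q3 : 0 < B' ^ e := by positivity
    rw [div_div, div_mul_eq_mul_div, div_le_iff₀ (by positivity)] at h1
    rw [← mul_div_assoc, ← mul_div_assoc, le_div_iff₀ q2]
    linarith
  have hlim : Tendsto (fun n : ℕ => C * ((B + 1 / ((n : ℝ) + 1)) ^ e * A ^ (t - e))) atTop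
      (𝓝 (C * ((B + 0) ^ e * A ^ (t - e)))) :=
    (((tendsto_one_div_add_atTop_nhds_zero_nat.const_add B).rpow_const
      (Or.inr he0.le)).mul_const _).const_mul _
  rw [add_zero] at hlim
  refine ge_of_tendsto' hlim fun n => key _ (by positivity) ?_
  have : (0 : ℝ) < 1 / ((n : ℝ) + 1) := by positivity
  linarith

end GagliardoNirenberg

/-! ### Consequences of the conditions on the coefficients -/

section Weights

variable {N : ℕ}

lemma CondW.nonneg {w : Space N → ℝ} {a b : ℝ} (hw : CondW w a b) (x : Space N) : 0 ≤ w x :=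
  hw.lim_pos.le.trans (hw.lim_le x)

lemma CondW.max_pos {w : Space N → ℝ} {a b : ℝ} (hw : CondW w a b) : 0 < b :=
  hw.lim_pos.trans_le ((hw.lim_le 0).trans (hw.le_max 0))

lemma condW_const {c : ℝ} (hc : 0 < c) : CondW (fun _ : Space N => c) c c :=
  ⟨memLp_top_const c, tendsto_const_nhds, hc, fun _ => le_rfl, fun _ => le_rfl⟩

lemma CondV.abs_le {V : Space N → ℝ} {b : ℝ} (hV : CondV V b) (x : Space N) : |V x| ≤ b := by
  rw [abs_of_nonneg (hV.nonneg x)]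
  exact hV.le_lim x

lemma CondV.lim_nonneg {V : Space N → ℝ} {b : ℝ} (hV : CondV V b) : 0 ≤ b :=
  (hV.nonneg 0).trans (hV.le_lim 0)

lemma condV_const {c : ℝ} (hc : 0 ≤ c) : CondV (fun _ : Space N => c) c :=
  ⟨memLp_top_const c, tendsto_const_nhds, fun _ => hc, fun _ => le_rfl⟩

end Weights

/-- The powers `t` for which the nonlocal energy is well defined and subcritical on `H^s`. -/
structure SubcriticalPower (N : ℕ) (s α t : ℝ) : Prop where
  hs0 : 0 < s
  hs1 : s < 1
  hN : 0 < N
  hα0 : 0 < α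
  hαN : α < N
  lower : ((N : ℝ) + α) / N < t
  upper : t * (2 * N / (N + α)) < 2 + 4 * s / N

/-! ### The nonlocal energy for an admissible power -/

namespace SubcriticalPower

variable {N : ℕ} {s α t : ℝ} {u v w : Space N → ℝ} {winf wmax : ℝ}

lemma one_lt (h : SubcriticalPower N s α t) : 1 < t := by
  have hN : (0 : ℝ) < N := by exact_mod_cast h.hN
  refine lt_of_le_of_lt ?_ h.lower
  rw [le_div_iff₀ hN]
  linarith [h.hα0]

lemma pos (h : SubcriticalPower N s α t) : 0 < t := one_pos.trans h.one_lt

lemma exists_split (h : SubcriticalPower N s α t) :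
    ∃ (ρ₁ ρ₂ : ℝ) (κ : Space N → ℝ), RieszSplit α t (2 + 4 * s / N) ρ₁ ρ₂ κ :=
  exists_rieszSplit h.hN h.hα0 h.hαN h.lower h.upper

lemma integrable_form (h : SubcriticalPower N s α t) (hw : CondW w winf wmax) (hu : MemHs s u) :
    Integrable (fun z : Space N × Space N => (w z.1 * |u z.1| ^ t) * (w z.2 * |u z.2| ^ t) *
      rieszKernel α (z.1 - z.2)) (volume.prod volume) := by
  obtain ⟨ρ₁, ρ₂, κ, hS⟩ := h.exists_split
  have := (hu.rieszAdm h.hs0 h.hN h.pos hS).weight hS hw.memLp.1 hw.nonneg hw.le_max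
  exact integrable_rieszIntegrand h.hα0 h.hαN hS this this

lemma choquardEnergy_eq (h : SubcriticalPower N s α t) (hw : CondW w winf wmax) (hu : MemHs s u) :
    choquardEnergy α t w u =
      rieszForm α (fun x => w x * |u x| ^ t) (fun x => w x * |u x| ^ t) :=
  integral_rieszPotential_mul (h := fun x => w x * |u x| ^ t) (h.integrable_form hw hu)

lemma choquardEnergy_nonneg (h : SubcriticalPower N s α t) (hw : CondW w winf wmax)
    (hu : MemHs s u) : 0 ≤ choquardEnergy α t w u := by
  have : ∀ x, 0 ≤ w x * |u x| ^ t := fun x => mul_nonneg (hw.nonneg x) (by positivity)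
  rw [h.choquardEnergy_eq hw hu]
  exact rieszForm_nonneg h.hα0 h.hαN this this

lemma choquardEnergy_pos (h : SubcriticalPower N s α t) (hw : CondW w winf wmax)
    (hu : MemHs s u) (hne : ¬ u =ᵐ[volume] 0) : 0 < choquardEnergy α t w u := by
  obtain ⟨ρ₁, ρ₂, κ, hS⟩ := h.exists_split
  rw [h.choquardEnergy_eq hw hu]
  refine rieszForm_pos h.hα0 h.hαN hS h.hN
    ((hu.rieszAdm h.hs0 h.hN h.pos hS).weight hS hw.memLp.1 hw.nonneg hw.le_max) fun h0 => hne ?_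
  filter_upwards [h0] with x hx
  have hwx : w x ≠ 0 := (hw.lim_pos.trans_le (hw.lim_le x)).ne'
  simp only [Pi.zero_apply, mul_eq_zero, hwx, false_or] at hx ⊢
  exact abs_eq_zero.1 ((Real.rpow_eq_zero (abs_nonneg _) h.pos.ne').1 hx)

lemma choquardEnergy_const_mul (h : SubcriticalPower N s α t) (hw : CondW w winf wmax)
    (hu : MemHs s u) (c : ℝ) :
    choquardEnergy α t w (fun x => c * u x) = (|c| ^ t) ^ 2 * choquardEnergy α t w u := by
  rw [h.choquardEnergy_eq hw hu, h.choquardEnergy_eq hw (hu.const_mul c), ← rieszForm_const_mul]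
  have : (fun x => w x * |c * u x| ^ t) = fun x => |c| ^ t * (w x * |u x| ^ t) := by
    ext x
    rw [abs_mul, Real.mul_rpow (abs_nonneg _) (abs_nonneg _)]
    ring
  rw [this]

lemma choquardEnergy_weight_mono (h : SubcriticalPower N s α t) (hw : CondW w winf wmax)
    {w' : Space N → ℝ} {winf' wmax' : ℝ} (hw' : CondW w' winf' wmax') (hle : ∀ x, w x ≤ w' x)
    (hu : MemHs s u) : choquardEnergy α t w u ≤ choquardEnergy α t w' u := by
  obtain ⟨ρ₁, ρ₂, κ, hS⟩ := h.exists_split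
  have hadm := hu.rieszAdm h.hs0 h.hN h.pos hS
  rw [h.choquardEnergy_eq hw hu, h.choquardEnergy_eq hw' hu]
  refine rieszForm_mono h.hα0 h.hαN hS (hadm.weight hS hw'.memLp.1 hw'.nonneg hw'.le_max)
    (hadm.weight hS hw.memLp.1 hw.nonneg hw.le_max) fun x => ?_
  exact mul_le_mul_of_nonneg_right (hle x) (by positivity)

lemma choquardEnergy_const_weight (h : SubcriticalPower N s α t) {c : ℝ} (hc : 0 < c)
    (hu : MemHs s u) :
    choquardEnergy α t (fun _ => c) u = c ^ 2 * choquardEnergy α t (fun _ => 1) u := by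
  rw [h.choquardEnergy_eq (condW_const hc) hu, h.choquardEnergy_eq (condW_const one_pos) hu,
    ← rieszForm_const_mul]
  simp only [one_mul]

lemma choquardEnergy_one (h : SubcriticalPower N s α t) (hu : MemHs s u) :
    choquardEnergy α t (fun _ => 1) u = rieszForm α (fun x => |u x| ^ t) (fun x => |u x| ^ t) := by
  rw [h.choquardEnergy_eq (condW_const one_pos) hu]
  simp only [one_mul]

lemma choquardEnergy_le (h : SubcriticalPower N s α t) (hw : CondW w winf wmax) (hu : MemHs s u) :
    choquardEnergy α t w u ≤ wmax ^ 2 * choquardEnergy α t (fun _ => 1) u := by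
  rw [← h.choquardEnergy_const_weight hw.max_pos hu]
  exact h.choquardEnergy_weight_mono hw (condW_const hw.max_pos) hw.le_max hu

lemma le_choquardEnergy (h : SubcriticalPower N s α t) (hw : CondW w winf wmax) (hu : MemHs s u) :
    winf ^ 2 * choquardEnergy α t (fun _ => 1) u ≤ choquardEnergy α t w u := by
  rw [← h.choquardEnergy_const_weight hw.lim_pos hu]
  exact h.choquardEnergy_weight_mono (condW_const hw.lim_pos) hw hw.lim_le hu

lemma exists_choquardEnergy_le (h : SubcriticalPower N s α t) :
    ∃ C : ℝ, 0 ≤ C ∧ ∀ u : Space N → ℝ, MemHs s u →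
      choquardEnergy α t (fun _ => 1) u ≤ C * (gagliardoSq s u ^ ((N * t - N - α) / (2 * s)) *
          (∫ x, u x ^ 2) ^ (t - (N * t - N - α) / (2 * s))) := by
  obtain ⟨C, hC, hb⟩ := exists_rieszForm_le_rpow h.hs0 h.hN h.hα0 h.hαN h.lower h.upper
  exact ⟨C, hC, fun u hu => (h.choquardEnergy_one hu).trans_le (hb u hu)⟩

lemma exponent_pos (h : SubcriticalPower N s α t) : 0 < (N * t - N - α) / (2 * s) := by
  have hN : (0 : ℝ) < N := by exact_mod_cast h.hN
  have h1 := h.lower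
  rw [div_lt_iff₀ hN] at h1
  exact div_pos (by linarith) (by linarith [h.hs0])

/-- Passing from the norm to its square halves the exponent: tγ = (Nt - N - α)/(2s). -/
lemma fracNorm_rpow (h : SubcriticalPower N s α t) (u : Space N → ℝ) :
    fracNorm s u ^ (2 * t * gnExponent N s α t)
      = fracForm s u u ^ ((N * t - N - α) / (2 * s)) := by
  have hs := h.hs0
  have ht := h.pos
  have h0 : 0 ≤ fracForm s u u := by
    rw [fracForm_self]
    exact mul_nonneg (by linarith [fracConst_pos (N := N) h.hs0 h.hs1]) gagliardoSq_nonneg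
  rw [fracNorm, Real.sqrt_eq_rpow, ← Real.rpow_mul h0, gnExponent]
  congr 1
  field_simp

lemma normTwo_rpow (h : SubcriticalPower N s α t) (u : Space N → ℝ) :
    normTwo u ^ (2 * t * (1 - gnExponent N s α t))
      = (∫ x, u x ^ 2) ^ (t - (N * t - N - α) / (2 * s)) := by
  have hs := h.hs0
  have ht := h.pos
  have h0 : 0 ≤ ∫ x, u x ^ 2 := integral_nonneg fun x => sq_nonneg _
  rw [normTwo, Real.sqrt_eq_rpow, ← Real.rpow_mul h0, gnExponent]
  congr 1
  field_simp

/-- The infimum in the definition of the optimal constant is attained. -/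
lemma choquardEnergy_le_gnConst (h : SubcriticalPower N s α t) (hu : MemHs s u) :
    choquardEnergy α t (fun _ => 1) u ≤ gnConst N s α t *
      fracForm s u u ^ ((N * t - N - α) / (2 * s)) *
      (∫ x, u x ^ 2) ^ (t - (N * t - N - α) / (2 * s)) := by
  have hc := fracConst_pos (N := N) h.hs0 h.hs1
  set S := {C : ℝ | 0 ≤ C ∧ ∀ u : Space N → ℝ, MemHs s u →
    choquardEnergy α t (fun _ => 1) u
      ≤ C * fracNorm s u ^ (2 * t * gnExponent N s α t)
          * normTwo u ^ (2 * t * (1 - gnExponent N s α t))} with hSdef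
  have hS : S.Nonempty := by
    obtain ⟨C, hC, hb⟩ := h.exists_choquardEnergy_le
    refine ⟨C * (fracConst N s / 2)⁻¹ ^ ((N * t - N - α) / (2 * s)), by positivity, fun v hv => ?_⟩
    rw [h.fracNorm_rpow, h.normTwo_rpow, fracForm_self]
    refine (hb v hv).trans_eq ?_
    rw [Real.mul_rpow (by positivity) gagliardoSq_nonneg, Real.inv_rpow (by positivity)]
    have : (fracConst N s / 2) ^ ((N * t - N - α) / (2 * s)) ≠ 0 := by positivity
    field_simp
  have hform : 0 ≤ fracForm s u u := by
    rw [fracForm_self]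
    exact mul_nonneg (by linarith) gagliardoSq_nonneg
  have hA : 0 ≤ ∫ x, u x ^ 2 := integral_nonneg fun x => sq_nonneg _
  have hmem : ∀ C ∈ S, choquardEnergy α t (fun _ => 1) u ≤ C *
      (fracForm s u u ^ ((N * t - N - α) / (2 * s)) *
        (∫ x, u x ^ 2) ^ (t - (N * t - N - α) / (2 * s))) := fun C hC => by
    have := hC.2 u hu
    rwa [h.fracNorm_rpow, h.normTwo_rpow, mul_assoc] at this
  rw [mul_assoc]
  set X := fracForm s u u ^ ((N * t - N - α) / (2 * s)) *
        (∫ x, u x ^ 2) ^ (t - (N * t - N - α) / (2 * s)) with hX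
  have hX0 : 0 ≤ X := by positivity
  -- Where the right-hand side degenerates to 0, any admissible constant forces the energy to be
  -- nonpositive; otherwise divide and compare with the infimum.
  rcases hX0.eq_or_lt with h0 | hpos
  · obtain ⟨C, hC⟩ := hS
    have := hmem C hC
    rw [← h0, mul_zero] at this
    rwa [← h0, mul_zero]
  · rw [← div_le_iff₀ hpos]
    exact le_csInf hS fun C hC => (div_le_iff₀ hpos).2 (hmem C hC)

lemma gnConst_nonneg : 0 ≤ gnConst N s α t := Real.sInf_nonneg fun _ hC => hC.1

lemma tendsto_choquardEnergy_brezisLieb (h : SubcriticalPower N s α t) (hw : CondW w winf wmax)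
    {v : ℕ → Space N → ℝ} {M : ℝ} (hu : MemHs s u) (hv : ∀ n, MemHs s (v n))
    (hM : ∀ n, ∫ x, v n x ^ 2 ≤ M) (hG : ∀ n, gagliardoSq s (v n) ≤ M)
    (hlim : ∀ᵐ x, Tendsto (fun n => v n x) atTop (𝓝 0)) :
    Tendsto (fun n => choquardEnergy α t w (fun x => u x + v n x) - choquardEnergy α t w u
      - choquardEnergy α t w (v n)) atTop (𝓝 0) := by
  obtain ⟨ρ₁, ρ₂, κ, hS⟩ := h.exists_split
  obtain ⟨C₁, hC₁, h₁⟩ := exists_integral_rpow_le_of_le h.hs0 h.hN hS.lt_mul₁.le hS.mul_lt₁.le M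
  obtain ⟨C₂, hC₂, h₂⟩ := exists_integral_rpow_le_of_le h.hs0 h.hN hS.lt_mul₂.le hS.mul_lt₂.le M
  have hadd : ∀ n, MemHs s (fun x => u x + v n x) := fun n => by
    simpa using hu.lincomb (hv n) 1 1
  simp only [h.choquardEnergy_eq hw hu, h.choquardEnergy_eq hw (hv _),
    h.choquardEnergy_eq hw (hadd _)]
  refine tendsto_rieszForm_brezisLieb h.hα0 h.hαN hS h.pos (M := C₁ + C₂) hw.memLp.1 hw.nonneg
    hw.le_max (hu.rieszAdm h.hs0 h.hN h.pos hS) (fun n => (hv n).rieszAdm h.hs0 h.hN h.pos hS)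
    (fun n => (hadd n).rieszAdm h.hs0 h.hN h.pos hS) (fun n => ?_) (fun n => ?_) hlim
  · simp only [← Real.rpow_mul (abs_nonneg _)]
    linarith [h₁ (v n) (hv n) (hM n) (hG n)]
  · simp only [← Real.rpow_mul (abs_nonneg _)]
    linarith [h₂ (v n) (hv n) (hM n) (hG n)]

end SubcriticalPower

/-! ### Mass scaling of the energy and absence of dichotomy -/

section Energy

variable {N : ℕ} {s α q p a : ℝ} {V f g u v : Space N → ℝ} {Vinf finf fmax ginf gmax : ℝ}

lemma fracForm_self_nonneg (hs0 : 0 < s) (hs1 : s < 1) : 0 ≤ fracForm s u u := by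
  rw [fracForm_self]
  exact mul_nonneg (by linarith [fracConst_pos (N := N) hs0 hs1]) gagliardoSq_nonneg

lemma integral_potential_nonneg (hV : CondV V Vinf) : 0 ≤ ∫ x, V x * u x ^ 2 :=
  integral_nonneg fun x => mul_nonneg (hV.nonneg x) (sq_nonneg _)

lemma integral_sq_lincomb_one (hu : MemLp u 2 volume) (hv : MemLp v 2 volume) (c d : ℝ) :
    ∫ x, (c * u x + d * v x) ^ 2
      = c ^ 2 * (∫ x, u x ^ 2) + 2 * c * d * (∫ x, u x * v x) + d ^ 2 * ∫ x, v x ^ 2 := by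
  simpa using integral_sq_lincomb (w := fun _ : Space N => (1 : ℝ)) (C := 1)
    aestronglyMeasurable_const (by simp) hu hv c d

lemma abs_rpow_sq (c t : ℝ) : (|c| ^ t) ^ 2 = (c ^ 2) ^ t := by
  rw [← sq_abs c, ← Real.rpow_natCast, ← Real.rpow_natCast, ← Real.rpow_mul (abs_nonneg _),
    ← Real.rpow_mul (abs_nonneg _), mul_comm]

lemma energy_const_mul (hq : SubcriticalPower N s α q) (hp : SubcriticalPower N s α p)
    (hf : CondW f finf fmax) (hg : CondW g ginf gmax) (hu : MemHs s u) (c : ℝ) :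
    energy s α q p V f g (fun x => c * u x) =
      c ^ 2 * (1 / 2 * fracForm s u u + 1 / 2 * ∫ x, V x * u x ^ 2)
        - (c ^ 2) ^ q * (1 / (2 * q) * choquardEnergy α q f u)
        - (c ^ 2) ^ p * (1 / (2 * p) * choquardEnergy α p g u) := by
  have h1 : fracForm s (fun x => c * u x) (fun x => c * u x) = c ^ 2 * fracForm s u u := by
    rw [fracForm_self, fracForm_self, gagliardoSq_const_mul]; ring
  have h2 : ∫ x, V x * (c * u x) ^ 2 = c ^ 2 * ∫ x, V x * u x ^ 2 := by
    rw [← integral_const_mul]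
    congr 1
    ext x
    ring
  rw [energy, h1, h2, hq.choquardEnergy_const_mul hf hu, hp.choquardEnergy_const_mul hg hu,
    abs_rpow_sq, abs_rpow_sq]
  ring

/-- The quadratic part scales like θ and the nonlocal terms like θ^q and θ^p, with p, q > 1. The
gain in the p-term is kept because its strict positivity for u ≠ 0 rules out loss of mass; this
takes the place of strict subadditivity of the level. -/
lemma energy_sqrt_mul_le (hq : SubcriticalPower N s α q) (hp : SubcriticalPower N s α p)
    (hf : CondW f finf fmax) (hg : CondW g ginf gmax) (hu : MemHs s u) {θ : ℝ} (hθ : 1 ≤ θ) :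
    energy s α q p V f g (fun x => √θ * u x) ≤ θ * energy s α q p V f g u
      - (θ ^ p - θ) * (1 / (2 * p) * choquardEnergy α p g u) := by
  rw [energy_const_mul hq hp hf hg hu, Real.sq_sqrt (by linarith), energy]
  have h1 : θ ≤ θ ^ q := by
    simpa using Real.rpow_le_rpow_of_exponent_le hθ hq.one_lt.le
  have h2 : 0 ≤ 1 / (2 * q) * choquardEnergy α q f u :=
    mul_nonneg (by have := hq.pos; positivity) (hq.choquardEnergy_nonneg hf hu)
  nlinarith [mul_nonneg (sub_nonneg.2 h1) h2]

/-- Scale u up to mass a and use `energy_sqrt_mul_le`; a function of mass zero has nonnegative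
energy. This bounds the remainder from below in the Brezis-Lieb splitting. -/
lemma mul_energy_inf_le (hq : SubcriticalPower N s α q) (hp : SubcriticalPower N s α p)
    (hV : CondV V Vinf) (hf : CondW f finf fmax) (hg : CondW g ginf gmax) (ha : 0 < a) {m : ℝ}
    (hm : ∀ v ∈ massSphere s a, m ≤ energy s α q p V f g v) (hu : MemHs s u)
    (hua : ∫ x, u x ^ 2 ≤ a) : (∫ x, u x ^ 2) / a * m ≤ energy s α q p V f g u := by
  have h0 : 0 ≤ ∫ x, u x ^ 2 := integral_nonneg fun x => sq_nonneg _
  rcases h0.eq_or_lt with hz | hpos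
  · have hae := ae_eq_zero_of_integral_sq hu.memLp hz.symm
    have hD : ∀ {t : ℝ} {w : Space N → ℝ} {w₀ w₁ : ℝ}, SubcriticalPower N s α t → CondW w w₀ w₁ →
        choquardEnergy α t w u = 0 := fun {t w w₀ w₁} ht hw => by
      rw [ht.choquardEnergy_eq hw hu]
      refine rieszForm_eq_zero_of_ae ?_
      filter_upwards [hae] with x hx
      simp [hx, Real.zero_rpow ht.pos.ne']
    rw [← hz, energy, hD hq hf, hD hp hg]
    have := fracForm_self_nonneg (u := u) hq.hs0 hq.hs1
    have := integral_potential_nonneg (u := u) hV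
    simp only [zero_div, zero_mul, mul_zero, sub_zero]
    positivity
  · set A := ∫ x, u x ^ 2
    have hθ : 1 ≤ a / A := by rwa [one_le_div hpos]
    have hmem : (fun x => √(a / A) * u x) ∈ massSphere s a := by
      refine ⟨hu.const_mul _, ?_⟩
      simp only [mul_pow]
      rw [integral_const_mul, Real.sq_sqrt (by positivity), div_mul_cancel₀ _ hpos.ne']
    have h1 := (hm _ hmem).trans (energy_sqrt_mul_le hq hp hf hg hu hθ)
    have h2 : a / A ≤ (a / A) ^ p := by
      simpa using Real.rpow_le_rpow_of_exponent_le hθ hp.one_lt.le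
    have h3 : 0 ≤ 1 / (2 * p) * choquardEnergy α p g u :=
      mul_nonneg (by have := hp.pos; positivity) (hp.choquardEnergy_nonneg hg hu)
    have h4 : m ≤ a / A * energy s α q p V f g u := by
      nlinarith [mul_nonneg (sub_nonneg.2 h2) h3]
    calc A / a * m ≤ A / a * (a / A * energy s α q p V f g u) := by gcongr
      _ = _ := by field_simp

lemma integral_sq_sub_le (hu : MemLp u 2 volume) (hv : MemLp v 2 volume) :
    ∫ x, (u x - v x) ^ 2 ≤ 2 * (∫ x, u x ^ 2) + 2 * ∫ x, v x ^ 2 := by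
  have h1 := hu.integrable_sq.const_mul 2
  have h2 := hv.integrable_sq.const_mul 2
  rw [← integral_const_mul, ← integral_const_mul, ← integral_add h1 h2]
  refine integral_mono (hu.sub hv).integrable_sq (h1.add h2) fun x => ?_
  beta_reduce
  nlinarith [sq_nonneg (u x + v x)]

/-- The Brezis-Lieb splitting of the energy. -/
lemma tendsto_energy_brezisLieb (hq : SubcriticalPower N s α q) (hp : SubcriticalPower N s α p)
    (hV : CondV V Vinf) (hf : CondW f finf fmax) (hg : CondW g ginf gmax)
    {v : ℕ → Space N → ℝ} {M : ℝ} (hu : MemHs s u) (hv : ∀ n, MemHs s (v n))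
    (hM : ∀ n, ∫ x, v n x ^ 2 ≤ M) (hG : ∀ n, gagliardoSq s (v n) ≤ M)
    (hlim : ∀ᵐ x, Tendsto (fun n => v n x) atTop (𝓝 0)) :
    Tendsto (fun n => energy s α q p V f g (fun x => u x + v n x) - energy s α q p V f g u
      - energy s α q p V f g (v n)) atTop (𝓝 0) := by
  have h1 := tendsto_fracForm_zero hu hv hG hlim
  have h2 : Tendsto (fun n => ∫ x, V x * u x * v n x) atTop (𝓝 0) := by
    refine tendsto_integral_mul_zero ?_ (fun n => (hv n).memLp) hM hlim
    refine (hu.memLp.const_mul Vinf).mono (hV.memLp.1.mul hu.memLp.1)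
      (Eventually.of_forall fun x => ?_)
    rw [norm_mul, norm_mul, Real.norm_eq_abs, Real.norm_of_nonneg hV.lim_nonneg]
    exact mul_le_mul_of_nonneg_right (hV.abs_le x) (norm_nonneg _)
  have h3 := hq.tendsto_choquardEnergy_brezisLieb hf hu hv hM hG hlim
  have h4 := hp.tendsto_choquardEnergy_brezisLieb hg hu hv hM hG hlim
  have h := ((h1.add h2).sub (h3.const_mul (1 / (2 * q)))).sub (h4.const_mul (1 / (2 * p)))
  simp only [mul_zero, add_zero, sub_zero] at h
  refine h.congr fun n => ?_
  have e1 := fracForm_lincomb hu (hv n) 1 1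
  have e2 := integral_sq_lincomb hV.memLp.1 hV.abs_le hu.memLp (hv n).memLp 1 1
  simp only [one_mul, mul_one, one_pow] at e1 e2
  simp only [energy, e1, e2]
  ring

/-- A nonzero almost everywhere limit of a minimizing sequence is a minimizer. -/
lemma mem_massSphere_of_tendsto (hq : SubcriticalPower N s α q) (hp : SubcriticalPower N s α p)
    (hV : CondV V Vinf) (hf : CondW f finf fmax) (hg : CondW g ginf gmax) (ha : 0 < a) {m : ℝ}
    (hm : ∀ v ∈ massSphere s a, m ≤ energy s α q p V f g v) {u : ℕ → Space N → ℝ}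
    {U : Space N → ℝ} {M : ℝ} (hu : ∀ n, u n ∈ massSphere s a) (hG : ∀ n, gagliardoSq s (u n) ≤ M)
    (hJ : Tendsto (fun n => energy s α q p V f g (u n)) atTop (𝓝 m)) (hU : MemHs s U)
    (hUa : ∫ x, U x ^ 2 ≤ a) (hU0 : ¬ U =ᵐ[volume] 0)
    (hlim : ∀ᵐ x, Tendsto (fun n => u n x) atTop (𝓝 (U x))) :
    U ∈ massSphere s a ∧ energy s α q p V f g U ≤ m := by
  set b := ∫ x, U x ^ 2 with hb
  have hb0 : 0 < b := by
    refine lt_of_le_of_ne (integral_nonneg fun x => sq_nonneg _) fun h => hU0 ?_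
    exact ae_eq_zero_of_integral_sq hU.memLp h.symm
  set v : ℕ → Space N → ℝ := fun n x => u n x - U x with hv
  have hvm : ∀ n, MemHs s (v n) := fun n => (hu n).1.sub hU
  set M' := max (2 * a + 2 * b) (2 * M + 2 * gagliardoSq s U)
  have hvM : ∀ n, ∫ x, v n x ^ 2 ≤ M' := fun n =>
    (integral_sq_sub_le (hu n).1.memLp hU.memLp).trans (by
      rw [(hu n).2]; exact le_max_left _ _)
  have hvG : ∀ n, gagliardoSq s (v n) ≤ M' := fun n =>
    (gagliardoSq_sub_le (hu n).1 hU).trans (le_trans (by linarith [hG n]) (le_max_right _ _))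
  have hvlim : ∀ᵐ x, Tendsto (fun n => v n x) atTop (𝓝 0) := by
    filter_upwards [hlim] with x hx
    simpa using hx.sub_const (U x)
  have hadd : ∀ n, (fun x => U x + v n x) = u n := fun n => by ext x; simp [hv]
  have h1 := tendsto_energy_brezisLieb hq hp hV hf hg hU hvm hvM hvG hvlim
  simp only [hadd] at h1
  have h2 : Tendsto (fun n => energy s α q p V f g (v n)) atTop
      (𝓝 (m - energy s α q p V f g U)) := by
    have := (hJ.sub_const (energy s α q p V f g U)).sub h1
    rw [sub_zero] at this
    exact this.congr fun n => by ring
  -- Expanding the mass of U + v n, the cross term tends to 0 by weak convergence.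
  have h3 : Tendsto (fun n => ∫ x, v n x ^ 2) atTop (𝓝 (a - b)) := by
    have h := tendsto_integral_mul_zero hU.memLp (fun n => (hvm n).memLp) hvM hvlim
    have := (h.const_mul 2).const_sub (a - b)
    rw [mul_zero, sub_zero] at this
    refine this.congr fun n => ?_
    have e := integral_sq_lincomb_one hU.memLp (hvm n).memLp 1 1
    simp only [one_mul, mul_one, one_pow] at e
    have e2 : ∫ x, (U x + v n x) ^ 2 = a := by
      rw [← (hu n).2]
      congr 1
      ext x
      rw [← hadd n]
    rw [e2] at e
    linarith
  have h4 : (a - b) / a * m ≤ m - energy s α q p V f g U := by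
    refine le_of_tendsto_of_tendsto ((h3.div_const a).mul_const m) h2 ?_
    filter_upwards [h3.eventually (gt_mem_nhds (by linarith : a - b < a))] with n hn
    exact mul_energy_inf_le hq hp hV hf hg ha hm (hvm n) hn.le
  have h5 : energy s α q p V f g U ≤ b / a * m := by
    have : (a - b) / a * m = m - b / a * m := by field_simp
    linarith
  rcases hUa.lt_or_eq with hlt | heq
  -- If b < a, scaling U up to mass a gives m ≤ (a/b)J(U) minus a positive quantity, while (a/b)J(U)
  -- ≤ m.
  · exfalso
    have hθ : 1 < a / b := by rwa [one_lt_div hb0]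
    have hmem : (fun x => √(a / b) * U x) ∈ massSphere s a := by
      refine ⟨hU.const_mul _, ?_⟩
      simp only [mul_pow]
      rw [integral_const_mul, Real.sq_sqrt (by positivity), div_mul_cancel₀ _ hb0.ne']
    have k1 := (hm _ hmem).trans (energy_sqrt_mul_le hq hp hf hg hU hθ.le)
    have k2 : a / b < (a / b) ^ p := by
      simpa using Real.rpow_lt_rpow_of_exponent_lt hθ hp.one_lt
    have k3 : 0 < 1 / (2 * p) * choquardEnergy α p g U :=
      mul_pos (by have := hp.pos; positivity) (hp.choquardEnergy_pos hg hU hU0)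
    have k4 : a / b * energy s α q p V f g U ≤ a / b * (b / a * m) := by gcongr
    have k5 : a / b * (b / a * m) = m := by field_simp
    nlinarith [mul_pos (sub_pos.2 k2) k3]
  · refine ⟨⟨hU, heq⟩, h5.trans_eq ?_⟩
    rw [heq, div_self ha.ne', one_mul]

end Energy

/-! ### Sequences tending to zero: replacing the coefficients by their limits, and Lions vanishing
-/

section Vanishing

variable {N : ℕ} {s α t R ρ₁ ρ₂ : ℝ} {κ : Space N → ℝ}

lemma rieszForm_mul_inv {c : ℝ} (hc : c ≠ 0) (h k : Space N → ℝ) :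
    rieszForm α (fun x => c⁻¹ * h x) (fun x => c * k x) = rieszForm α h k := by
  unfold rieszForm
  congr 1
  ext z
  field_simp

lemma rieszForm_comm (h k : Space N → ℝ) : rieszForm α h k = rieszForm α k h := by
  unfold rieszForm
  rw [← integral_prod_swap]
  congr 1
  ext z
  simp only [Prod.fst_swap, Prod.snd_swap]
  rw [← rieszKernel_neg, neg_sub]
  ring

/-- The Young bound contains terms in k alone, which do not tend to 0. The form is unchanged under
(h, k) ↦ (θ⁻¹h, θk), so these terms can first be made small by a choice of θ; then h n → 0 handles
the rest. -/
lemma tendsto_rieszForm_zero (hα0 : 0 < α) (hαN : α < N) (hS : RieszSplit α t R ρ₁ ρ₂ κ)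
    {h k : ℕ → Space N → ℝ} {M : ℝ} (hh : ∀ n, RieszAdm ρ₁ ρ₂ (h n))
    (hk : ∀ n, RieszAdm ρ₁ ρ₂ (k n)) (h₁ : Tendsto (fun n => ∫ x, h n x ^ ρ₁) atTop (𝓝 0))
    (h₂ : Tendsto (fun n => ∫ x, h n x ^ ρ₂) atTop (𝓝 0)) (hM₁ : ∀ n, ∫ x, k n x ^ ρ₁ ≤ M)
    (hM₂ : ∀ n, ∫ x, k n x ^ ρ₂ ≤ M) :
    Tendsto (fun n => rieszForm α (h n) (k n)) atTop (𝓝 0) := by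
  have hκ0 : 0 ≤ ∫ x, κ x := integral_nonneg hS.nonneg
  have hM0 : 0 ≤ M :=
    (integral_nonneg fun x => Real.rpow_nonneg ((hk 0).nonneg x) ρ₁).trans (hM₁ 0)
  have p1 : ∀ n, 0 ≤ ∫ x, h n x ^ ρ₁ := fun n =>
    integral_nonneg fun x => Real.rpow_nonneg ((hh n).nonneg x) ρ₁
  have p2 : ∀ n, 0 ≤ ∫ x, h n x ^ ρ₂ := fun n =>
    integral_nonneg fun x => Real.rpow_nonneg ((hh n).nonneg x) ρ₂
  refine Metric.tendsto_atTop.2 fun ε hε => ?_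
  have hρ₁ := hS.one_lt₁
  have hρ₂ := hS.one_lt₂
  obtain ⟨θ, hθ, hθε⟩ : ∃ θ : ℝ, 0 < θ ∧ (θ ^ ρ₁ * M + θ ^ ρ₂ * M) * ∫ x, κ x < ε := by
    have hc : Tendsto (fun θ : ℝ => (θ ^ ρ₁ * M + θ ^ ρ₂ * M) * ∫ x, κ x) (𝓝 0)
        (𝓝 (((0 : ℝ) ^ ρ₁ * M + (0 : ℝ) ^ ρ₂ * M) * ∫ x, κ x)) :=
      ((((Real.continuousAt_rpow_const _ _ (Or.inr (by linarith))).tendsto).mul_const _).add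
        (((Real.continuousAt_rpow_const _ _ (Or.inr (by linarith))).tendsto).mul_const _)).mul_const _
    rw [Real.zero_rpow (by linarith), Real.zero_rpow (by linarith), zero_mul, add_zero,
      zero_mul] at hc
    obtain ⟨θ, a1, a2⟩ := ((frequently_gt_nhds (0 : ℝ)).and_eventually
      (hc.eventually (gt_mem_nhds hε))).exists
    exact ⟨θ, a1, a2⟩
  have hlim : Tendsto (fun n => ((θ⁻¹ ^ ρ₁ * ∫ x, h n x ^ ρ₁) * (θ ^ ρ₁ * M) +
      ((θ⁻¹ ^ ρ₁ * ∫ x, h n x ^ ρ₁) + θ ^ ρ₁ * M) * ∫ x, κ x) +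
      ((θ⁻¹ ^ ρ₂ * ∫ x, h n x ^ ρ₂) * (θ ^ ρ₂ * M) +
      ((θ⁻¹ ^ ρ₂ * ∫ x, h n x ^ ρ₂) + θ ^ ρ₂ * M) * ∫ x, κ x)) atTop
      (𝓝 (((θ⁻¹ ^ ρ₁ * 0) * (θ ^ ρ₁ * M) + ((θ⁻¹ ^ ρ₁ * 0) + θ ^ ρ₁ * M) * ∫ x, κ x) +
      ((θ⁻¹ ^ ρ₂ * 0) * (θ ^ ρ₂ * M) + ((θ⁻¹ ^ ρ₂ * 0) + θ ^ ρ₂ * M) * ∫ x, κ x))) :=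
    (((h₁.const_mul _).mul_const _).add (((h₁.const_mul _).add_const _).mul_const _)).add
      (((h₂.const_mul _).mul_const _).add (((h₂.const_mul _).add_const _).mul_const _))
  simp only [mul_zero, zero_mul, zero_add] at hlim
  rw [← add_mul] at hlim
  obtain ⟨n₀, hn₀⟩ := eventually_atTop.1 (hlim.eventually (gt_mem_nhds hθε))
  refine ⟨n₀, fun n hn => ?_⟩
  rw [Real.dist_eq, sub_zero, abs_of_nonneg (rieszForm_nonneg hα0 hαN (hh n).nonneg (hk n).nonneg)]
  refine lt_of_le_of_lt ?_ (hn₀ n hn)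
  have hb := rieszForm_le hα0 hαN hS ((hh n).const_mul (inv_pos.2 hθ).le) ((hk n).const_mul hθ.le)
  rw [rieszForm_mul_inv hθ.ne'] at hb
  simp only [Real.mul_rpow (inv_pos.2 hθ).le ((hh n).nonneg _),
    Real.mul_rpow hθ.le ((hk n).nonneg _), integral_const_mul] at hb
  refine hb.trans ?_
  have := hM₁ n
  have := hM₂ n
  have := p1 n
  have := p2 n
  gcongr

lemma exists_rpow_le_mul_add {r r' : ℝ} (hr : 0 < r) (hr' : r < r') {η : ℝ} (hη : 0 < η) :
    ∃ C : ℝ, 0 ≤ C ∧ ∀ y : ℝ, 0 ≤ y → y ^ r ≤ η * y ^ r' + C := by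
  set K := η ^ (1 / (r - r')) with hK
  have hKpos : 0 < K := by positivity
  refine ⟨K ^ r, by positivity, fun y hy => ?_⟩
  rcases le_or_gt y K with hle | hgt
  · have : 0 ≤ η * y ^ r' := by positivity
    have := Real.rpow_le_rpow hy hle hr.le
    linarith
  · have hypos : 0 < y := hKpos.trans hgt
    have h1 : y ^ (r - r') ≤ K ^ (r - r') :=
      Real.rpow_le_rpow_of_nonpos hKpos hgt.le (by linarith)
    have h2 : K ^ (r - r') = η := by
      rw [hK, ← Real.rpow_mul hη.le, one_div, inv_mul_cancel₀ (by linarith), Real.rpow_one]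
    have h3 : y ^ r = y ^ (r - r') * y ^ r' := by
      rw [← Real.rpow_add hypos]; congr 1; ring
    rw [h3]
    have h4 : y ^ (r - r') * y ^ r' ≤ η * y ^ r' := by
      rw [h2] at h1; gcongr
    have : 0 ≤ K ^ r := by positivity
    linarith

/-- Sequences which vanish almost everywhere and are bounded in `H^s` vanish in `L^r` after
multiplication by a weight which vanishes at infinity. -/
lemma tendsto_integral_weight_zero (hs0 : 0 < s) (hN : 0 < N) {d : Space N → ℝ} {D : ℝ}
    (hd : AEStronglyMeasurable d) (hd0 : ∀ x, 0 ≤ d x) (hdD : ∀ x, d x ≤ D)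
    (hdlim : Tendsto d (cocompact (Space N)) (𝓝 0)) {u : ℕ → Space N → ℝ} {M : ℝ}
    (hu : ∀ n, MemHs s (u n)) (hM : ∀ n, ∫ x, u n x ^ 2 ≤ M) (hG : ∀ n, gagliardoSq s (u n) ≤ M)
    (hlim : ∀ᵐ x, Tendsto (fun n => u n x) atTop (𝓝 0)) {r : ℝ} (hr : 2 ≤ r)
    (hr2 : r < 2 + 4 * s / N) :
    Tendsto (fun n => ∫ x, d x * |u n x| ^ r) atTop (𝓝 0) := by
  set r' := 2 + 4 * s / (N : ℝ) with hr'
  have hr'2 : 2 ≤ r' := by linarith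
  obtain ⟨C₁, hC₁, b₁⟩ := exists_integral_rpow_le_of_le hs0 hN hr hr2.le M
  obtain ⟨C₂, hC₂, b₂⟩ := exists_integral_rpow_le_of_le hs0 hN hr'2 le_rfl M
  have i₁ := fun n => (hu n).integrable_rpow hs0 hN hr hr2.le
  have i₂ := fun n => (hu n).integrable_rpow hs0 hN hr'2 le_rfl
  have hD : 0 ≤ D := (hd0 0).trans (hdD 0)
  refine tendsto_integral_zero (A := fun n x => |u n x| ^ r + |u n x| ^ r') (M := C₁ + C₂)
    (fun n => Integrable.weight hd (fun x => by rw [abs_of_nonneg (hd0 x)]; exact hdD x) (i₁ n))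
    ?_ (fun n => (i₁ n).add (i₂ n)) (fun n x => by positivity) (fun n => ?_) fun ε hε => ?_
  · filter_upwards [hlim] with x hx
    have := (hx.abs.rpow_const (p := r) (Or.inr (by linarith))).const_mul (d x)
    simpa [Real.zero_rpow (by linarith : r ≠ 0)] using this
  · rw [integral_add (i₁ n) (i₂ n)]
    exact add_le_add (b₁ _ (hu n) (hM n) (hG n)) (b₂ _ (hu n) (hM n) (hG n))
  -- On a large compact set, |u|^r is a small multiple of |u|^r' plus a constant, which is
  -- integrable there; r' is the endpoint of the embedding, strictly above r. Off the compact set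
  -- the weight itself is below ε.
  · obtain ⟨C, hC, hCb⟩ := exists_rpow_le_mul_add (by linarith : 0 < r) hr2
      (div_pos hε (by linarith : 0 < D + 1))
    have hev := hdlim.eventually (gt_mem_nhds hε)
    obtain ⟨K, hK, hKsub⟩ := mem_cocompact.1 hev
    refine ⟨(closure K).indicator fun _ => D * C,
      (integrable_indicator_iff isClosed_closure.measurableSet).2
        (integrableOn_const hK.closure.measure_lt_top.ne), fun n x => ?_⟩
    have q1 : 0 ≤ |u n x| ^ r := by positivity
    have q2 : 0 ≤ |u n x| ^ r' := by positivity
    rw [abs_of_nonneg (mul_nonneg (hd0 x) q1)]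
    by_cases hx : x ∈ closure K
    · rw [Set.indicator_of_mem hx]
      have h1 := hCb |u n x| (abs_nonneg _)
      have h2 : ε / (D + 1) * D ≤ ε := by
        rw [div_mul_eq_mul_div, div_le_iff₀ (by linarith)]
        nlinarith
      calc d x * |u n x| ^ r ≤ D * (ε / (D + 1) * |u n x| ^ r' + C) := by
            gcongr
            exact hdD x
        _ = (ε / (D + 1) * D) * |u n x| ^ r' + D * C := by ring
        _ ≤ ε * |u n x| ^ r' + D * C := by gcongr
        _ ≤ _ := by nlinarith [mul_nonneg hε.le q1]
    · rw [Set.indicator_of_notMem hx]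
      have hdx : d x < ε := hKsub fun hxK => hx (subset_closure hxK)
      nlinarith [mul_le_mul_of_nonneg_right hdx.le q1, mul_nonneg hε.le q2]

/-- With d = w - w_∞, the product w(x)w(y) - w_∞² is d(x)w(y) + w_∞d(y) ≤ w_max(d(x)+d(y)). The
difference is then controlled by the Riesz form of d|u|^t against |u|^t, and d|u|^t tends to 0 in
both L^ρ because d vanishes at infinity. -/
lemma SubcriticalPower.tendsto_choquardEnergy_sub (h : SubcriticalPower N s α t)
    {w : Space N → ℝ} {winf wmax : ℝ} (hw : CondW w winf wmax) {u : ℕ → Space N → ℝ} {M : ℝ}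
    (hu : ∀ n, MemHs s (u n)) (hM : ∀ n, ∫ x, u n x ^ 2 ≤ M) (hG : ∀ n, gagliardoSq s (u n) ≤ M)
    (hlim : ∀ᵐ x, Tendsto (fun n => u n x) atTop (𝓝 0)) :
    Tendsto (fun n => choquardEnergy α t w (u n) - choquardEnergy α t (fun _ => winf) (u n)) atTop
      (𝓝 0) := by
  obtain ⟨ρ₁, ρ₂, κ, hS⟩ := h.exists_split
  obtain ⟨C₁, hC₁, h₁⟩ := exists_integral_rpow_le_of_le h.hs0 h.hN hS.lt_mul₁.le hS.mul_lt₁.le M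
  obtain ⟨C₂, hC₂, h₂⟩ := exists_integral_rpow_le_of_le h.hs0 h.hN hS.lt_mul₂.le hS.mul_lt₂.le M
  set d : Space N → ℝ := fun x => w x - winf with hd
  have hd0 : ∀ x, 0 ≤ d x := fun x => sub_nonneg.2 (hw.lim_le x)
  have hdD : ∀ x, d x ≤ wmax := fun x => by
    simp only [hd]; linarith [hw.le_max x, hw.lim_pos]
  have hdm : AEStronglyMeasurable d := hw.memLp.1.sub aestronglyMeasurable_const
  have hdlim : Tendsto d (cocompact (Space N)) (𝓝 0) := by
    simpa using hw.tendsto.sub_const winf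
  have hk := fun n => (hu n).rieszAdm h.hs0 h.hN h.pos hS
  have hh := fun n => (hk n).weight hS hdm hd0 hdD
  have hz : ∀ ρ : ℝ, 1 < ρ → 2 < t * ρ → t * ρ < 2 + 4 * s / N →
      Tendsto (fun n => ∫ x, (d x * |u n x| ^ t) ^ ρ) atTop (𝓝 0) := by
    intro ρ hρ hρ1 hρ2
    have := tendsto_integral_weight_zero h.hs0 h.hN (d := fun x => d x ^ ρ) (D := wmax ^ ρ)
      ((Real.continuous_rpow_const (by linarith)).comp_aestronglyMeasurable hdm)
      (fun x => Real.rpow_nonneg (hd0 x) _)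
      (fun x => Real.rpow_le_rpow (hd0 x) (hdD x) (by linarith))
      (by simpa [Real.zero_rpow (by linarith : ρ ≠ 0)] using
        hdlim.rpow_const (p := ρ) (Or.inr (by linarith))) hu hM hG hlim hρ1.le hρ2
    refine this.congr fun n => ?_
    congr 1
    ext x
    rw [Real.mul_rpow (hd0 x) (by positivity), ← Real.rpow_mul (abs_nonneg _)]
  have hmain := tendsto_rieszForm_zero h.hα0 h.hαN hS (M := C₁ + C₂) hh hk
    (hz ρ₁ hS.one_lt₁ hS.lt_mul₁ hS.mul_lt₁) (hz ρ₂ hS.one_lt₂ hS.lt_mul₂ hS.mul_lt₂)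
    (fun n => by
      simp only [← Real.rpow_mul (abs_nonneg _)]
      linarith [h₁ (u n) (hu n) (hM n) (hG n)])
    (fun n => by
      simp only [← Real.rpow_mul (abs_nonneg _)]
      linarith [h₂ (u n) (hu n) (hM n) (hG n)])
  have hmain2 := hmain.const_mul (2 * wmax)
  rw [mul_zero] at hmain2
  refine squeeze_zero (fun n => sub_nonneg.2 ?_) (fun n => ?_) hmain2
  · exact h.choquardEnergy_weight_mono (condW_const hw.lim_pos) hw hw.lim_le (hu n)
  · have j1 := integrable_rieszIntegrand h.hα0 h.hαN hS (hh n) (hk n)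
    have j2 := integrable_rieszIntegrand h.hα0 h.hαN hS (hk n) (hh n)
    have e : 2 * wmax * rieszForm α (fun x => d x * |u n x| ^ t) (fun x => |u n x| ^ t) =
        wmax * (rieszForm α (fun x => d x * |u n x| ^ t) (fun x => |u n x| ^ t) +
          rieszForm α (fun x => |u n x| ^ t) (fun x => d x * |u n x| ^ t)) := by
      rw [rieszForm_comm (fun x => |u n x| ^ t)]; ring
    rw [e, h.choquardEnergy_eq hw (hu n), h.choquardEnergy_eq (condW_const hw.lim_pos) (hu n)]
    have i1 := h.integrable_form hw (hu n)
    have i2 := h.integrable_form (condW_const hw.lim_pos) (hu n)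
    unfold rieszForm
    rw [← integral_sub i1 i2, ← integral_add j1 j2, ← integral_const_mul]
    refine integral_mono (i1.sub i2) ((j1.add j2).const_mul wmax) fun z => ?_
    have hI := rieszKernel_nonneg h.hα0 h.hαN (z.1 - z.2)
    have k1 := (hk n).nonneg z.1
    have k2 := (hk n).nonneg z.2
    have hww : w z.1 * w z.2 - winf * winf ≤ wmax * (d z.1 + d z.2) := by
      have e2 : w z.1 * w z.2 - winf * winf = d z.1 * w z.2 + winf * d z.2 := by
        simp only [hd]; ring
      have := mul_le_mul_of_nonneg_left (hw.le_max z.2) (hd0 z.1)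
      have := mul_le_mul_of_nonneg_right ((hw.lim_le z.2).trans (hw.le_max z.2)) (hd0 z.2)
      rw [e2]; linarith
    have hkk : 0 ≤ |u n z.1| ^ t * |u n z.2| ^ t * rieszKernel α (z.1 - z.2) := by positivity
    have := mul_le_mul_of_nonneg_right hww hkk
    beta_reduce
    linarith

lemma tendsto_energy_sub {q p : ℝ} (hq : SubcriticalPower N s α q) (hp : SubcriticalPower N s α p)
    {V f g : Space N → ℝ} {Vinf finf fmax ginf gmax : ℝ}
    (hV : CondV V Vinf) (hf : CondW f finf fmax) (hg : CondW g ginf gmax)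
    {u : ℕ → Space N → ℝ} {M : ℝ}
    (hu : ∀ n, MemHs s (u n)) (hM : ∀ n, ∫ x, u n x ^ 2 ≤ M) (hG : ∀ n, gagliardoSq s (u n) ≤ M)
    (hlim : ∀ᵐ x, Tendsto (fun n => u n x) atTop (𝓝 0)) :
    Tendsto (fun n => energy s α q p (fun _ => Vinf) (fun _ => finf) (fun _ => ginf) (u n)
      - energy s α q p V f g (u n)) atTop (𝓝 0) := by
  have h1 := hq.tendsto_choquardEnergy_sub hf hu hM hG hlim
  have h2 := hp.tendsto_choquardEnergy_sub hg hu hM hG hlim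
  have hNpos : (0 : ℝ) < N := by exact_mod_cast hq.hN
  have h3 := tendsto_integral_weight_zero hq.hs0 hq.hN (d := fun x => Vinf - V x) (D := Vinf)
    (aestronglyMeasurable_const.sub hV.memLp.1) (fun x => sub_nonneg.2 (hV.le_lim x))
    (fun x => by linarith [hV.nonneg x]) (by simpa using hV.tendsto.const_sub Vinf) hu hM hG hlim
    le_rfl (by have := hq.hs0; have : 0 < 4 * s / N := by positivity
               linarith)
  have h := ((h3.const_mul (1 / 2)).add (h1.const_mul (1 / (2 * q)))).add
    (h2.const_mul (1 / (2 * p)))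
  simp only [mul_zero, add_zero] at h
  refine h.congr fun n => ?_
  have e : ∫ x, (Vinf - V x) * |u n x| ^ (2 : ℝ) =
      (∫ x, Vinf * u n x ^ 2) - ∫ x, V x * u n x ^ 2 := by
    rw [← integral_sub ((hu n).memLp.integrable_sq.const_mul Vinf)
      (Integrable.weight hV.memLp.1 hV.abs_le (hu n).memLp.integrable_sq)]
    congr 1
    ext x
    rw [Real.rpow_two, sq_abs]
    ring
  rw [e, energy, energy]
  ring

/-- The nonlocal energy tends to `0` along vanishing sequences. -/
lemma SubcriticalPower.tendsto_choquardEnergy_zero (h : SubcriticalPower N s α t)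
    {w : Space N → ℝ} {winf wmax : ℝ} (hw : CondW w winf wmax) {u : ℕ → Space N → ℝ} {M : ℝ}
    (hu : ∀ n, MemHs s (u n)) (hM : ∀ n, ∫ x, u n x ^ 2 ≤ M) (hG : ∀ n, gagliardoSq s (u n) ≤ M)
    (hvan : ∀ E : ℝ, 0 < E → ∀ᶠ n in atTop, ∀ x, ∫ y in Metric.ball x 1, u n y ^ 2 ≤ E) :
    Tendsto (fun n => choquardEnergy α t w (u n)) atTop (𝓝 0) := by
  obtain ⟨ρ₁, ρ₂, κ, hS⟩ := h.exists_split
  obtain ⟨C₁, hC₁, h₁⟩ := exists_integral_rpow_le_of_le h.hs0 h.hN hS.lt_mul₁.le hS.mul_lt₁.le M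
  obtain ⟨C₂, hC₂, h₂⟩ := exists_integral_rpow_le_of_le h.hs0 h.hN hS.lt_mul₂.le hS.mul_lt₂.le M
  have hk := fun n => (hu n).rieszAdm h.hs0 h.hN h.pos hS
  have hM0 : 0 ≤ M := gagliardoSq_nonneg.trans (hG 0)
  have hz : ∀ r : ℝ, 2 < r → r < 2 + 4 * s / N →
      Tendsto (fun n => ∫ x, |u n x| ^ r) atTop (𝓝 0) := by
    intro r hr hr2
    obtain ⟨C, hC, hb⟩ := exists_integral_rpow_le h.hs0 h.hN hr.le hr2.le
    refine Metric.tendsto_atTop.2 fun ε hε => ?_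
    -- For r > 2 the factor E^((r-2)/2) in Lions' inequality tends to 0 with the local mass E.
    obtain ⟨E, hE, hEε⟩ : ∃ E : ℝ, 0 < E ∧ C * (E ^ ((r - 2) / 2) * (M + M)) < ε := by
      have hc : Tendsto (fun E : ℝ => C * (E ^ ((r - 2) / 2) * (M + M))) (𝓝 0)
          (𝓝 (C * ((0 : ℝ) ^ ((r - 2) / 2) * (M + M)))) :=
        (((Real.continuousAt_rpow_const _ _ (Or.inr (by linarith))).tendsto).mul_const _).const_mul _
      rw [Real.zero_rpow (by linarith), zero_mul, mul_zero] at hc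
      obtain ⟨E, a1, a2⟩ := ((frequently_gt_nhds (0 : ℝ)).and_eventually
        (hc.eventually (gt_mem_nhds hε))).exists
      exact ⟨E, a1, a2⟩
    obtain ⟨n₀, hn₀⟩ := eventually_atTop.1 (hvan E hE)
    refine ⟨n₀, fun n hn => ?_⟩
    rw [Real.dist_eq, sub_zero, abs_of_nonneg (integral_nonneg fun x => by positivity)]
    refine lt_of_le_of_lt ((hb (u n) (hu n) E hE (hn₀ n hn)).2.trans ?_) hEε
    have := hM n
    have := hG n
    gcongr
  have hmain := tendsto_rieszForm_zero h.hα0 h.hαN hS (M := C₁ + C₂) hk hk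
    (by simpa only [← Real.rpow_mul (abs_nonneg _)] using hz _ hS.lt_mul₁ hS.mul_lt₁)
    (by simpa only [← Real.rpow_mul (abs_nonneg _)] using hz _ hS.lt_mul₂ hS.mul_lt₂)
    (fun n => by
      simp only [← Real.rpow_mul (abs_nonneg _)]
      linarith [h₁ (u n) (hu n) (hM n) (hG n)])
    (fun n => by
      simp only [← Real.rpow_mul (abs_nonneg _)]
      linarith [h₂ (u n) (hu n) (hM n) (hG n)])
  have hmain2 := hmain.const_mul (wmax ^ 2)
  rw [mul_zero] at hmain2
  refine squeeze_zero (fun n => h.choquardEnergy_nonneg hw (hu n)) (fun n => ?_) hmain2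
  rw [← h.choquardEnergy_one (hu n)]
  exact h.choquardEnergy_le hw (hu n)

end Vanishing

/-! ### Translation invariance of the energy with constant coefficients -/

section Translation

variable {N : ℕ} {s α t : ℝ} {u : Space N → ℝ}

lemma gagliardoKernel_translate (y : Space N) (z : Space N × Space N) :
    gagliardoKernel s (fun x => u (x + y)) (fun x => u (x + y)) z
      = gagliardoKernel s u u (z + (y, y)) := by
  simp [gagliardoKernel]

lemma MemHs.translate (hu : MemHs s u) (y : Space N) : MemHs s (fun x => u (x + y)) := by
  refine ⟨hu.memLp.comp_measurePreserving (measurePreserving_add_right volume y), ?_⟩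
  exact (hu.gagliardo.comp_add_right (y, y)).congr
    (Eventually.of_forall fun z => (gagliardoKernel_translate y z).symm)

lemma gagliardoSq_translate (y : Space N) : gagliardoSq s (fun x => u (x + y)) = gagliardoSq s u := by
  simp only [gagliardoSq, gagliardoKernel_translate]
  exact integral_add_right_eq_self (μ := volume.prod volume) (gagliardoKernel s u u) (y, y)

lemma rieszForm_translate (h k : Space N → ℝ) (y : Space N) :
    rieszForm α (fun x => h (x + y)) (fun x => k (x + y)) = rieszForm α h k := by
  unfold rieszForm
  rw [← integral_add_right_eq_self (μ := volume.prod volume)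
    (fun z : Space N × Space N => h z.1 * k z.2 * rieszKernel α (z.1 - z.2)) (y, y)]
  simp

lemma energy_translate {q p c d e : ℝ} (hq : SubcriticalPower N s α q)
    (hp : SubcriticalPower N s α p) (hd : 0 < d) (he : 0 < e) (hu : MemHs s u) (y : Space N) :
    energy s α q p (fun _ => c) (fun _ => d) (fun _ => e) (fun x => u (x + y))
      = energy s α q p (fun _ => c) (fun _ => d) (fun _ => e) u := by
  have h1 : ∫ x, c * u (x + y) ^ 2 = ∫ x, c * u x ^ 2 :=
    integral_add_right_eq_self (fun x => c * u x ^ 2) y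
  rw [energy, energy, fracForm_self, fracForm_self, gagliardoSq_translate, h1,
    hq.choquardEnergy_eq (condW_const hd) hu, hp.choquardEnergy_eq (condW_const he) hu,
    hq.choquardEnergy_eq (condW_const hd) (hu.translate y),
    hp.choquardEnergy_eq (condW_const he) (hu.translate y),
    rieszForm_translate (fun x => d * |u x| ^ q) (fun x => d * |u x| ^ q),
    rieszForm_translate (fun x => e * |u x| ^ p) (fun x => e * |u x| ^ p)]

end Translation

/-! ### Existence of a minimizer -/

section Existence

variable {N : ℕ} {s α q p a : ℝ} {V f g : Space N → ℝ} {Vinf finf fmax ginf gmax : ℝ}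

/-- The sign conditions V ≤ V_∞, f ≥ f_∞, g ≥ g_∞ enter here. The inequality carries the lower bound
m over to the problem at infinity, and brings a minimizer found there back to the original one. -/
lemma energy_le_energy_const (hq : SubcriticalPower N s α q) (hp : SubcriticalPower N s α p)
    (hV : CondV V Vinf) (hf : CondW f finf fmax) (hg : CondW g ginf gmax) {u : Space N → ℝ}
    (hu : MemHs s u) : energy s α q p V f g u ≤
      energy s α q p (fun _ => Vinf) (fun _ => finf) (fun _ => ginf) u := by
  have h1 := hq.choquardEnergy_weight_mono (condW_const hf.lim_pos) hf hf.lim_le hu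
  have h2 := hp.choquardEnergy_weight_mono (condW_const hg.lim_pos) hg hg.lim_le hu
  have h3 : ∫ x, V x * u x ^ 2 ≤ ∫ x, Vinf * u x ^ 2 :=
    integral_mono (Integrable.weight hV.memLp.1 hV.abs_le hu.memLp.integrable_sq)
      (hu.memLp.integrable_sq.const_mul Vinf)
      fun x => mul_le_mul_of_nonneg_right (hV.le_lim x) (sq_nonneg _)
  have hq0 := hq.pos
  have hp0 := hp.pos
  unfold energy
  gcongr

lemma setIntegral_ball_translate (v : Space N → ℝ) (y : Space N) :
    ∫ x in Metric.ball 0 1, v (x + y) ^ 2 = ∫ x in Metric.ball y 1, v x ^ 2 := by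
  rw [← integral_indicator measurableSet_ball, ← integral_indicator measurableSet_ball,
    ← integral_add_right_eq_self ((Metric.ball y 1).indicator fun x => v x ^ 2) y]
  congr 1
  ext x
  by_cases hx : x ∈ Metric.ball (0 : Space N) 1
  · rw [Set.indicator_of_mem hx, Set.indicator_of_mem]
    simpa [dist_eq_norm] using hx
  · rw [Set.indicator_of_notMem hx, Set.indicator_of_notMem]
    simpa [dist_eq_norm] using hx

/-- Minimizing sequences at a negative level do not vanish. -/
lemma exists_frequently_mass (hq : SubcriticalPower N s α q) (hp : SubcriticalPower N s α p)
    (hV : CondV V Vinf) (hf : CondW f finf fmax) (hg : CondW g ginf gmax) {m M : ℝ} (hm : m < 0)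
    {u : ℕ → Space N → ℝ} (hu : ∀ n, MemHs s (u n)) (hM : ∀ n, ∫ x, u n x ^ 2 ≤ M)
    (hG : ∀ n, gagliardoSq s (u n) ≤ M)
    (hJ : Tendsto (fun n => energy s α q p V f g (u n)) atTop (𝓝 m)) :
    ∃ E : ℝ, 0 < E ∧ ∃ᶠ n in atTop, ∃ y, E < ∫ x in Metric.ball y 1, u n x ^ 2 := by
  -- If local masses vanish uniformly, both nonlocal terms tend to 0 and m becomes a limit of
  -- nonnegative quantities.
  by_contra hcon
  push Not at hcon
  have h1 := hq.tendsto_choquardEnergy_zero hf hu hM hG hcon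
  have h2 := hp.tendsto_choquardEnergy_zero hg hu hM hG hcon
  have h3 := (hJ.add (h1.const_mul (1 / (2 * q)))).add (h2.const_mul (1 / (2 * p)))
  simp only [mul_zero, add_zero] at h3
  refine absurd (ge_of_tendsto' h3 fun n => ?_) (not_le.2 hm)
  have k1 := fracForm_self_nonneg (u := u n) hq.hs0 hq.hs1
  have k2 := integral_potential_nonneg (u := u n) hV
  rw [energy]
  linarith

/-- Existence of a minimizer for a coercive energy which takes a negative value. -/
lemma exists_isMinOn_energy (hq : SubcriticalPower N s α q) (hp : SubcriticalPower N s α p)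
    (hV : CondV V Vinf) (hf : CondW f finf fmax) (hg : CondW g ginf gmax) (ha : 0 < a)
    {δ K : ℝ} (hδ : 0 < δ)
    (hcoer : ∀ u ∈ massSphere s a, δ * gagliardoSq s u - K ≤ energy s α q p V f g u)
    (hneg : ∃ w ∈ massSphere s a, energy s α q p V f g w < 0) :
    ∃ u ∈ massSphere s a, IsMinOn (energy s α q p V f g) (massSphere s a) u := by
  obtain ⟨w, hw, hwneg⟩ := hneg
  set J := energy s α q p V f g with hJdef
  have hbdd : BddBelow (J '' massSphere s a) := by
    refine ⟨-K, ?_⟩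
    rintro _ ⟨v, hv, rfl⟩
    have := hcoer v hv
    have := mul_nonneg hδ.le (gagliardoSq_nonneg (s := s) (u := v))
    linarith
  set m := sInf (J '' massSphere s a) with hm
  have hmle : ∀ v ∈ massSphere s a, m ≤ J v := fun v hv => csInf_le hbdd ⟨v, hv, rfl⟩
  have hmneg : m < 0 := (hmle w hw).trans_lt hwneg
  obtain ⟨b, -, hb, hbmem⟩ := exists_seq_tendsto_sInf (Set.Nonempty.image J ⟨w, hw⟩) hbdd
  choose u hu hub using hbmem
  have hJu : Tendsto (fun n => J (u n)) atTop (𝓝 m) := by simpa only [hub] using hb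
  obtain ⟨B, hB⟩ := hJu.bddAbove_range
  have hJB : ∀ n, J (u n) ≤ B := fun n => hB ⟨n, rfl⟩
  set M := max a ((B + K) / δ) with hM
  have hG : ∀ n, gagliardoSq s (u n) ≤ M := fun n => by
    refine le_trans ?_ (le_max_right _ _)
    rw [le_div_iff₀ hδ]
    linarith [hcoer _ (hu n), hJB n]
  have hL : ∀ n, ∫ x, u n x ^ 2 ≤ M := fun n => (hu n).2.le.trans (le_max_left _ _)
  have of_mem : ∀ U ∈ massSphere s a, J U ≤ m → ∃ u ∈ massSphere s a,
      IsMinOn J (massSphere s a) u :=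
    fun U hU hUm => ⟨U, hU, fun v hv => hUm.trans (hmle v hv)⟩
  obtain ⟨φ, hφ, U, hU, -, hlim⟩ := exists_subseq_tendsto_ae hq.hs0 (fun n => (hu n).1) hL hG
  have mass_le : ∀ {x : ℕ → Space N → ℝ} {X : Space N → ℝ}, (∀ n, x n ∈ massSphere s a) →
      (∀ᵐ z, Tendsto (fun n => x n z) atTop (𝓝 (X z))) → ∫ z, X z ^ 2 ≤ a :=
    fun {x X} hx hX => (integrable_and_integral_le_of_tendsto
      (fun n => (hx n).1.memLp.integrable_sq) (fun n z => sq_nonneg _) (fun n => (hx n).2.le)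
      (hX.mono fun z hz => hz.pow 2)).2
  by_cases hU0 : U =ᵐ[volume] 0
  swap
  · obtain ⟨h1, h2⟩ := mem_massSphere_of_tendsto hq hp hV hf hg ha hmle (fun n => hu (φ n))
      (fun n => hG (φ n)) (hJu.comp hφ.tendsto_atTop) hU (mass_le (fun n => hu (φ n)) hlim) hU0 hlim
    exact of_mem U h1 h2
  have hlim0 : ∀ᵐ x, Tendsto (fun n => u (φ n) x) atTop (𝓝 0) := by
    filter_upwards [hlim, hU0] with x h1 h2
    rwa [h2] at h1
  have hVc : CondV (fun _ : Space N => Vinf) Vinf := condV_const hV.lim_nonneg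
  have hfc := condW_const (N := N) hf.lim_pos
  have hgc := condW_const (N := N) hg.lim_pos
  -- From here on the weak limit is zero, so the sequence does not see the coefficients at finite
  -- distance and the translation-invariant energy J' has the same limit m along it.
  set J' := energy s α q p (fun _ : Space N => Vinf) (fun _ => finf) (fun _ => ginf) with hJ'
  have hJ'u : Tendsto (fun n => J' (u (φ n))) atTop (𝓝 m) := by
    have := (tendsto_energy_sub hq hp hV hf hg (fun n => (hu (φ n)).1) (fun n => hL (φ n))
      (fun n => hG (φ n)) hlim0).add (hJu.comp hφ.tendsto_atTop)
    rw [zero_add] at this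
    exact this.congr fun n => by simp [hJ', hJdef]
  obtain ⟨E, hE, hfreq⟩ := exists_frequently_mass hq hp hVc hfc hgc hmneg
    (fun n => (hu (φ n)).1) (fun n => hL (φ n)) (fun n => hG (φ n)) hJ'u
  obtain ⟨ψ, hψ, hmass⟩ := extraction_of_frequently_atTop hfreq
  choose y hy using hmass
  set x : ℕ → Space N → ℝ := fun n z => u (φ (ψ n)) (z + y n) with hx
  have hxS : ∀ n, x n ∈ massSphere s a := fun n => by
    refine ⟨(hu _).1.translate (y n), ?_⟩
    rw [← (hu (φ (ψ n))).2]
    exact integral_add_right_eq_self (fun z => u (φ (ψ n)) z ^ 2) (y n)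
  have hxG : ∀ n, gagliardoSq s (x n) ≤ M := fun n => by
    rw [hx]; simp only; rw [gagliardoSq_translate]; exact hG _
  have hxL : ∀ n, ∫ z, x n z ^ 2 ≤ M := fun n => (hxS n).2.le.trans (le_max_left _ _)
  have hJ'x : Tendsto (fun n => J' (x n)) atTop (𝓝 m) := by
    refine (hJ'u.comp hψ.tendsto_atTop).congr fun n => ?_
    exact (energy_translate hq hp hf.lim_pos hg.lim_pos (hu _).1 (y n)).symm
  obtain ⟨χ, hχ, X, hX, -, hXlim⟩ := exists_subseq_tendsto_ae hq.hs0 (fun n => (hxS n).1) hxL hxG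
  have hX0 : ¬ X =ᵐ[volume] 0 := by
    intro hX0
    have hXlim0 : ∀ᵐ z, Tendsto (fun n => x (χ n) z) atTop (𝓝 0) := by
      filter_upwards [hXlim, hX0] with z h1 h2
      rwa [h2] at h1
    have hNpos : (0 : ℝ) < N := by exact_mod_cast hq.hN
    -- With the indicator of the unit ball as weight and r = 2: a zero limit would have no mass left
    -- in the unit ball, whereas each translate was centred to have more than E there.
    have h0 := tendsto_integral_weight_zero hq.hs0 hq.hN
      (d := (Metric.ball (0 : Space N) 1).indicator fun _ => 1) (D := 1)
      ((measurable_const.indicator measurableSet_ball).aestronglyMeasurable)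
      (fun z => Set.indicator_nonneg (fun _ _ => zero_le_one) z)
      (fun z => Set.indicator_le_self' (fun _ _ => zero_le_one) z)
      (by
        refine tendsto_const_nhds.congr' ?_
        filter_upwards [(isCompact_closedBall (0 : Space N) 1).compl_mem_cocompact] with z hz
        exact (Set.indicator_of_notMem (fun h => hz (Metric.ball_subset_closedBall h)) _).symm)
      (fun n => (hxS (χ n)).1) (fun n => hxL _) (fun n => hxG _) hXlim0 le_rfl
      (by have := hq.hs0; have : 0 < 4 * s / N := by positivity
          linarith)
    refine absurd (ge_of_tendsto' h0 fun n => ?_) (not_le.2 hE)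
    refine (hy (χ n)).le.trans_eq ?_
    rw [← setIntegral_ball_translate, ← integral_indicator measurableSet_ball]
    congr 1
    ext z
    by_cases hz : z ∈ Metric.ball (0 : Space N) 1
    · simp only [Set.indicator_of_mem hz, one_mul, Real.rpow_two, sq_abs, hx]
    · simp only [Set.indicator_of_notMem hz, zero_mul]
  obtain ⟨h1, h2⟩ := mem_massSphere_of_tendsto hq hp hVc hfc hgc ha
    (fun v hv => (hmle v hv).trans (energy_le_energy_const hq hp hV hf hg hv.1))
    (fun n => hxS (χ n)) (fun n => hxG (χ n)) (hJ'x.comp hχ.tendsto_atTop) hX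
    (mass_le (fun n => hxS (χ n)) hXlim) hX0 hXlim
  exact of_mem X h1 ((energy_le_energy_const hq hp hV hf hg h1.1).trans h2)

end Existence

/-! ### Coercivity below the mass threshold, and negativity of the level -/

section Coercivity

variable {N : ℕ} {s α q p a : ℝ} {f g : Space N → ℝ} {finf fmax ginf gmax : ℝ}

/-- The energy is coercive on spheres of mass below the threshold. -/
lemma exists_coercive (hq : SubcriticalPower N s α q) (hp : SubcriticalPower N s α p)
    (hqp : q < p) (hpdef : p = ((N : ℝ) + 2 * s + α) / N)
    (hf : CondW f finf fmax) (hg : CondW g ginf gmax)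
    (ha0 : 0 < a) (ha : a < massThreshold N s α p gmax) :
    ∃ δ K : ℝ, 0 < δ ∧ ∀ (V : Space N → ℝ) (Vinf : ℝ), CondV V Vinf →
      ∀ u ∈ massSphere s a, δ * gagliardoSq s u - K ≤ energy s α q p V f g u := by
  have hNpos : (0 : ℝ) < N := by exact_mod_cast hq.hN
  have hs := hq.hs0
  have hq0 := hq.pos
  have hp0 := hp.pos
  have hp1 := hp.one_lt
  have hc := fracConst_pos (N := N) hq.hs0 hq.hs1
  have hNp : N * p = N + 2 * s + α := by rw [hpdef]; field_simp
  have ep : (N * p - N - α) / (2 * s) = 1 := by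
    rw [hNp]; field_simp; ring
  have eq1 : (N * q - N - α) / (2 * s) < 1 := by
    rw [← ep]
    gcongr
  obtain ⟨Cq, hCq, hbq⟩ := hq.exists_choquardEnergy_le
  set G := gnConst N s α p with hG
  have hG0 : 0 ≤ G := SubcriticalPower.gnConst_nonneg
  have hthr : a ^ (p - 1) * (G * gmax ^ 2) < p := by
    have h1 : a ^ (p - 1) < (massThreshold N s α p gmax) ^ (p - 1) :=
      Real.rpow_lt_rpow ha0.le ha (by linarith)
    have h2 : 0 ≤ p / (G * gmax ^ 2) := by positivity
    rw [massThreshold, ← Real.rpow_mul h2, one_div, inv_mul_cancel₀ (by linarith),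
      Real.rpow_one] at h1
    have h3 : 0 < a ^ (p - 1) := by positivity
    -- If the product were zero, division by zero would make the threshold power 0, contradicting a
    -- > 0.
    have h4 : 0 < G * gmax ^ 2 := by
      by_contra hcon
      have : G * gmax ^ 2 = 0 := le_antisymm (not_lt.1 hcon) (by positivity)
      rw [this, div_zero] at h1
      linarith
    rwa [lt_div_iff₀ h4] at h1
  -- The fraction of ‖u‖² left after the p-term is subtracted. Half of it absorbs the q-term, which
  -- explains the factor 1/4 in the coercivity constant.
  set σ := 1 / 2 * (1 - a ^ (p - 1) * (G * gmax ^ 2) / p) with hσ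
  have hσ0 : 0 < σ := by
    have : a ^ (p - 1) * (G * gmax ^ 2) / p < 1 := by rwa [div_lt_one hp0]
    rw [hσ]; linarith
  set e := (N * q - N - α) / (2 * s) with he
  set L := 1 / (2 * q) * (fmax ^ 2 * (Cq * a ^ (q - e))) with hL
  have hL0 : 0 ≤ L := by positivity
  obtain ⟨C, hC, hCb⟩ := exists_rpow_le_mul_add hq.exponent_pos eq1
    (by positivity : 0 < σ * fracConst N s / (4 * (L + 1)))
  refine ⟨σ * fracConst N s / 4, L * C, by positivity, fun V Vinf hV u hu => ?_⟩
  have hB0 : 0 ≤ gagliardoSq s u := gagliardoSq_nonneg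
  set B := gagliardoSq s u with hB
  have d1 : choquardEnergy α q f u ≤ fmax ^ 2 * (Cq * (B ^ e * a ^ (q - e))) := by
    refine (hq.choquardEnergy_le hf hu.1).trans ?_
    have := hbq u hu.1
    rw [hu.2] at this
    gcongr
  have d2 : choquardEnergy α p g u ≤ gmax ^ 2 * (G * fracForm s u u * a ^ (p - 1)) := by
    refine (hp.choquardEnergy_le hg hu.1).trans ?_
    have := hp.choquardEnergy_le_gnConst hu.1
    rw [hu.2, ep, Real.rpow_one] at this
    gcongr
  have d3 := integral_potential_nonneg (u := u) hV
  have d1' : 1 / (2 * q) * choquardEnergy α q f u ≤ L * B ^ e := by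
    calc _ ≤ 1 / (2 * q) * (fmax ^ 2 * (Cq * (B ^ e * a ^ (q - e)))) := by gcongr
      _ = _ := by rw [hL]; ring
  have d2' : 1 / (2 * p) * choquardEnergy α p g u ≤
      1 / 2 * fracForm s u u - σ * fracForm s u u := by
    calc _ ≤ 1 / (2 * p) * (gmax ^ 2 * (G * fracForm s u u * a ^ (p - 1))) := by gcongr
      _ = _ := by rw [hσ]; field_simp; ring
  have d4 : L * B ^ e ≤ σ * fracConst N s / 4 * B + L * C := by
    have h1 := hCb B hB0
    rw [Real.rpow_one] at h1
    have h2 : L * (σ * fracConst N s / (4 * (L + 1))) ≤ σ * fracConst N s / 4 := by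
      rw [mul_div_assoc', div_le_div_iff₀ (by positivity) (by positivity)]
      nlinarith [mul_pos hσ0 hc]
    calc L * B ^ e ≤ L * (σ * fracConst N s / (4 * (L + 1)) * B + C) := by gcongr
      _ = L * (σ * fracConst N s / (4 * (L + 1))) * B + L * C := by ring
      _ ≤ _ := by gcongr
  have d5 : fracForm s u u = fracConst N s / 2 * B := rfl
  rw [energy]
  rw [d5] at d2' ⊢
  linarith

/-- There are functions of arbitrary mass at which the energy without potential is negative. -/
lemma exists_energy_neg (hq : SubcriticalPower N s α q) (hp : SubcriticalPower N s α p)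
    (hqp : q < p) (hpdef : p = ((N : ℝ) + 2 * s + α) / N)
    (hf : CondW f finf fmax) (hg : CondW g ginf gmax) (ha0 : 0 < a) :
    ∃ w ∈ massSphere s a, 1 / 2 * fracForm s w w - 1 / (2 * q) * choquardEnergy α q f w
      - 1 / (2 * p) * choquardEnergy α p g w < 0 := by
  have hNpos : (0 : ℝ) < N := by exact_mod_cast hq.hN
  have hq0 := hq.pos
  have hp0 := hp.pos
  have hNp : N * p = N + 2 * s + α := by rw [hpdef]; field_simp
  set θ := N * q - N - α with hθ
  have hθs : 0 < 2 * s - θ := by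
    have : N * q < N * p := by gcongr
    rw [hθ]; linarith
  obtain ⟨w, hw⟩ := exists_mem_massSphere (N := N) hq.hs0 hq.hs1 hq.hN ha0
  set X := fracForm s w w with hX
  have hX0 : 0 ≤ X := fracForm_self_nonneg hq.hs0 hq.hs1
  set Y := choquardEnergy α q (fun _ => 1) w with hY
  have hYpos : 0 < Y := by
    refine hq.choquardEnergy_pos (condW_const one_pos) hw.1 fun h0 => ha0.ne' ?_
    rw [← hw.2]
    refine integral_eq_zero_of_ae ?_
    filter_upwards [h0] with x hx
    simp [hx]
  -- Under w ↦ τ^(N/2) w(τ·), which keeps the mass, the kinetic term scales like τ^(2s) and the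
  -- q-term like τ^θ with θ < 2s; after division by τ^θ a small τ suffices.
  obtain ⟨τ, hτ, hτlt⟩ : ∃ τ : ℝ, 0 < τ ∧
      1 / 2 * (τ ^ (2 * s - θ) * X) < 1 / (2 * q) * (finf ^ 2 * Y) := by
    have hc : Tendsto (fun τ : ℝ => 1 / 2 * (τ ^ (2 * s - θ) * X)) (𝓝 0)
        (𝓝 (1 / 2 * ((0 : ℝ) ^ (2 * s - θ) * X))) :=
      (((Real.continuousAt_rpow_const _ _ (Or.inr hθs.le)).tendsto).mul_const _).const_mul _
    rw [Real.zero_rpow hθs.ne', zero_mul, mul_zero] at hc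
    have hfp := hf.lim_pos
    obtain ⟨τ, a1, a2⟩ := ((frequently_gt_nhds (0 : ℝ)).and_eventually
      (hc.eventually (gt_mem_nhds (by positivity :
        (0 : ℝ) < 1 / (2 * q) * (finf ^ 2 * Y))))).exists
    exact ⟨τ, a1, a2⟩
  set c := τ ^ ((N : ℝ) / 2) with hcdef
  have hc2 : c ^ 2 = τ ^ (N : ℝ) := by
    rw [hcdef, ← Real.rpow_natCast, ← Real.rpow_mul hτ.le]
    congr 1
    push_cast
    ring
  have hW : MemHs s (fun x => c * w (τ • x)) := hw.1.dilation hτ c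
  refine ⟨fun x => c * w (τ • x), ⟨hW, ?_⟩, ?_⟩
  · rw [integral_sq_dilation hτ, hc2, ← Real.rpow_add hτ, hw.2]
    simp
  · have e1 : fracForm s (fun x => c * w (τ • x)) (fun x => c * w (τ • x)) = τ ^ (2 * s) * X := by
      rw [hX, fracForm_self, fracForm_self, gagliardoSq_dilation hτ, hc2, ← Real.rpow_add hτ]
      rw [show (N : ℝ) + (2 * s - N) = 2 * s by ring]
      ring
    have e2 : choquardEnergy α q (fun _ => 1) (fun x => c * w (τ • x)) = τ ^ θ * Y := by
      rw [hY, hq.choquardEnergy_one hW, hq.choquardEnergy_one hw.1, rieszForm_dilation hτ,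
        abs_rpow_sq, hc2, ← Real.rpow_mul hτ.le, ← Real.rpow_add hτ, hθ]
      congr 2
      ring
    have h1 := hq.le_choquardEnergy hf hW
    rw [e2] at h1
    have h2 := hp.choquardEnergy_nonneg hg hW
    have h3 : 0 ≤ 1 / (2 * p) * choquardEnergy α p g (fun x => c * w (τ • x)) := by positivity
    have h4 : 1 / (2 * q) * (finf ^ 2 * (τ ^ θ * Y)) ≤
        1 / (2 * q) * choquardEnergy α q f (fun x => c * w (τ • x)) := by gcongr
    have hτθ : 0 < τ ^ θ := by positivity
    have h5 := mul_lt_mul_of_pos_left hτlt hτθ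
    have h6 : τ ^ (2 * s) = τ ^ θ * τ ^ (2 * s - θ) := by
      rw [← Real.rpow_add hτ]; congr 1; ring
    rw [e1, h6]
    linarith

end Coercivity

/-! ### Gateaux derivative of the nonlocal energy -/

section Derivative

variable {N : ℕ} {s α t R ρ₁ ρ₂ : ℝ} {κ : Space N → ℝ}

lemma integrable_rieszIntegrand_of_abs_le (hα0 : 0 < α) (hαN : α < N)
    (hS : RieszSplit α t R ρ₁ ρ₂ κ) {h k h' k' : Space N → ℝ} (hh' : RieszAdm ρ₁ ρ₂ h')
    (hk' : RieszAdm ρ₁ ρ₂ k') (hh : AEStronglyMeasurable h) (hk : AEStronglyMeasurable k)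
    (hle : ∀ x, |h x| ≤ h' x) (kle : ∀ x, |k x| ≤ k' x) :
    Integrable (fun z : Space N × Space N => h z.1 * k z.2 * rieszKernel α (z.1 - z.2))
      (volume.prod volume) := by
  refine (integrable_rieszIntegrand hα0 hαN hS hh' hk').mono'
    (aestronglyMeasurable_rieszIntegrand hh hk) (Eventually.of_forall fun z => ?_)
  have hI := rieszKernel_nonneg hα0 hαN (z.1 - z.2)
  rw [Real.norm_eq_abs, abs_mul, abs_mul, abs_of_nonneg hI]
  have := hh'.nonneg z.1
  have := hle z.1
  have := kle z.2
  gcongr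

/-- For |ε| < 1 this function dominates |u+εφ|^t and, up to the factor t, its derivative in ε. It is
the common majorant for differentiation under the integral. -/
lemma MemHs.rieszAdm_add {u φ : Space N → ℝ} (hu : MemHs s u) (hφ : MemHs s φ) (hs0 : 0 < s)
    (hN : 0 < N) (ht : 0 < t) (hS : RieszSplit α t (2 + 4 * s / N) ρ₁ ρ₂ κ) :
    RieszAdm ρ₁ ρ₂ (fun x => (|u x| + |φ x|) ^ t) := by
  have hm : AEStronglyMeasurable (fun x => |u x| + |φ x|) volume :=
    (continuous_abs.comp_aestronglyMeasurable hu.memLp.1).add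
      (continuous_abs.comp_aestronglyMeasurable hφ.memLp.1)
  have key : ∀ r : ℝ, 2 ≤ r → r ≤ 2 + 4 * s / N →
      Integrable fun x => (|u x| + |φ x|) ^ r := by
    intro r hr hr2
    refine (((hu.integrable_rpow hs0 hN hr hr2).add
      (hφ.integrable_rpow hs0 hN hr hr2)).const_mul (2 ^ r)).mono'
      ((Real.continuous_rpow_const (by linarith)).comp_aestronglyMeasurable hm)
      (Eventually.of_forall fun x => ?_)
    rw [Real.norm_of_nonneg (by positivity)]
    simp only [Pi.add_apply]
    have p1 : 0 ≤ |u x| ^ r := by positivity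
    have p2 : 0 ≤ |φ x| ^ r := by positivity
    rcases le_total |u x| |φ x| with hle | hle
    · calc (|u x| + |φ x|) ^ r ≤ (2 * |φ x|) ^ r :=
            Real.rpow_le_rpow (by positivity) (by linarith) (by linarith)
        _ = 2 ^ r * |φ x| ^ r := Real.mul_rpow (by norm_num) (abs_nonneg _)
        _ ≤ _ := by gcongr; linarith
    · calc (|u x| + |φ x|) ^ r ≤ (2 * |u x|) ^ r :=
            Real.rpow_le_rpow (by positivity) (by linarith) (by linarith)
        _ = 2 ^ r * |u x| ^ r := Real.mul_rpow (by norm_num) (abs_nonneg _)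
        _ ≤ _ := by gcongr; linarith
  refine ⟨(Real.continuous_rpow_const ht.le).comp_aestronglyMeasurable hm,
    fun x => by positivity, ?_, ?_⟩
  · have := key _ hS.lt_mul₁.le hS.mul_lt₁.le
    refine this.congr (Eventually.of_forall fun x => ?_)
    beta_reduce
    rw [← Real.rpow_mul (by positivity)]
  · have := key _ hS.lt_mul₂.le hS.mul_lt₂.le
    refine this.congr (Eventually.of_forall fun x => ?_)
    beta_reduce
    rw [← Real.rpow_mul (by positivity)]

lemma abs_rpow_sub_two_mul_le {t y z c : ℝ} (ht : 1 < t) (hyc : |y| ≤ c) (hzc : |z| ≤ c) :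
    |(|y| ^ (t - 2) * y * z)| ≤ c ^ t := by
  have hc : 0 ≤ c := (abs_nonneg _).trans hyc
  rcases eq_or_ne y 0 with rfl | hy
  · simp only [mul_zero, zero_mul, abs_zero]; positivity
  · have hy' : 0 < |y| := abs_pos.2 hy
    have hcpos : 0 < c := hy'.trans_le hyc
    rw [abs_mul, abs_mul, abs_of_nonneg (by positivity : (0 : ℝ) ≤ |y| ^ (t - 2))]
    have e : |y| ^ (t - 2) * |y| = |y| ^ (t - 1) := by
      rw [← Real.rpow_add_one hy'.ne']; congr 1; ring
    have e2 : c ^ t = c ^ (t - 1) * c := by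
      rw [← Real.rpow_add_one hcpos.ne']; congr 1; ring
    rw [e, e2]
    have : |y| ^ (t - 1) ≤ c ^ (t - 1) := Real.rpow_le_rpow hy'.le hyc (by linarith)
    gcongr

lemma aestronglyMeasurable_abs_rpow_mul {u φ : Space N → ℝ} (hu : AEStronglyMeasurable u volume)
    (hφ : AEStronglyMeasurable φ volume) :
    AEStronglyMeasurable (fun x => |u x| ^ (t - 2) * u x * φ x) volume := by
  have : Measurable fun y : ℝ => |y| ^ (t - 2) * y := by fun_prop
  exact (this.comp_aemeasurable hu.aemeasurable).aestronglyMeasurable.mul hφ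

namespace SubcriticalPower

lemma integrable_choquardTerm_form (h : SubcriticalPower N s α t) {w u φ : Space N → ℝ}
    {winf wmax : ℝ} (hw : CondW w winf wmax) (hu : MemHs s u) (hφ : MemHs s φ) :
    Integrable (fun z : Space N × Space N => (w z.1 * (|u z.1| ^ (t - 2) * u z.1 * φ z.1)) *
      (w z.2 * |u z.2| ^ t) * rieszKernel α (z.1 - z.2)) (volume.prod volume) := by
  obtain ⟨ρ₁, ρ₂, κ, hS⟩ := h.exists_split
  have hadm := (hu.rieszAdm_add hφ h.hs0 h.hN h.pos hS).weight hS hw.memLp.1 hw.nonneg hw.le_max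
  refine integrable_rieszIntegrand_of_abs_le h.hα0 h.hαN hS hadm hadm
    (hw.memLp.1.mul (aestronglyMeasurable_abs_rpow_mul hu.memLp.1 hφ.memLp.1))
    (hw.memLp.1.mul (hu.rieszAdm h.hs0 h.hN h.pos hS).aesm) (fun x => ?_) fun x => ?_
  · change |w x * (|u x| ^ (t - 2) * u x * φ x)| ≤ w x * (|u x| + |φ x|) ^ t
    rw [abs_mul, abs_of_nonneg (hw.nonneg x)]
    exact mul_le_mul_of_nonneg_left (abs_rpow_sub_two_mul_le h.one_lt
      (by linarith [abs_nonneg (φ x)]) (by linarith [abs_nonneg (u x)])) (hw.nonneg x)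
  · change |w x * |u x| ^ t| ≤ w x * (|u x| + |φ x|) ^ t
    rw [abs_mul, abs_of_nonneg (hw.nonneg x), abs_of_nonneg (by positivity : 0 ≤ |u x| ^ t)]
    exact mul_le_mul_of_nonneg_left (Real.rpow_le_rpow (abs_nonneg _)
      (by linarith [abs_nonneg (φ x)]) h.pos.le) (hw.nonneg x)

lemma choquardTerm_mul (w u φ : Space N → ℝ) (x : Space N) :
    choquardTerm α t w u x * φ x = rieszPotential α (fun y => w y * |u y| ^ t) x *
      (w x * (|u x| ^ (t - 2) * u x * φ x)) := by
  rw [choquardTerm]; ring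

lemma integrable_choquardTerm_mul (h : SubcriticalPower N s α t) {w u φ : Space N → ℝ}
    {winf wmax : ℝ} (hw : CondW w winf wmax) (hu : MemHs s u) (hφ : MemHs s φ) :
    Integrable fun x => choquardTerm α t w u x * φ x := by
  simp only [choquardTerm_mul]
  exact integrable_rieszPotential_mul (h.integrable_choquardTerm_form hw hu hφ)

lemma integral_choquardTerm_mul (h : SubcriticalPower N s α t) {w u φ : Space N → ℝ}
    {winf wmax : ℝ} (hw : CondW w winf wmax) (hu : MemHs s u) (hφ : MemHs s φ) :
    ∫ x, choquardTerm α t w u x * φ x =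
      rieszForm α (fun x => w x * (|u x| ^ (t - 2) * u x * φ x)) (fun x => w x * |u x| ^ t) := by
  simp only [choquardTerm_mul]
  exact integral_rieszPotential_mul (h.integrable_choquardTerm_form hw hu hφ)

/-- Pair the density with an everywhere positive admissible function k. Fubini makes k(x) times the
convolution integrand integrable in y for almost every x, and k(x) can be divided out. -/
lemma ae_integrable_rieszKernel_mul (h : SubcriticalPower N s α t) {w u : Space N → ℝ}
    {winf wmax : ℝ} (hw : CondW w winf wmax) (hu : MemHs s u) :
    ∀ᵐ x, Integrable fun y => rieszKernel α (x - y) * (w y * |u y| ^ t) := by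
  obtain ⟨ρ₁, ρ₂, κ, hS⟩ := h.exists_split
  set k : Space N → ℝ := fun x => (1 + ‖x‖) ^ (-((N : ℝ) + 1)) with hk
  have hkint : Integrable k := integrable_one_add_norm (by simp)
  have hkpos : ∀ x, 0 < k x := fun x => by positivity
  have hk1 : ∀ x, k x ≤ 1 := fun x =>
    Real.rpow_le_one_of_one_le_of_nonpos (by linarith [norm_nonneg x])
      (by linarith [N.cast_nonneg (α := ℝ)])
  have hkρ : ∀ ρ : ℝ, 1 < ρ → Integrable fun x => k x ^ ρ := fun ρ hρ => by
    refine hkint.mono' ((Real.continuous_rpow_const (by linarith)).comp_aestronglyMeasurable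
      hkint.1) (Eventually.of_forall fun x => ?_)
    rw [Real.norm_of_nonneg (Real.rpow_nonneg (hkpos x).le _)]
    exact Real.rpow_le_self_of_le_one (hkpos x).le (hk1 x) hρ.le
  have hkadm : RieszAdm ρ₁ ρ₂ k :=
    ⟨hkint.1, fun x => (hkpos x).le, hkρ _ hS.one_lt₁, hkρ _ hS.one_lt₂⟩
  have hi := integrable_rieszIntegrand h.hα0 h.hαN hS hkadm
    ((hu.rieszAdm h.hs0 h.hN h.pos hS).weight hS hw.memLp.1 hw.nonneg hw.le_max)
  filter_upwards [hi.prod_right_ae] with x hx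
  refine (hx.const_mul (k x)⁻¹).congr (Eventually.of_forall fun y => ?_)
  have := (hkpos x).ne'
  simp only
  field_simp

end SubcriticalPower

lemma hasDerivAt_abs_add_mul_rpow (ht : 1 < t) (y z ε : ℝ) :
    HasDerivAt (fun ε : ℝ => |y + ε * z| ^ t)
      (t * (|y + ε * z| ^ (t - 2) * (y + ε * z) * z)) ε := by
  have h1 : HasDerivAt (fun ε : ℝ => y + ε * z) z ε := by
    simpa using ((hasDerivAt_id ε).mul_const z).const_add y
  have := (hasDerivAt_abs_rpow (y + ε * z) ht).comp ε h1
  refine this.congr_deriv ?_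
  ring

/-- Differentiation of a quadratic Riesz energy along a dominated curve. -/
lemma hasDerivAt_rieszForm (hα0 : 0 < α) (hαN : α < N) {P P' : ℝ → Space N → ℝ}
    {S : Space N → ℝ} {U : Set ℝ} (hU : U ∈ 𝓝 (0 : ℝ))
    (hS : Integrable (fun z : Space N × Space N => S z.1 * S z.2 * rieszKernel α (z.1 - z.2))
      (volume.prod volume))
    (hP : ∀ ε ∈ U, ∀ x, |P ε x| ≤ S x) (hP' : ∀ ε ∈ U, ∀ x, |P' ε x| ≤ S x)
    (hd : ∀ ε x, HasDerivAt (fun ε => P ε x) (t * P' ε x) ε)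
    (hi : ∀ ε, Integrable (fun z : Space N × Space N =>
      P ε z.1 * P ε z.2 * rieszKernel α (z.1 - z.2)) (volume.prod volume))
    (hT : Integrable (fun z : Space N × Space N =>
      P' 0 z.1 * P 0 z.2 * rieszKernel α (z.1 - z.2)) (volume.prod volume)) :
    HasDerivAt (fun ε => rieszForm α (P ε) (P ε)) (2 * t * rieszForm α (P' 0) (P 0)) 0 := by
  have hT2 : Integrable (fun z : Space N × Space N =>
      P' 0 z.2 * P 0 z.1 * rieszKernel α (z.2 - z.1)) (volume.prod volume) := hT.swap
  have hmain := hasDerivAt_integral_of_dominated_loc_of_deriv_le (μ := volume.prod volume)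
    (F := fun (ε : ℝ) (z : Space N × Space N) => P ε z.1 * P ε z.2 * rieszKernel α (z.1 - z.2))
    (F' := fun (ε : ℝ) (z : Space N × Space N) =>
      t * (P' ε z.1 * P ε z.2 * rieszKernel α (z.1 - z.2)) +
      t * (P' ε z.2 * P ε z.1 * rieszKernel α (z.2 - z.1))) (x₀ := (0 : ℝ)) (s := U)
    (bound := fun z => 2 * |t| * (S z.1 * S z.2 * rieszKernel α (z.1 - z.2)))
    hU (Eventually.of_forall fun ε => (hi ε).1) (hi 0)
    ((hT.const_mul t).add (hT2.const_mul t)).1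
    (Eventually.of_forall fun z ε hε => by
      have hsym : rieszKernel α (z.2 - z.1) = rieszKernel α (z.1 - z.2) := by
        rw [← rieszKernel_neg, neg_sub]
      have hI := rieszKernel_nonneg hα0 hαN (z.1 - z.2)
      have hS1 := (abs_nonneg _).trans (hP ε hε z.1)
      have hS2 := (abs_nonneg _).trans (hP ε hε z.2)
      have a1 : |P' ε z.1 * P ε z.2| ≤ S z.1 * S z.2 := by
        rw [abs_mul]
        exact mul_le_mul (hP' ε hε _) (hP ε hε _) (abs_nonneg _) hS1
      have a2 : |P' ε z.2 * P ε z.1| ≤ S z.1 * S z.2 := by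
        rw [abs_mul, mul_comm (S z.1)]
        exact mul_le_mul (hP' ε hε _) (hP ε hε _) (abs_nonneg _) hS2
      have a3 : |P' ε z.1 * P ε z.2 + P' ε z.2 * P ε z.1| ≤ 2 * (S z.1 * S z.2) :=
        (abs_add_le _ _).trans (by linarith)
      rw [hsym, ← mul_add, ← add_mul, Real.norm_eq_abs, abs_mul, abs_mul, abs_of_nonneg hI]
      calc |t| * (|P' ε z.1 * P ε z.2 + P' ε z.2 * P ε z.1| * rieszKernel α (z.1 - z.2))
          ≤ |t| * (2 * (S z.1 * S z.2) * rieszKernel α (z.1 - z.2)) := by gcongr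
        _ = 2 * |t| * (S z.1 * S z.2 * rieszKernel α (z.1 - z.2)) := by ring)
    (hS.const_mul _)
    (Eventually.of_forall fun z ε hε => by
      have hsym : rieszKernel α (z.2 - z.1) = rieszKernel α (z.1 - z.2) := by
        rw [← rieszKernel_neg, neg_sub]
      refine (((hd ε z.1).mul (hd ε z.2)).mul_const
        (rieszKernel α (z.1 - z.2))).congr_deriv ?_
      rw [hsym]
      ring)
  refine hmain.2.congr_deriv ?_
  rw [integral_add (hT.const_mul t) (hT2.const_mul t), integral_const_mul, integral_const_mul]
  have hsw : ∫ z : Space N × Space N, P' 0 z.2 * P 0 z.1 * rieszKernel α (z.2 - z.1)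
      ∂(volume.prod volume) = rieszForm α (P' 0) (P 0) :=
    integral_prod_swap (μ := (volume : Measure (Space N))) (ν := (volume : Measure (Space N)))
      (fun z : Space N × Space N => P' 0 z.1 * P 0 z.2 * rieszKernel α (z.1 - z.2))
  rw [hsw, ← rieszForm]
  ring

namespace SubcriticalPower

/-- The Gateaux derivative of the nonlocal energy. -/
lemma hasDerivAt_choquardEnergy (h : SubcriticalPower N s α t) {w u φ : Space N → ℝ}
    {winf wmax : ℝ} (hw : CondW w winf wmax) (hu : MemHs s u) (hφ : MemHs s φ) :
    HasDerivAt (fun ε : ℝ => choquardEnergy α t w (fun x => u x + ε * φ x))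
      (2 * t * ∫ x, choquardTerm α t w u x * φ x) 0 := by
  obtain ⟨ρ₁, ρ₂, κ, hS⟩ := h.exists_split
  have hmem : ∀ ε : ℝ, MemHs s (fun x => u x + ε * φ x) := fun ε => by
    simpa using hu.lincomb hφ 1 ε
  have hadm := (hu.rieszAdm_add hφ h.hs0 h.hN h.pos hS).weight hS hw.memLp.1 hw.nonneg hw.le_max
  have hle : ∀ ε ∈ Metric.ball (0 : ℝ) 1, ∀ x, |u x + ε * φ x| ≤ |u x| + |φ x| := by
    intro ε hε x
    rw [mem_ball_zero_iff, Real.norm_eq_abs] at hε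
    refine (abs_add_le _ _).trans ?_
    rw [abs_mul]
    have := mul_le_of_le_one_left (abs_nonneg (φ x)) hε.le
    linarith
  have hT := h.integrable_choquardTerm_form hw hu hφ
  have b1 : ∀ ε ∈ Metric.ball (0 : ℝ) 1, ∀ x,
      |w x * |u x + ε * φ x| ^ t| ≤ w x * (|u x| + |φ x|) ^ t := fun ε hε x => by
    rw [abs_mul, abs_of_nonneg (hw.nonneg x), abs_of_nonneg (Real.rpow_nonneg (abs_nonneg _) _)]
    exact mul_le_mul_of_nonneg_left
      (Real.rpow_le_rpow (abs_nonneg _) (hle ε hε x) h.pos.le) (hw.nonneg x)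
  have b2 : ∀ ε ∈ Metric.ball (0 : ℝ) 1, ∀ x,
      |w x * (|u x + ε * φ x| ^ (t - 2) * (u x + ε * φ x) * φ x)|
        ≤ w x * (|u x| + |φ x|) ^ t := fun ε hε x => by
    rw [abs_mul, abs_of_nonneg (hw.nonneg x)]
    exact mul_le_mul_of_nonneg_left (abs_rpow_sub_two_mul_le h.one_lt (hle ε hε x)
      (by linarith [abs_nonneg (u x)])) (hw.nonneg x)
  have b3 : ∀ (ε : ℝ) (x : Space N), HasDerivAt (fun ε => w x * |u x + ε * φ x| ^ t)
      (t * (w x * (|u x + ε * φ x| ^ (t - 2) * (u x + ε * φ x) * φ x))) ε := fun ε x =>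
    ((hasDerivAt_abs_add_mul_rpow h.one_lt (u x) (φ x) ε).const_mul (w x)).congr_deriv (by ring)
  have hS2 : Integrable (fun z : Space N × Space N => w z.1 * (|u z.1| + |φ z.1|) ^ t *
      (w z.2 * (|u z.2| + |φ z.2|) ^ t) * rieszKernel α (z.1 - z.2)) (volume.prod volume) :=
    integrable_rieszIntegrand h.hα0 h.hαN hS hadm hadm
  have hT2 : Integrable (fun z : Space N × Space N =>
      w z.1 * (|u z.1 + 0 * φ z.1| ^ (t - 2) * (u z.1 + 0 * φ z.1) * φ z.1) *
      (w z.2 * |u z.2 + 0 * φ z.2| ^ t) * rieszKernel α (z.1 - z.2)) (volume.prod volume) := by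
    simpa only [zero_mul, add_zero] using hT
  have hmain := hasDerivAt_rieszForm (t := t) h.hα0 h.hαN
    (P := fun ε x => w x * |u x + ε * φ x| ^ t)
    (P' := fun ε x => w x * (|u x + ε * φ x| ^ (t - 2) * (u x + ε * φ x) * φ x))
    (S := fun x => w x * (|u x| + |φ x|) ^ t)
    (Metric.ball_mem_nhds (0 : ℝ) one_pos) hS2 b1 b2 b3
    (fun ε => h.integrable_form (w := w) (u := fun x => u x + ε * φ x) hw (hmem ε)) hT2
  simp only [zero_mul, add_zero] at hmain
  rw [h.integral_choquardTerm_mul hw hu hφ]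
  simpa only [h.choquardEnergy_eq hw (hmem _)] using hmain

end SubcriticalPower

end Derivative

/-! ### Euler-Lagrange equation -/

section EulerLagrange

variable {N : ℕ} {s α q p a : ℝ} {V f g u : Space N → ℝ} {Vinf finf fmax ginf gmax : ℝ}

/-- Constrained minimizers solve the Euler-Lagrange equation. -/
lemma euler_lagrange (hq : SubcriticalPower N s α q) (hp : SubcriticalPower N s α p)
    (hV : CondV V Vinf) (hf : CondW f finf fmax) (hg : CondW g ginf gmax) (ha : 0 < a)
    (hu : u ∈ massSphere s a) (hmin : IsMinOn (energy s α q p V f g) (massSphere s a) u)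
    {φ : Space N → ℝ} (hφ : MemHs s φ) :
    fracForm s u φ + (∫ x, V x * u x * φ x)
      = (fracForm s u u + (∫ x, V x * u x ^ 2) - choquardEnergy α q f u
          - choquardEnergy α p g u) / a * (∫ x, u x * φ x)
        + (∫ x, choquardTerm α q f u x * φ x) + (∫ x, choquardTerm α p g u x * φ x) := by
  have hq0 := hq.pos
  have hp0 := hp.pos
  set β := ∫ x, u x * φ x with hβ
  set Tq := ∫ x, choquardTerm α q f u x * φ x with hTq
  set Tp := ∫ x, choquardTerm α p g u x * φ x with hTp
  set Q := fracForm s u u + ∫ x, V x * u x ^ 2 with hQ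
  set B := fracForm s u φ + ∫ x, V x * u x * φ x with hB
  set W : ℝ → Space N → ℝ := fun ε x => u x + ε * φ x with hW
  have hmem : ∀ ε : ℝ, MemHs s (W ε) := fun ε => by
    simpa using hu.1.lincomb hφ 1 ε
  have hW0 : W 0 = u := by ext x; simp [hW]
  set n : ℝ → ℝ := fun ε => a + 2 * ε * β + ε ^ 2 * ∫ x, φ x ^ 2 with hn
  have hnW : ∀ ε, ∫ x, W ε x ^ 2 = n ε := fun ε => by
    have := integral_sq_lincomb_one hu.1.memLp hφ.memLp 1 ε
    simp only [one_mul, one_pow, mul_one, hu.2] at this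
    exact this
  have hn0 : n 0 = a := by simp [hn]
  have hnd : HasDerivAt n (2 * β) 0 := by
    have h1 : HasDerivAt (fun ε : ℝ => 2 * ε * β) (2 * β) 0 := by
      simpa using ((hasDerivAt_id (0 : ℝ)).const_mul 2).mul_const β
    have h2 : HasDerivAt (fun ε : ℝ => ε ^ 2 * ∫ x, φ x ^ 2) 0 0 := by
      simpa using (hasDerivAt_pow 2 (0 : ℝ)).mul_const (∫ x, φ x ^ 2)
    exact ((h1.const_add a).add h2).congr_deriv (add_zero _)
  -- √(k ε)(u + εφ) is the perturbation renormalized to mass a; it is an admissible competitor as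
  -- long as n ε > 0.
  set k : ℝ → ℝ := fun ε => a / n ε with hk
  have hk0 : k 0 = 1 := by rw [hk]; simp only; rw [hn0, div_self ha.ne']
  have hkd : HasDerivAt k (-(2 * β / a)) 0 := by
    have := (hasDerivAt_const (0 : ℝ) a).div hnd (by rw [hn0]; exact ha.ne')
    refine this.congr_deriv ?_
    rw [hn0]
    field_simp
    ring
  have hkt : ∀ t : ℝ, HasDerivAt (fun ε => k ε ^ t) (-(2 * β / a) * t) 0 := fun t => by
    have := hkd.rpow_const (p := t) (Or.inl (by rw [hk0]; exact one_ne_zero))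
    rw [hk0, Real.one_rpow, mul_one] at this
    exact this
  set E : ℝ → ℝ := fun ε => fracForm s (W ε) (W ε) + ∫ x, V x * W ε x ^ 2 with hE
  have hE0 : E 0 = Q := by rw [hE]; simp only; rw [hW0]
  have hEd : HasDerivAt E (2 * B) 0 := by
    have e : E = fun ε => Q + 2 * ε * B + ε ^ 2 * (fracForm s φ φ + ∫ x, V x * φ x ^ 2) := by
      ext ε
      have e1 := fracForm_lincomb hu.1 hφ 1 ε
      have e2 := integral_sq_lincomb hV.memLp.1 hV.abs_le hu.1.memLp hφ.memLp 1 ε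
      simp only [one_mul, one_pow, mul_one] at e1 e2
      simp only [hE, hW, e1, e2, hQ, hB]
      ring
    rw [e]
    have h1 : HasDerivAt (fun ε : ℝ => 2 * ε * B) (2 * B) 0 := by
      simpa using ((hasDerivAt_id (0 : ℝ)).const_mul 2).mul_const B
    have h2 : HasDerivAt (fun ε : ℝ => ε ^ 2 * (fracForm s φ φ + ∫ x, V x * φ x ^ 2)) 0 0 := by
      simpa using (hasDerivAt_pow 2 (0 : ℝ)).mul_const (fracForm s φ φ + ∫ x, V x * φ x ^ 2)
    exact ((h1.const_add Q).add h2).congr_deriv (add_zero _)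
  have hDq := hq.hasDerivAt_choquardEnergy hf hu.1 hφ
  have hDp := hp.hasDerivAt_choquardEnergy hg hu.1 hφ
  set Dq : ℝ → ℝ := fun ε => choquardEnergy α q f (W ε) with hDqdef
  set Dp : ℝ → ℝ := fun ε => choquardEnergy α p g (W ε) with hDpdef
  have hDq0 : Dq 0 = choquardEnergy α q f u := by rw [hDqdef]; simp only; rw [hW0]
  have hDp0 : Dp 0 = choquardEnergy α p g u := by rw [hDpdef]; simp only; rw [hW0]
  -- By homogeneity this is the energy along the curve, written so that the normalization is
  -- differentiated as a scalar factor.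
  set J : ℝ → ℝ := fun ε => k ε * (1 / 2 * E ε) - k ε ^ q * (1 / (2 * q) * Dq ε)
    - k ε ^ p * (1 / (2 * p) * Dp ε) with hJ
  have hJd := ((hkd.mul (hEd.const_mul (1 / 2))).sub ((hkt q).mul (hDq.const_mul (1 / (2 * q))))).sub
    ((hkt p).mul (hDp.const_mul (1 / (2 * p))))
  have hnpos : ∀ᶠ ε in 𝓝 (0 : ℝ), 0 < n ε :=
    hnd.continuousAt.eventually (lt_mem_nhds (by rw [hn0]; exact ha))
  have hJe : ∀ ε, 0 < n ε → J ε = energy s α q p V f g (fun x => √(k ε) * W ε x) := by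
    intro ε hε
    have hkpos : 0 ≤ k ε := by simp only [hk]; positivity
    rw [energy_const_mul hq hp hf hg (hmem ε), Real.sq_sqrt hkpos]
    simp only [hJ, hE, hDqdef, hDpdef]
    ring
  have hloc : IsLocalMin J 0 := by
    have h0 : J 0 = energy s α q p V f g u := by
      rw [hJe 0 (by rw [hn0]; exact ha), hk0, hW0]
      simp
    filter_upwards [hnpos] with ε hε
    rw [h0, hJe ε hε]
    refine hmin ⟨(hmem ε).const_mul _, ?_⟩
    simp only [mul_pow]
    rw [integral_const_mul, Real.sq_sqrt (by simp only [hk]; positivity), hnW]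
    simp only [hk]
    field_simp
  have hzero := hloc.hasDerivAt_eq_zero hJd
  -- The product rule with k'(0) = -2β/a; the terms carrying β/a assemble into the multiplier.
  change -(2 * β / a) * (1 / 2 * E 0) + k 0 * (1 / 2 * (2 * B)) -
    (-(2 * β / a) * q * (1 / (2 * q) * Dq 0) + k 0 ^ q * (1 / (2 * q) * (2 * q * Tq))) -
    (-(2 * β / a) * p * (1 / (2 * p) * Dp 0) + k 0 ^ p * (1 / (2 * p) * (2 * p * Tp))) = 0 at hzero
  rw [hk0, hE0, hDq0, hDp0, Real.one_rpow, Real.one_rpow] at hzero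
  field_simp at hzero ⊢
  linarith

end EulerLagrange

end FracChoquard

theorem theorem2 (N : ℕ) (s α q p : ℝ)
    (hs0 : 0 < s) (hs1 : s < 1) (hN : 2 * s < N) (hα0 : 0 < α) (hαN : α < N)
    (hq : ((N : ℝ) + α) / N < q) (hqp : q < p) (hp : p = ((N : ℝ) + 2 * s + α) / N)
    (f g : Space N → ℝ) (finf fmax ginf gmax : ℝ)
    (hf : CondW f finf fmax) (hg : CondW g ginf gmax)
    (a : ℝ) (ha0 : 0 < a) (ha : a < massThreshold N s α p gmax) :
    ∃ Vstar : ℝ, 0 < Vstar ∧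
      ∀ (V : Space N → ℝ) (Vinf : ℝ), CondV V Vinf →
        eLpNorm V ∞ volume < ENNReal.ofReal Vstar →
        ∃ (u : Space N → ℝ) (lam : ℝ),
          u ∈ massSphere s a ∧
          IsWeakSolution s α q p V f g lam u ∧
          lam < 0 ∧
          energy s α q p V f g u < 0 ∧
          IsMinOn (energy s α q p V f g) (massSphere s a) u := by
  have hN' : (0 : ℝ) < N := by linarith
  have hN0 : 0 < N := by exact_mod_cast hN'
  have hpu : p * (2 * N / (N + α)) < 2 + 4 * s / N := by
    have e : p * (2 * N / (N + α)) = 2 + 4 * s / (N + α) := by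
      rw [hp]; field_simp; ring
    rw [e]
    gcongr
    linarith
  have Hp : SubcriticalPower N s α p := ⟨hs0, hs1, hN0, hα0, hαN, hq.trans hqp, hpu⟩
  have Hq : SubcriticalPower N s α q :=
    ⟨hs0, hs1, hN0, hα0, hαN, hq, lt_trans (by gcongr) hpu⟩
  obtain ⟨δ, K, hδ, hcoer⟩ := exists_coercive Hq Hp hqp hp hf hg ha0 ha
  obtain ⟨w, hw, hwneg⟩ := exists_energy_neg Hq Hp hqp hp hf hg ha0
  set e₀ := 1 / 2 * fracForm s w w - 1 / (2 * q) * choquardEnergy α q f w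
      - 1 / (2 * p) * choquardEnergy α p g w with he₀
  -- The potential then contributes at most -e₀/2 at w, so J(w) ≤ e₀/2 < 0; w is chosen before V.
  refine ⟨-e₀ / a, div_pos (by linarith) ha0, fun V Vinf hV hVs => ?_⟩
  have hVle : ∀ᵐ x, V x ≤ -e₀ / a := by
    have h1 := ae_le_eLpNormEssSup (f := V) (μ := volume)
    filter_upwards [h1] with x hx
    rw [eLpNorm_exponent_top] at hVs
    have h2 := hx.trans_lt hVs
    rw [Real.enorm_eq_ofReal (hV.nonneg x)] at h2
    exact ((ENNReal.ofReal_lt_ofReal_iff_of_nonneg (hV.nonneg x)).1 h2).le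
  have hwV : ∫ x, V x * w x ^ 2 ≤ -e₀ := by
    have hsq := hw.1.memLp.integrable_sq
    calc ∫ x, V x * w x ^ 2 ≤ ∫ x, -e₀ / a * w x ^ 2 := by
          refine integral_mono_ae (Integrable.weight hV.memLp.1 hV.abs_le hsq)
            (hsq.const_mul _) ?_
          filter_upwards [hVle] with x hx
          exact mul_le_mul_of_nonneg_right hx (sq_nonneg _)
      _ = -e₀ := by rw [integral_const_mul, hw.2, div_mul_cancel₀ _ ha0.ne']
  have hwE : energy s α q p V f g w < 0 := by
    rw [energy]
    linarith
  obtain ⟨u, hu, hmin⟩ := exists_isMinOn_energy Hq Hp hV hf hg ha0 hδ (hcoer V Vinf hV) ⟨w, hw, hwE⟩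
  have huE : energy s α q p V f g u < 0 := (hmin hw).trans_lt hwE
  refine ⟨u, (fracForm s u u + (∫ x, V x * u x ^ 2) - choquardEnergy α q f u
    - choquardEnergy α p g u) / a, hu, ⟨hu.1, Hq.ae_integrable_rieszKernel_mul hf hu.1,
      Hp.ae_integrable_rieszKernel_mul hg hu.1,
      fun φ hφ => Hq.integrable_choquardTerm_mul hf hu.1 hφ,
      fun φ hφ => Hp.integrable_choquardTerm_mul hg hu.1 hφ,
      fun φ hφ => euler_lagrange Hq Hp hV hf hg ha0 hu hmin hφ⟩, ?_, huE, hmin⟩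
  -- The numerator is at most 2J(u) < 0: in 2J(u) the nonlocal terms carry the factors 1/q and 1/p,
  -- both less than 1.
  refine div_neg_of_neg_of_pos ?_ ha0
  have k1 : 1 / q * choquardEnergy α q f u ≤ choquardEnergy α q f u :=
    mul_le_of_le_one_left (Hq.choquardEnergy_nonneg hf hu.1)
      ((div_le_one Hq.pos).2 Hq.one_lt.le)
  have k2 : 1 / p * choquardEnergy α p g u ≤ choquardEnergy α p g u :=
    mul_le_of_le_one_left (Hp.choquardEnergy_nonneg hg hu.1)
      ((div_le_one Hp.pos).2 Hp.one_lt.le)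
  have e : 2 * energy s α q p V f g u = fracForm s u u + (∫ x, V x * u x ^ 2)
      - 1 / q * choquardEnergy α q f u - 1 / p * choquardEnergy α p g u := by
    have := Hq.pos
    have := Hp.pos
    rw [energy]
    field_simp
  linarith
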